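/- **Setting.** Let $\mathcal U=\{v_1<\dots<v_n\}$ and let $\mathcal F\subseteq 2^{\mathcal U}$ contain $\emptyset$ and at least one nonempty set. A *solution* is a member of $\mathcal F$; let $q$ be the maximum size of a solution. Assume that $\mathcal F$ is *strongly accessible*: if $X\subset Y$ are solutions, some $z\in Y\setminus X$ satisfies $X\cup\{z\}\in\mathcal F$. Call $\mathcal F$ *commutable* if for all solutions $\emptyset\ne X\subset Y$ and $a,b\in Y\setminus X$, $X\cup\{a\},X\cup\{b\}\in\mathcal F$ implies $X\cup\{a,b\}\in\mathcal F$. Put $X^+_A=\{a\in A\setminus X: X\cup\{a\}\in\mathcal F\}$, $X^+=X^+_{\mathcal U}$, $Z=\{x:\{x\}\in\mathcal F\}$, and $\mathrm{source}(X)=\min(X\cap Z)$. Given a rule $\mathrm{choose}(X,A)\in X^+_A$, let $\mathrm{complete}(X,A)$ add $\mathrm{choose}(X,A)$ to $X$ as long as $X^+_A\neq\emptyset$; $\mathrm{complete}(X,A)|_w$ stops, in addition, as soon as $\mathrm{choose}$ returns $w$; and $\mathrm{complete}(X)=\mathrm{complete}(X,\mathcal U)$. For a maximal solution $S$, let $s_1=\mathrm{source}(S),s_2,\dots,s_{|S|}$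 be the order in which $\mathrm{complete}(\{\mathrm{source}(S)\},S)$ collects $S$, and $S[j]=\{s_1,\dots,s_j\}$. Let $j\ge1$ be least with $\mathrm{complete}(S[j])=S$, and $\mathrm{pi}(S)=s_j$. If $j=1$, $S$ is a *root*; otherwise $\mathrm{core}(S)=S[j-1]$, $\mathrm{parent}(S)=\mathrm{complete}(\mathrm{core}(S))$ and $\mathrm r(S)=\mathrm{complete}(\mathrm{core}(S)\cup\{\mathrm{pi}(S)\},\ \mathrm{parent}(S)\cup\{\mathrm{pi}(S)\})$. **Algorithms.** Each calls $\mathrm{spawn}$ on all roots, in increasing order of their sources. $\mathrm{spawn}(P)$ outputs $P$ first if its depth is odd (roots have depth 0), then, for each $w\in\mathcal U$ in increasing order, calls $\mathrm{spawn}$ on the solutions yielded by $\mathrm{children}(P,w)$, and finally outputs $P$ if its depth is even. *Algorithm 1 (basic).* $\mathrm{choose}(X,A)=\min X^+_A$. $\mathrm{children}(P,w)$ runs through all $X\subset P\setminus\{w\}$ with $X\cup\{w\}\in\mathcal F$ and yields $S=\mathrm{complete}(X\cup\{w\})$ if $\langle \mathrm{parent}(S),\mathrm{pi}(S),\mathrm{core}(S)\rangle=\langle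 P,w,X\rangle$. (The sets $X$ are taken in the order of a binary counter.) *Algorithm 2 (refined).* With $t=\mathrm{source}(X)$, $B_0=\{t\}$, $B_i=B_{i-1}\cup(B_{i-1}^+\cap X)$ and $\mathrm{lay}^X(y)=\min\{i\ge1:y\in B_{i-1}^+\}$, $\mathrm{choose}(X,A)$ is the $y\in X^+_A$ with lexicographically least pair $\langle\mathrm{lay}^X(y),y\rangle$. $\mathrm{children}(P,w)$ yields nothing if $w\in P$. Otherwise it runs through the solutions $R$ of the *restricted problem* $\mathrm{restr}(P,w)$, which are the sets $R\ne P$ that are inclusion-maximal among the solutions contained in $P\cup\{w\}$, and for each $R$ through $s\in(R\cap Z)\setminus\{w\}$ in increasing order. It yields $S=\mathrm{complete}\big(\mathrm{complete}(\{s\},R)|_w\cup\{w\}\big)$ if $\langle \mathrm{parent}(S),\mathrm{pi}(S),\mathrm r(S),\mathrm{source}(S)\rangle=\langle P,w,R,s\rangle$. **Stateless versions.** The stateless version of either algorithm is an iterative program that keeps between moves only the current maximal solution $S$, one bit telling whether its subtree is being entered or left, and the parity of its depth. On entering $S$ it moves to the first child of $S$, or, if there is none, to leaving $S$. On leaving $S$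 it recomputes $P=\mathrm{parent}(S)$ and the loop variables that belong to $S$ (which are $(\mathrm{pi}(S),\mathrm{core}(S))$ in Algorithm 1 and $(\mathrm{pi}(S),\mathrm r(S),\mathrm{source}(S))$ in Algorithm 2), resumes the loop of $P$ right after these values, and moves to the next child of $P$, or, if there is none, to leaving $P$; if $S$ is a root it moves to the next root, or stops. It outputs $S$ on entering at odd depth and on leaving at even depth. **Resources.** Programs run on a random access machine with constantly many flags, words (each holding an element of $\mathcal U$ or null) and sets stored as sorted lists of words. An instruction costs $1$ plus the lengths of the lists it handles plus the time of the black box it calls. Space is the number of words in use, including the working space of the black boxes. Let $\mathscr G_T$, $\mathscr G_S$ bound the time (including the time to read $X$) and the working space for testing $X\in\mathcal F$, for all $X$ with $|X|\le q+1$. For every maximal solution $P$ and $w\notin P$, suppose that a black box lists the solutions of $\mathrm{restr}(P,w)$ one by one, without repetition, in an order determined by $(P,w)$, in total time at most $\mathscr R_T$ and space at most $\mathscr R_S\ge q$; let $\mathscr R_B\ge 1$ bound their number. (Restricted problems concern Algorithm 2 only.) The *delay* is the maximum time up to the first output, between consecutive outputs, and from the last output to termination. **Theorem.** Programs and constants below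 do not depend on $n$, $\mathcal F$ or the black boxes. 1. There is a program realizing the stateless version of Algorithm 1 such that, for every strongly accessible $\mathcal F$ as above with $\mathscr G_S=\Omega(q)$, the program halts and outputs the same solutions in the same order as the recursive Algorithm 1, namely all maximal solutions, each exactly once, with delay $O\!\left(q\,2^q\,|\mathcal U|^2\,\mathscr G_T\right)$, and using $O(\mathscr G_S)$ space (the constant in the space bound depends only on the constant in $\mathscr G_S=\Omega(q)$). 2. There is a program realizing the stateless version of Algorithm 2 such that, for every strongly accessible commutable $\mathcal F$ as above, the program halts and outputs the same solutions in the same order as the recursive Algorithm 2, namely all maximal solutions, each exactly once, with delay $O\!\left(\mathscr R_T\,|\mathcal U|+q^3\,|\mathcal U|\,\mathscr G_T\,\mathscr R_B\,|\mathcal U|\right)$, and using $O(\mathscr G_S+\mathscr R_S)$ space. -/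

import Mathlib

/-! Set systems, the two enumeration frameworks, their recursive and stateless versions, and a
machine model with time and space accounting in which the stateless versions are run. -/

open Finset

namespace MaxEnum

section SetSystems

variable {n : ℕ}

/-- `(U, F)` with `U = Fin n` (the elements are identified with their labels) is strongly
accessible. -/
def StronglyAccessible (F : Finset (Finset (Fin n))) : Prop :=
  ∀ X ∈ F, ∀ Y ∈ F, X ⊂ Y → ∃ z ∈ Y \ X, insert z X ∈ F

/-- The commutable property. -/
def Commutable (F : Finset (Finset (Fin n))) : Prop :=
  ∀ X ∈ F, ∀ Y ∈ F, X.Nonempty → X ⊂ Y → ∀ a ∈ Y \ X, ∀ b ∈ Y \ X,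
    insert a X ∈ F → insert b X ∈ F → insert a (insert b X) ∈ F

/-- `S` is a maximal solution (under inclusion). -/
def IsMaxSol (F : Finset (Finset (Fin n))) (S : Finset (Fin n)) : Prop :=
  Maximal (fun X => X ∈ F) S

/-- `q`: the maximum size of a solution. -/
def rank (F : Finset (Finset (Fin n))) : ℕ := F.sup Finset.card

/-- The elements of `X` in increasing order. -/
def sorted (X : Finset (Fin n)) : List (Fin n) := (List.finRange n).filter (fun x => x ∈ X)

/-- `X⁺_A`: the elements of `A` that can be added to `X`. -/
def addable (F : Finset (Finset (Fin n))) (X A : Finset (Fin n)) : Finset (Fin n) :=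
  A.filter (fun a => a ∉ X ∧ insert a X ∈ F)

/-- `Z`: the good singletons. -/
def singles (F : Finset (Finset (Fin n))) : Finset (Fin n) := univ.filter (fun x => {x} ∈ F)

/-- `source(X)`: the smallest element of `X ∩ Z`. -/
def source (F : Finset (Finset (Fin n))) (X : Finset (Fin n)) : Option (Fin n) :=
  (sorted (X ∩ singles F)).head?

/-- A function `choose(X, A)`; it returns `none` exactly when nothing can be added. -/
abbrev Chooser (n : ℕ) : Type := Finset (Fin n) → Finset (Fin n) → Option (Fin n)

/-- `choose` of the basic framework: the minimum of `X⁺_A`. -/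
def chooseMin (F : Finset (Finset (Fin n))) : Chooser n := fun X A => (sorted (addable F X A)).head?

/-- The sets `B_i` of the definition of layers, for `X` and the starting element `t`. -/
def layerSet (F : Finset (Finset (Fin n))) (X : Finset (Fin n)) (t : Fin n) : ℕ → Finset (Fin n)
  | 0 => {t}
  | i + 1 => layerSet F X t i ∪ (addable F (layerSet F X t i) univ ∩ X)

/-- `lay_t^X(y)`: the least `i ≥ 1` with `y ∈ B_{i-1}⁺`, and `0` for `y = t`. (Layers of elements
of `X ∪ X⁺` never exceed `n`.) -/
def lay (F : Finset (Finset (Fin n))) (X : Finset (Fin n)) (t y : Fin n) : ℕ :=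
  ((List.range (n + 1)).find?
    (fun i => 1 ≤ i ∧ y ∈ addable F (layerSet F X t (i - 1)) univ)).getD 0

/-- `choose` of the refined framework: the `y ∈ X⁺_A` with the lexicographically least pair
`⟨lay^X(y), y⟩`, layers being taken from `source(X)`. -/
def chooseLay (F : Finset (Finset (Fin n))) : Chooser n := fun X A =>
  match source F X with
  | none => none
  | some t => (sorted (addable F X A)).argmin (fun y => toLex (lay F X t y, y))

/-- One iteration of the loop of `complete(·, A)`. -/
def grow (ch : Chooser n) (A X : Finset (Fin n)) : Finset (Fin n) :=
  match ch X A with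
  | none => X
  | some x => insert x X

/-- `complete(X, A)`. The loop makes at most `n` iterations; further ones change nothing. -/
def complete (ch : Chooser n) (X A : Finset (Fin n)) : Finset (Fin n) := (grow ch A)^[n] X

/-- `complete(X, A)|_w`: stop as soon as `choose` returns `w`. -/
def completeUntil (ch : Chooser n) (w : Fin n) (X A : Finset (Fin n)) : Finset (Fin n) :=
  (fun Y => if ch Y A = some w then Y else grow ch A Y)^[n] X

/-- `S[j]`, for `1 ≤ j ≤ |S|`: the set of the first `j` elements of the canonical order of `S`,
which is the order in which `complete({source(S)}, S)` collects the elements of `S`. -/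
def pref (F : Finset (Finset (Fin n))) (ch : Chooser n) (S : Finset (Fin n)) (j : ℕ) :
    Finset (Fin n) :=
  match source F S with
  | none => ∅
  | some s => (grow ch S)^[j - 1] {s}

/-- `s_j`, for `1 ≤ j ≤ |S|`: the `j`-th element of the canonical order of `S`. -/
def canon (F : Finset (Finset (Fin n))) (ch : Chooser n) (S : Finset (Fin n)) (j : ℕ) :
    Option (Fin n) :=
  if j ≤ 1 then source F S else ch (pref F ch S (j - 1)) S

/-- The least `j ≥ 1` with `complete(S[j]) = S`. -/
def piIndex (F : Finset (Finset (Fin n))) (ch : Chooser n) (S : Finset (Fin n)) : ℕ :=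
  ((List.range (n + 1)).find? (fun j => 1 ≤ j ∧ complete ch (pref F ch S j) univ = S)).getD 0

/-- `pi(S)`. -/
def pi (F : Finset (Finset (Fin n))) (ch : Chooser n) (S : Finset (Fin n)) : Option (Fin n) :=
  canon F ch S (piIndex F ch S)

/-- `core(S)` (the empty set when `S` is a root). -/
def core (F : Finset (Finset (Fin n))) (ch : Chooser n) (S : Finset (Fin n)) : Finset (Fin n) :=
  if 1 < piIndex F ch S then pref F ch S (piIndex F ch S - 1) else ∅

/-- `parent(S)`; `none` when `S` is a root. -/
def parent (F : Finset (Finset (Fin n))) (ch : Chooser n) (S : Finset (Fin n)) :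
    Option (Finset (Fin n)) :=
  if 1 < piIndex F ch S then some (complete ch (core F ch S) univ) else none

/-- `r(S) = complete(core(S) ∪ {pi(S)}, parent(S) ∪ {pi(S)})` (`none` for a root). -/
def rSol (F : Finset (Finset (Fin n))) (ch : Chooser n) (S : Finset (Fin n)) :
    Option (Finset (Fin n)) :=
  match parent F ch S, pi F ch S with
  | some P, some w => some (complete ch (insert w (core F ch S)) (insert w P))
  | _, _ => none

end SetSystems

section Traversals

variable {n : ℕ} {ι : Type}

/-- The data of a reverse search: `root z` is the root with source `z`, if there is one; the
procedure `children(P, w)`, over all `w`, runs a loop through the values `iters P` of the local loop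
variables, and the pass `i` yields the child `child P i`, or nothing; `resume S` are the values of
the loop variables of `parent S` that belong to the child `S`, as they are computed from `S`
alone. -/
structure Scheme (n : ℕ) (ι : Type) where
  root : Fin n → Option (Finset (Fin n))
  source : Finset (Fin n) → Option (Fin n)
  parent : Finset (Fin n) → Option (Finset (Fin n))
  iters : Finset (Fin n) → List ι
  child : Finset (Fin n) → ι → Option (Finset (Fin n))
  resume : Finset (Fin n) → Option ι

/-- The root with source `z`, if there is one. -/
def rootAt (F : Finset (Finset (Fin n))) (ch : Chooser n) (z : Fin n) : Option (Finset (Fin n)) :=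
  if {z} ∈ F ∧ source F (complete ch {z} univ) = some z ∧
      parent F ch (complete ch {z} univ) = none then
    some (complete ch {z} univ)
  else none

/-- The basic framework. The loop variables are `(w, X)`: `w` runs through `U` in increasing order
and `X` through the sets `X ⊂ P \ {w}` with `X ∪ {w} ∈ F`, in the order of a binary counter. -/
def basic (F : Finset (Finset (Fin n))) : Scheme n (Fin n × Finset (Fin n)) where
  root := rootAt F (chooseMin F)
  source := source F
  parent := parent F (chooseMin F)
  iters P := (List.finRange n).flatMap fun w =>
    (((sorted (P.erase w)).sublists.map List.toFinset).filter
      (fun X => X ⊂ P.erase w ∧ insert w X ∈ F)).map fun X => (w, X)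
  child P i :=
    let S := complete (chooseMin F) (insert i.1 i.2) univ
    if parent F (chooseMin F) S = some P ∧ pi F (chooseMin F) S = some i.1 ∧
        core F (chooseMin F) S = i.2 then some S else none
  resume S := (pi F (chooseMin F) S).map fun w => (w, core F (chooseMin F) S)

/-- The refined framework. The loop variables are `(w, R, s)`: `w ∉ P` runs through `U` in
increasing order, `R ≠ P` through the solutions of the restricted problem for `(P, w)` in the order
in which they are listed, and `s` through `(R ∩ Z) \ {w}` in increasing order. -/
def refined (F : Finset (Finset (Fin n)))
    (restr : Finset (Fin n) → Fin n → List (Finset (Fin n))) :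
    Scheme n (Fin n × Finset (Fin n) × Fin n) where
  root := rootAt F (chooseLay F)
  source := source F
  parent := parent F (chooseLay F)
  iters P := (List.finRange n).flatMap fun w =>
    if w ∈ P then [] else
      ((restr P w).filter (fun R => R ≠ P)).flatMap fun R =>
        (sorted ((R ∩ singles F).erase w)).map fun s => (w, R, s)
  child P i :=
    let coreS := completeUntil (chooseLay F) i.1 {i.2.2} i.2.1
    let S := complete (chooseLay F) (insert i.1 coreS) univ
    if parent F (chooseLay F) S = some P ∧ pi F (chooseLay F) S = some i.1 ∧
        rSol F (chooseLay F) S = some i.2.1 ∧ source F S = some i.2.2 then some S else none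
  resume S :=
    match pi F (chooseLay F) S, rSol F (chooseLay F) S, source F S with
    | some w, some R, some s => some (w, R, s)
    | _, _, _ => none

mutual
/-- `Spawn A odd X out`: the recursive call `spawn(X)` at odd (even) depth terminates, and `out` is
the list of solutions output during it, in order. -/
inductive Spawn (A : Scheme n ι) : Bool → Finset (Fin n) → List (Finset (Fin n)) → Prop
  | call (odd : Bool) (X : Finset (Fin n)) (out : List (Finset (Fin n))) :
      SpawnAll A (!odd) ((A.iters X).filterMap (A.child X)) out →
      Spawn A odd X ((if odd then [X] else []) ++ out ++ (if odd then [] else [X]))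
/-- Successive calls of `spawn` on the members of a list. -/
inductive SpawnAll (A : Scheme n ι) : Bool → List (Finset (Fin n)) → List (Finset (Fin n)) → Prop
  | nil (odd : Bool) : SpawnAll A odd [] []
  | cons (odd : Bool) (X : Finset (Fin n)) (l out₁ out₂ : List (Finset (Fin n))) :
      Spawn A odd X out₁ → SpawnAll A odd l out₂ → SpawnAll A odd (X :: l) (out₁ ++ out₂)
end

/-- The recursive algorithm (roots have depth `0`) terminates with the list `out` of outputs. -/
def RecursiveRun (A : Scheme n ι) (out : List (Finset (Fin n))) : Prop :=
  SpawnAll A false ((List.finRange n).filterMap A.root) out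

/-- What the stateless version remembers: the current solution, whether its subtree is being entered
or left, and the parity of its depth. -/
structure Node (n : ℕ) where
  cur : Finset (Fin n)
  leaving : Bool
  odd : Bool

/-- The part of a loop after the pass with the given values of the loop variables. -/
def after {α : Type} [DecidableEq α] (l : List α) : Option α → List α
  | none => []
  | some a => (l.dropWhile (fun b => b ≠ a)).tail

/-- The first node of the traversal. -/
def Scheme.start (A : Scheme n ι) : Option (Node n) :=
  ((List.finRange n).findSome? A.root).map fun R => ⟨R, false, false⟩

/-- One move of the stateless traversal (`none`: stop). On entering `S` it goes to the first child of
`S`, if any. On leaving `S` it goes back to the parent of `S`, whose loop is resumed right after the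
pass that belongs to `S`; the parent and the loop variables are recomputed from `S`. -/
def Scheme.next [DecidableEq ι] (A : Scheme n ι) (t : Node n) : Option (Node n) :=
  if t.leaving then
    match A.parent t.cur with
    | none =>
        ((after (List.finRange n) (A.source t.cur)).findSome? A.root).map fun R => ⟨R, false, t.odd⟩
    | some P =>
        match (after (A.iters P) (A.resume t.cur)).findSome? (A.child P) with
        | some S => some ⟨S, false, t.odd⟩
        | none => some ⟨P, true, !t.odd⟩
  else
    match (A.iters t.cur).findSome? (A.child t.cur) with
    | some S => some ⟨S, false, !t.odd⟩
    | none => some ⟨t.cur, true, t.odd⟩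

/-- The output of a move: on entering at odd depth, on leaving at even depth. -/
def Scheme.emit (_A : Scheme n ι) (t : Node n) : List (Finset (Fin n)) :=
  if t.leaving = t.odd then [] else [t.cur]

end Traversals

section Machine

/-- The black boxes of an instance: the family `fam` with the time and the working space that a
membership test needs on a given set; and the lister of the restricted problems, with the list that
it produces on `(P, w)`, the time it spends between its `i`-th and its `(i+1)`-st answer (the last
answer being that the list is exhausted), and the space that it occupies while it is active. -/
structure Oracle (n : ℕ) where
  fam : Finset (Finset (Fin n))
  memTime : Finset (Fin n) → ℕ
  memSpace : Finset (Fin n) → ℕ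
  restr : Finset (Fin n) → Fin n → List (Finset (Fin n))
  restrTime : Finset (Fin n) → Fin n → ℕ → ℕ
  restrSpace : Finset (Fin n) → Fin n → ℕ

/-- Time of a membership test: to issue it, to read the set, and to decide. -/
def Oracle.queryTime {n : ℕ} (O : Oracle n) (X : Finset (Fin n)) : ℕ := 1 + #X + O.memTime X

/-- The memory: `k` flags, `k` words holding an element of `U` or a null value, `k` sets, stored as
sorted lists of words, and at most one active lister of a restricted problem, with the number of
answers that it has given. -/
structure Store (n k : ℕ) where
  flag : Fin k → Bool
  elt : Fin k → Option (Fin n)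
  fset : Fin k → Finset (Fin n)
  lister : Option (Finset (Fin n) × Fin n × ℕ)

/-- The instructions of the machine; registers are referred to by number. -/
inductive Instr (k : ℕ) where
  | setFlag (b : Fin k) (v : Bool)
  | clearElt (x : Fin k)
  | copyElt (x y : Fin k)
  | succElt (x : Fin k)
  | nextElt (x s : Fin k)
  | isNull (b x : Fin k)
  | eqElt (b x y : Fin k)
  | ltElt (b x y : Fin k)
  | clearSet (s : Fin k)
  | copySet (s t : Fin k)
  | insertElt (s x : Fin k)
  | eraseElt (s x : Fin k)
  | memElt (b x s : Fin k)
  | eqSet (b s t : Fin k)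
  | query (b s : Fin k)
  | output (s : Fin k)
  | startList (s x : Fin k)
  | nextList (b s : Fin k)
  | stopList

/-- Programs. They do not depend on the instance, not even on `n`. -/
inductive Cmd (k : ℕ) where
  | instr (i : Instr k)
  | seq (c d : Cmd k)
  | cond (b : Fin k) (c d : Cmd k)
  | loop (b : Fin k) (c : Cmd k)

variable {n k : ℕ}

def Store.putFlag (σ : Store n k) (b : Fin k) (v : Bool) : Store n k :=
  { σ with flag := Function.update σ.flag b v }

def Store.putElt (σ : Store n k) (x : Fin k) (v : Option (Fin n)) : Store n k :=
  { σ with elt := Function.update σ.elt x v }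

def Store.putSet (σ : Store n k) (s : Fin k) (v : Finset (Fin n)) : Store n k :=
  { σ with fset := Function.update σ.fset s v }

/-- The first member of an increasing list after `x`; its first member if `x` is null. -/
def nextIn (l : List (Fin n)) : Option (Fin n) → Option (Fin n)
  | none => l.head?
  | some x => l.find? (fun y => x < y)

/-- Effect of an instruction on the memory. -/
def Instr.eval (O : Oracle n) (σ : Store n k) : Instr k → Store n k
  | .setFlag b v => σ.putFlag b v
  | .clearElt x => σ.putElt x none
  | .copyElt x y => σ.putElt x (σ.elt y)
  | .succElt x => σ.putElt x (nextIn (List.finRange n) (σ.elt x))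
  | .nextElt x s => σ.putElt x (nextIn (sorted (σ.fset s)) (σ.elt x))
  | .isNull b x => σ.putFlag b (σ.elt x).isNone
  | .eqElt b x y => σ.putFlag b (decide (σ.elt x = σ.elt y))
  | .ltElt b x y =>
      match σ.elt x, σ.elt y with
      | some u, some v => σ.putFlag b (decide (u < v))
      | _, _ => σ.putFlag b false
  | .clearSet s => σ.putSet s ∅
  | .copySet s t => σ.putSet s (σ.fset t)
  | .insertElt s x =>
      match σ.elt x with
      | some v => σ.putSet s (insert v (σ.fset s))
      | none => σ
  | .eraseElt s x =>
      match σ.elt x with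
      | some v => σ.putSet s ((σ.fset s).erase v)
      | none => σ
  | .memElt b x s =>
      match σ.elt x with
      | some v => σ.putFlag b (decide (v ∈ σ.fset s))
      | none => σ.putFlag b false
  | .eqSet b s t => σ.putFlag b (decide (σ.fset s = σ.fset t))
  | .query b s => σ.putFlag b (decide (σ.fset s ∈ O.fam))
  | .output _ => σ
  | .startList s x => { σ with lister := (σ.elt x).map fun w => (σ.fset s, w, 0) }
  | .nextList b s =>
      match σ.lister with
      | none => σ.putFlag b false
      | some (P, w, i) =>
          match (O.restr P w)[i]? with
          | some R => { (σ.putSet s R).putFlag b true with lister := some (P, w, i + 1) }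
          | none => { σ.putFlag b false with lister := none }
  | .stopList => { σ with lister := none }

/-- Time of an instruction: one unit, plus the lengths of the sets that it handles, plus the time of
the black box that it calls. -/
def Instr.time (O : Oracle n) (σ : Store n k) : Instr k → ℕ
  | .setFlag _ _ | .clearElt _ | .copyElt _ _ | .succElt _ | .isNull _ _ | .eqElt _ _ _
  | .ltElt _ _ _ | .stopList => 1
  | .nextElt _ s | .clearSet s | .insertElt s _ | .eraseElt s _ | .memElt _ _ s | .output s
  | .startList s _ => 1 + #(σ.fset s)
  | .copySet s t | .eqSet _ s t => 1 + #(σ.fset s) + #(σ.fset t)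
  | .query _ s => O.queryTime (σ.fset s)
  | .nextList _ s =>
      match σ.lister with
      | none => 1
      | some (P, w, i) =>
          1 + #(σ.fset s) + #(((O.restr P w)[i]?).getD ∅) + O.restrTime P w i

/-- Number of words in use: the registers, the entries of the stored sets, and the space of the
active lister. -/
def Store.words (O : Oracle n) (σ : Store n k) : ℕ :=
  3 * k + ∑ s, #(σ.fset s) +
    match σ.lister with
    | none => 0
    | some (P, w, _) => O.restrSpace P w

/-- Number of words in use while an instruction is executed. -/
def Instr.space (O : Oracle n) (σ : Store n k) (i : Instr k) : ℕ :=
  max (σ.words O) ((i.eval O σ).words O) +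
    match i with
    | .query _ s => O.memSpace (σ.fset s)
    | _ => 0

/-- A step of a run: its duration, the space in use, and the solution output, if any. -/
structure Event (n : ℕ) where
  time : ℕ
  space : ℕ
  out : Option (Finset (Fin n))

/-- The event of an instruction. -/
def Instr.event (O : Oracle n) (σ : Store n k) (i : Instr k) : Event n where
  time := i.time O σ
  space := i.space O σ
  out := match i with
    | .output s => some (σ.fset s)
    | _ => none

/-- `Exec O c σ tr τ`: the program `c`, started in the memory `σ`, halts in the memory `τ`, and `tr`
is the list of the steps of the run. Testing a flag takes one unit of time. -/
inductive Exec (O : Oracle n) : Cmd k → Store n k → List (Event n) → Store n k → Prop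
  | instr (i : Instr k) (σ : Store n k) : Exec O (.instr i) σ [i.event O σ] (i.eval O σ)
  | seq (c d : Cmd k) (σ τ υ : Store n k) (tr tr' : List (Event n)) :
      Exec O c σ tr τ → Exec O d τ tr' υ → Exec O (.seq c d) σ (tr ++ tr') υ
  | condTrue (b : Fin k) (c d : Cmd k) (σ τ : Store n k) (tr : List (Event n)) :
      σ.flag b = true → Exec O c σ tr τ → Exec O (.cond b c d) σ (⟨1, σ.words O, none⟩ :: tr) τ
  | condFalse (b : Fin k) (c d : Cmd k) (σ τ : Store n k) (tr : List (Event n)) :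
      σ.flag b = false → Exec O d σ tr τ → Exec O (.cond b c d) σ (⟨1, σ.words O, none⟩ :: tr) τ
  | loopStop (b : Fin k) (c : Cmd k) (σ : Store n k) :
      σ.flag b = false → Exec O (.loop b c) σ [⟨1, σ.words O, none⟩] σ
  | loopStep (b : Fin k) (c : Cmd k) (σ τ υ : Store n k) (tr tr' : List (Event n)) :
      σ.flag b = true → Exec O c σ tr τ → Exec O (.loop b c) τ tr' υ →
      Exec O (.loop b c) σ (⟨1, σ.words O, none⟩ :: tr ++ tr') υ

/-- The solutions output during a run, in order. -/
def outputs (tr : List (Event n)) : List (Finset (Fin n)) := tr.filterMap Event.out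

/-- The run has delay at most `D`: the time up to the first output, between two consecutive outputs,
and from the last output to the end is at most `D`. -/
def DelayLE (tr : List (Event n)) (D : ℕ) : Prop :=
  ∀ blk : List (Event n), blk <:+: tr → (∀ e ∈ blk.dropLast, e.out = none) →
    (blk.map Event.time).sum ≤ D

/-- The run uses at most `B` words of space at any time. -/
def SpaceLE (tr : List (Event n)) (B : ℕ) : Prop := ∀ e ∈ tr, e.space ≤ B

/-- The memory that holds a node of the traversal and nothing else: the flag `0` (the traversal goes
on), the flags `1` and `2` (direction and parity), and the set `0` (current solution). The memory of
a finished traversal is blank. -/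
def encode (k : ℕ) : Option (Node n) → Store n (k + 3)
  | none => ⟨fun _ => false, fun _ => none, fun _ => ∅, none⟩
  | some t =>
    { flag := fun i => if i = 0 then true else if i = 1 then t.leaving else
        if i = 2 then t.odd else false
      elt := fun _ => none
      fset := fun i => if i = 0 then t.cur else ∅
      lister := none }

/-- The program `setup; while flag 0 do body` is a stateless version of the recursive algorithm `A`,
with delay at most `D` and space at most `B`: each pass through `body` performs one move of the
stateless traversal, and between two passes the memory holds nothing but the current node; on a blank
memory, the program halts, its outputs are those of the recursive algorithm, in the same order, and
they are the maximal solutions, each once. -/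
structure StatelessVersion {ι : Type} [DecidableEq ι] (A : Scheme n ι) (O : Oracle n)
    (setup body : Cmd (k + 3)) (D B : ℕ) : Prop where
  start : ∃ tr, Exec O setup (encode k none) tr (encode k A.start) ∧ outputs tr = []
  move : ∀ t : Node n, IsMaxSol O.fam t.cur →
    ∃ tr, Exec O body (encode k (some t)) tr (encode k (A.next t)) ∧ outputs tr = A.emit t
  run : ∃ tr, Exec O (.seq setup (.loop 0 body)) (encode k none) tr (encode k none) ∧
    RecursiveRun A (outputs tr) ∧ (outputs tr).Nodup ∧
    (∀ S, S ∈ outputs tr ↔ IsMaxSol O.fam S) ∧ DelayLE tr D ∧ SpaceLE tr B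

/-- Membership in the family is tested in time `GT` and space `GS`, on sets of at most `q + 1`
elements. -/
def Oracle.MemBound (O : Oracle n) (GT GS : ℕ) : Prop :=
  ∀ X : Finset (Fin n), #X ≤ rank O.fam + 1 → O.queryTime X ≤ GT ∧ O.memSpace X ≤ GS

/-- The lister solves the restricted problems: for each maximal solution `P` and each `w ∉ P` it
lists, without repetition, the maximal solutions `R ≠ P` of the system `(P ∪ {w}, F)`, in total time
at most `RT` and space at most `RS`, and there are at most `RB` of them. -/
def Oracle.RestrBound (O : Oracle n) (RT RS RB : ℕ) : Prop :=
  ∀ P, IsMaxSol O.fam P → ∀ w, w ∉ P →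
    (O.restr P w).Nodup ∧
    (∀ R, R ∈ O.restr P w ↔ Maximal (fun X => X ∈ O.fam ∧ X ⊆ insert w P) R ∧ R ≠ P) ∧
    ∑ i ∈ range ((O.restr P w).length + 1), O.restrTime P w i ≤ RT ∧
    O.restrSpace P w ≤ RS ∧ (O.restr P w).length ≤ RB

end Machine

end MaxEnum

namespace MaxEnum

-- Set systems: key-driven choices, completions and canonical orders

section Systems

variable {n : ℕ}

-- Both algorithms are reverse searches: the maximal solutions form a forest under `parent`, and the
-- children of a node are found by trying all values of the loop variables and testing each
-- candidate against the data computed from it.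
--
-- The forest. In both frameworks `choose` takes the addable element with the least key, where the
-- key depends on the current set but not on the domain (`KeyChooser`). At the core of a non-root S
-- the free choice v differs from w = pi(S), lies outside S and has a smaller key
-- (`KeyChooser.nonroot_spec`). So the list of keys of the parent is lexicographically smaller than
-- that of S (`KeyChooser.keyList_parent_lt`), and since there are finitely many sets the parent
-- relation is well founded.
--
-- Finding the children. In Algorithm 1 the pass of S is (pi(S), core(S)), and it only has to be
-- checked that the loop of the parent contains it (`sound_basic`). In Algorithm 2 the core has to
-- be recovered from r(S) and the source (`refined_nonroot`). Here commutability enters: layers of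
-- elements outside a solution can only drop as the solution grows (`lay_anti`), and keys increase
-- along the canonical order (`layKey_pref_lt`). Hence an element outside S that was once preferable
-- to a canonical one cannot be addable to a prefix whose completion is S. It follows that every
-- solution containing core(S) and pi(S) follows the canonical order of S up to pi(S)
-- (`chooseLay_pref_eq`).
--
-- The traversal. `Scheme.Sound` collects what a reverse search needs. From it alone,
-- `Scheme.Sound.run` derives that the recursion and the stateless traversal produce the same list,
-- containing each maximal solution once. The point is that the loop values of a child, recomputed
-- from the child, occur once in the loop of its parent, so the interrupted loop is resumed at the
-- right place. Output alternates with the parity of the depth, so one of any two consecutive moves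
-- outputs something (`Scheme.emit_next`), and the delay is at most three moves
-- (`Scheme.Trav.exec`).
--
-- The machine. Explicit programs perform the moves. They are verified with triples `Tri` that bound
-- time and space along with the result; the time of a lister is paid in advance when it is started
-- and released as a potential. The source, pi and core of S come from a single scan of its
-- canonical order (`tri_branch`). In Algorithm 2 the state of the lister is not kept: the list is
-- produced again and skipped up to r(S) (`tri_refinedResume`). The delays are products. Algorithm 1
-- has at most n·2^q passes, each with O(q) calls of a `choose` that costs O(n) queries. Algorithm 2
-- has O(n·RB·q) passes, each with O(q) calls of a `choose` that costs O(q·n) queries, and O(n) runs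
-- of listers.

theorem mem_sorted {X : Finset (Fin n)} {a : Fin n} : a ∈ sorted X ↔ a ∈ X := by
  simp [sorted]

theorem pairwise_lt_sorted (X : Finset (Fin n)) : (sorted X).Pairwise (· < ·) :=
  (List.pairwise_lt_finRange n).filter _

theorem nodup_sorted (X : Finset (Fin n)) : (sorted X).Nodup :=
  (pairwise_lt_sorted X).imp (fun h => h.ne)

theorem toFinset_sorted (X : Finset (Fin n)) : (sorted X).toFinset = X := by
  ext a; simp [mem_sorted]

theorem length_sorted (X : Finset (Fin n)) : (sorted X).length = #X := by
  conv_rhs => rw [← toFinset_sorted X]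
  exact (List.toFinset_card_of_nodup (nodup_sorted X)).symm

theorem head?_sorted_eq_some {X : Finset (Fin n)} {a : Fin n} :
    (sorted X).head? = some a ↔ a ∈ X ∧ ∀ b ∈ X, a ≤ b := by
  have hp := pairwise_lt_sorted X
  have hm := fun b => @mem_sorted n X b
  revert hp hm
  cases sorted X with
  | nil => intro _ hm; simp [← hm]
  | cons c l =>
    intro hp hm
    rw [List.pairwise_cons] at hp
    constructor
    · intro h
      obtain rfl : c = a := by simpa using h
      refine ⟨(hm c).1 (by simp), fun b hb => ?_⟩
      rcases List.mem_cons.1 ((hm b).2 hb) with rfl | hb'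
      · exact le_rfl
      · exact (hp.1 b hb').le
    · rintro ⟨ha, hle⟩
      rcases List.mem_cons.1 ((hm a).2 ha) with rfl | ha'
      · rfl
      · exact absurd (hp.1 a ha') (not_lt.2 (hle c ((hm c).1 (by simp))))

theorem head?_sorted_eq_none {X : Finset (Fin n)} : (sorted X).head? = none ↔ X = ∅ := by
  rw [List.head?_eq_none_iff, ← List.length_eq_zero_iff, length_sorted, card_eq_zero]

variable {F : Finset (Finset (Fin n))} {ch : Chooser n}

theorem mem_addable {X A : Finset (Fin n)} {a : Fin n} :
    a ∈ addable F X A ↔ a ∈ A ∧ a ∉ X ∧ insert a X ∈ F := by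
  simp [addable]

theorem source_eq_some {X : Finset (Fin n)} {s : Fin n} :
    source F X = some s ↔ (s ∈ X ∧ {s} ∈ F) ∧ ∀ x ∈ X, {x} ∈ F → s ≤ x := by
  simp [source, head?_sorted_eq_some, singles]

theorem exists_source (h0 : ∅ ∈ F) (hs : StronglyAccessible F) {X : Finset (Fin n)} (hX : X ∈ F)
    (hne : X.Nonempty) : ∃ s, source F X = some s := by
  obtain ⟨z, hz, hzF⟩ := hs ∅ h0 X hX (empty_ssubset.2 hne)
  rw [← Option.isSome_iff_exists, ← Option.ne_none_iff_isSome]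
  intro h
  rw [source, head?_sorted_eq_none] at h
  have : z ∈ X ∩ singles F := by
    simp only [sdiff_empty] at hz
    simpa [singles, hz] using hzF
  simp [h] at this

theorem source_of_subset {S X : Finset (Fin n)} {s : Fin n} (h : source F S = some s)
    (hXS : X ⊆ S) (hsX : s ∈ X) : source F X = some s := by
  rw [source_eq_some] at h ⊢
  exact ⟨⟨hsX, h.1.2⟩, fun x hx => h.2 x (hXS hx)⟩

/-- `ch` selects the addable element with the least key. -/
structure KeyChooser (F : Finset (Finset (Fin n))) (ch : Chooser n)
    (key : Finset (Fin n) → Fin n → ℕ ×ₗ Fin n) : Prop where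
  inj : ∀ X, Function.Injective (key X)
  mem : ∀ {X A y}, ch X A = some y → y ∈ addable F X A
  le : ∀ {X A y y'}, ch X A = some y → y' ∈ addable F X A → key X y ≤ key X y'
  eq_empty : ∀ {X A}, X ∈ F → X.Nonempty → ch X A = none → addable F X A = ∅

/-- The first coordinate is padding, so that both frameworks have keys in the same ordered type and
share the theory below. -/
theorem keyChooser_chooseMin : KeyChooser F (chooseMin F) (fun _ y => toLex (0, y)) where
  inj X a b h := by simpa using h
  mem h := (head?_sorted_eq_some.1 h).1
  le h h' := by
    have := (head?_sorted_eq_some.1 h).2 _ h'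
    simpa [Prod.Lex.toLex_le_toLex] using this
  eq_empty _ _ h := head?_sorted_eq_none.1 h

/-- The key of the refined framework. -/
def layKey (F : Finset (Finset (Fin n))) (X : Finset (Fin n)) (y : Fin n) : ℕ ×ₗ Fin n :=
  toLex ((match source F X with | none => 0 | some t => lay F X t y), y)

/-- The two hypotheses serve the last field only: on a set without a source `chooseLay` returns
null, even if something is addable, and they give every nonempty solution a source. -/
theorem keyChooser_chooseLay (h0 : ∅ ∈ F) (hs : StronglyAccessible F) :
    KeyChooser F (chooseLay F) (layKey F) where
  inj X a b h := by
    have := congrArg (fun p => (ofLex p).2) h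
    simpa [layKey] using this
  mem {X A y} h := by
    unfold chooseLay at h
    split at h
    · cases h
    · exact mem_sorted.1 (List.argmin_mem h)
  le {X A y y'} h h' := by
    unfold chooseLay at h
    split at h
    · cases h
    · rename_i t ht
      have := List.le_of_mem_argmin (mem_sorted.2 h') h
      simpa [layKey, ht] using this
  eq_empty {X A} hX hne h := by
    obtain ⟨s, hs'⟩ := exists_source h0 hs hX hne
    simp only [chooseLay, hs', List.argmin_eq_none] at h
    rw [← List.head?_eq_none_iff] at h
    exact head?_sorted_eq_none.1 h

/-- Since the key ignores the domain, a minimiser over the larger domain that happens to lie in the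
smaller one is a minimiser there too; injectivity of the key makes it the only one. -/
theorem KeyChooser.eq_of_subset {key} (K : KeyChooser F ch key) {X A A' : Finset (Fin n)}
    {y : Fin n} (hX : X ∈ F) (hne : X.Nonempty) (h : ch X A' = some y) (hA : A ⊆ A')
    (hy : y ∈ A) : ch X A = some y := by
  have hya := mem_addable.1 (K.mem h)
  have hya' : y ∈ addable F X A := mem_addable.2 ⟨hy, hya.2⟩
  cases h' : ch X A with
  | none => simp [K.eq_empty hX hne h'] at hya'
  | some y' =>
    have h1 := K.le h' hya'
    have h2 := mem_addable.1 (K.mem h')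
    have h3 := K.le h (mem_addable.2 ⟨hA h2.1, h2.2⟩)
    rw [K.inj X (le_antisymm h1 h3)]

/-- One iteration of the loop of `complete`, stopping at `ws`. -/
def growStop (ch : Chooser n) (ws : Option (Fin n)) (A X : Finset (Fin n)) : Finset (Fin n) :=
  match ch X A with
  | none => X
  | some x => if some x = ws then X else insert x X

/-- `complete(X, A)`, stopping when `choose` returns `ws`. -/
def completeStop (ch : Chooser n) (ws : Option (Fin n)) (X A : Finset (Fin n)) :
    Finset (Fin n) := (growStop ch ws A)^[n] X

/-- A null stopping element is never chosen, so both kinds of completion are instances of one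
operation; later facts and the program for completion are established once for both. -/
theorem completeStop_none (X A : Finset (Fin n)) : completeStop ch none X A = complete ch X A := by
  have : growStop ch none A = grow ch A := by
    funext Y; unfold growStop grow; cases ch Y A <;> simp
  rw [completeStop, complete, this]

theorem completeStop_some (w : Fin n) (X A : Finset (Fin n)) :
    completeStop ch (some w) X A = completeUntil ch w X A := by
  have : growStop ch (some w) A = fun Y => if ch Y A = some w then Y else grow ch A Y := by
    funext Y; unfold growStop grow; cases ch Y A <;> simp
  rw [completeStop, completeUntil, this]

theorem subset_growStop (ws : Option (Fin n)) (A X : Finset (Fin n)) : X ⊆ growStop ch ws A X := by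
  unfold growStop
  cases ch X A with
  | none => exact Subset.rfl
  | some x => simp only; split_ifs; exacts [Subset.rfl, subset_insert _ _]

/-- This justifies the fixed number n of iterations: if the n-th step still changed something, all
steps up to it would be strict, and the set would have more than n elements. -/
theorem iterate_stationary {g : Finset (Fin n) → Finset (Fin n)} (hg : ∀ X, X ⊆ g X)
    (X : Finset (Fin n)) : g (g^[n] X) = g^[n] X := by
  by_contra hne
  have key : ∀ i ≤ n + 1, i ≤ #(g^[i] X) := by
    intro i
    induction i with
    | zero => simp
    | succ i ih =>
      intro hi
      have h1 := ih (by omega)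
      have h2 : g^[i] X ⊂ g^[i + 1] X := by
        rw [Function.iterate_succ_apply']
        refine (hg _).ssubset_of_ne fun heq => hne ?_
        have hfix : g^[n] X = g^[i] X := by
          obtain ⟨d, rfl⟩ : ∃ d, n = d + i := ⟨n - i, by omega⟩
          rw [Function.iterate_add_apply]
          exact Function.iterate_fixed heq.symm d
        rw [hfix, ← heq]
      exact lt_of_le_of_lt h1 (card_lt_card h2)
  have h1 := key (n + 1) le_rfl
  have h2 := card_le_univ (g^[n + 1] X)
  simp only [Fintype.card_fin] at h2
  omega

theorem growStop_completeStop (ws : Option (Fin n)) (X A : Finset (Fin n)) :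
    growStop ch ws A (completeStop ch ws X A) = completeStop ch ws X A :=
  iterate_stationary (subset_growStop ws A) X

theorem completeStop_growStop (ws : Option (Fin n)) (X A : Finset (Fin n)) :
    completeStop ch ws (growStop ch ws A X) A = completeStop ch ws X A := by
  rw [← growStop_completeStop ws X A]
  unfold completeStop
  rw [← Function.iterate_succ_apply, Function.iterate_succ_apply']

/-- Stationarity absorbs the extra iteration. This is the recursion equation of the completion, free
of the iteration count; it serves as the loop invariant of the program. -/
theorem completeStop_insert {ws : Option (Fin n)} {X A : Finset (Fin n)} {y : Fin n}
    (h : ch X A = some y) (hy : some y ≠ ws) :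
    completeStop ch ws (insert y X) A = completeStop ch ws X A := by
  rw [← completeStop_growStop ws X A]
  simp [growStop, h, hy]

theorem completeStop_of_growStop_eq {ws : Option (Fin n)} {X A : Finset (Fin n)}
    (h : growStop ch ws A X = X) : completeStop ch ws X A = X :=
  Function.iterate_fixed h n

theorem completeStop_induction {ws : Option (Fin n)} {A : Finset (Fin n)}
    {p : Finset (Fin n) → Prop} (hp : ∀ X y, p X → ch X A = some y → p (insert y X))
    {X : Finset (Fin n)} (hX : p X) : p (completeStop ch ws X A) := by
  have key : ∀ (k : ℕ) (X : Finset (Fin n)), p X → p ((growStop ch ws A)^[k] X) := by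
    intro k
    induction k with
    | zero => exact fun X hX => hX
    | succ k ih =>
      intro X hX
      rw [Function.iterate_succ_apply]
      refine ih _ ?_
      unfold growStop
      cases h : ch X A with
      | none => exact hX
      | some y => simp only; split_ifs; exacts [hX, hp X y hX h]
  exact key n X hX

theorem subset_completeStop (ws : Option (Fin n)) (X A : Finset (Fin n)) :
    X ⊆ completeStop ch ws X A :=
  completeStop_induction (p := fun Y => X ⊆ Y) (fun _ _ h _ => h.trans (subset_insert _ _)) Subset.rfl

variable {key : Finset (Fin n) → Fin n → ℕ ×ₗ Fin n}

theorem KeyChooser.completeStop_mem (K : KeyChooser F ch key) {ws : Option (Fin n)}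
    {X A : Finset (Fin n)} (hX : X ∈ F) : completeStop ch ws X A ∈ F :=
  completeStop_induction (p := fun Y => Y ∈ F) (fun _ _ _ h => (mem_addable.1 (K.mem h)).2.2) hX

theorem KeyChooser.completeStop_subset (K : KeyChooser F ch key) {ws : Option (Fin n)}
    {X A B : Finset (Fin n)} (hX : X ⊆ B) (hA : A ⊆ B) : completeStop ch ws X A ⊆ B :=
  completeStop_induction (p := fun Y => Y ⊆ B)
    (fun _ _ h hy => insert_subset (hA (mem_addable.1 (K.mem hy)).1) h) hX

theorem subset_complete (X A : Finset (Fin n)) : X ⊆ complete ch X A := by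
  rw [← completeStop_none]; exact subset_completeStop _ _ _

theorem KeyChooser.complete_mem (K : KeyChooser F ch key) {X : Finset (Fin n)}
    (hX : X ∈ F) (A : Finset (Fin n)) : complete ch X A ∈ F := by
  rw [← completeStop_none]; exact K.completeStop_mem hX

theorem KeyChooser.complete_subset (K : KeyChooser F ch key) {X A B : Finset (Fin n)}
    (hX : X ⊆ B) (hA : A ⊆ B) : complete ch X A ⊆ B := by
  rw [← completeStop_none]; exact K.completeStop_subset hX hA

theorem complete_insert {X A : Finset (Fin n)} {y : Fin n} (h : ch X A = some y) :
    complete ch (insert y X) A = complete ch X A := by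
  simp only [← completeStop_none]; exact completeStop_insert h (by simp)

theorem complete_of_none {X A : Finset (Fin n)} (h : ch X A = none) : complete ch X A = X := by
  rw [← completeStop_none]; exact completeStop_of_growStop_eq (by simp [growStop, h])

theorem KeyChooser.choose_complete (K : KeyChooser F ch key) (X A : Finset (Fin n)) :
    ch (complete ch X A) A = none := by
  have h := growStop_completeStop (ch := ch) none X A
  rw [completeStop_none] at h
  cases hc : ch (complete ch X A) A with
  | none => rfl
  | some y =>
    simp only [growStop, hc, reduceCtorEq, if_false] at h
    have := (mem_addable.1 (K.mem hc)).2.1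
    exact absurd (h ▸ mem_insert_self _ _) this

theorem KeyChooser.addable_complete (K : KeyChooser F ch key) {X : Finset (Fin n)} (hX : X ∈ F)
    (hne : X.Nonempty) (A : Finset (Fin n)) : addable F (complete ch X A) A = ∅ :=
  K.eq_empty (K.complete_mem hX A) (hne.mono (subset_complete X A)) (K.choose_complete X A)

/-- Strong accessibility turns the local stopping condition into maximality: a larger solution
inside A would provide an addable element of A. -/
theorem KeyChooser.complete_maximal (K : KeyChooser F ch key) (hs : StronglyAccessible F)
    {X : Finset (Fin n)} (hX : X ∈ F) (hne : X.Nonempty) {A : Finset (Fin n)} (hA : X ⊆ A) :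
    Maximal (fun Y => Y ∈ F ∧ Y ⊆ A) (complete ch X A) := by
  refine ⟨⟨K.complete_mem hX A, K.complete_subset hA Subset.rfl⟩, fun Y hY hle => ?_⟩
  by_contra hnot
  obtain ⟨z, hz, hzF⟩ := hs _ (K.complete_mem hX A) Y hY.1 ⟨hle, hnot⟩
  have : z ∈ addable F (complete ch X A) A :=
    mem_addable.2 ⟨hY.2 (mem_sdiff.1 hz).1, (mem_sdiff.1 hz).2, hzF⟩
  simp [K.addable_complete hX hne A] at this

theorem KeyChooser.isMaxSol_complete (K : KeyChooser F ch key) (hs : StronglyAccessible F)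
    {X : Finset (Fin n)} (hX : X ∈ F) (hne : X.Nonempty) : IsMaxSol F (complete ch X univ) := by
  have := K.complete_maximal hs hX hne (subset_univ X)
  exact ⟨this.1.1, fun Y hY hle => this.2 ⟨hY, subset_univ _⟩ hle⟩

theorem KeyChooser.complete_eq (K : KeyChooser F ch key) (hs : StronglyAccessible F)
    {X S : Finset (Fin n)} (hX : X ∈ F) (hne : X.Nonempty) (hS : S ∈ F) (hXS : X ⊆ S) :
    complete ch X S = S :=
  have := K.complete_maximal hs hX hne hXS
  Subset.antisymm this.1.2 (this.2 ⟨hS, Subset.rfl⟩ this.1.2)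

theorem IsMaxSol.eq_of_subset {S Y : Finset (Fin n)} (h : IsMaxSol F S) (hY : Y ∈ F) (hSY : S ⊆ Y) :
    Y = S := Subset.antisymm (h.2 hY hSY) hSY

theorem IsMaxSol.addable_eq {S : Finset (Fin n)} (h : IsMaxSol F S) (A : Finset (Fin n)) :
    addable F S A = ∅ := by
  ext y
  simp only [mem_addable, notMem_empty, iff_false, not_and]
  intro _ hy hF
  exact hy (h.2 hF (subset_insert _ _) (mem_insert_self _ _))

theorem IsMaxSol.nonempty {S : Finset (Fin n)} (h : IsMaxSol F S) (hn : ∃ X ∈ F, X.Nonempty) :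
    S.Nonempty := by
  rw [nonempty_iff_ne_empty]
  rintro rfl
  obtain ⟨X, hX, hne⟩ := hn
  exact hne.ne_empty (h.eq_of_subset hX (empty_subset _))

/-! ### Canonical order -/

theorem pref_one {S : Finset (Fin n)} {s : Fin n} (h : source F S = some s) :
    pref F ch S 1 = {s} := by simp [pref, h]

theorem pref_succ {S : Finset (Fin n)} {s : Fin n} (h : source F S = some s) {j : ℕ} (hj : 1 ≤ j) :
    pref F ch S (j + 1) = grow ch S (pref F ch S j) := by
  obtain ⟨i, rfl⟩ : ∃ i, j = i + 1 := ⟨j - 1, by omega⟩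
  simp [pref, h, Function.iterate_succ_apply']

theorem pref_succ_of_some {S : Finset (Fin n)} {s y : Fin n} (h : source F S = some s) {j : ℕ}
    (hj : 1 ≤ j) (hy : ch (pref F ch S j) S = some y) :
    pref F ch S (j + 1) = insert y (pref F ch S j) := by
  rw [pref_succ h hj, grow, hy]

theorem KeyChooser.pref_spec (K : KeyChooser F ch key) {S : Finset (Fin n)} {s : Fin n}
    (h : source F S = some s) {j : ℕ} (hj : 1 ≤ j) :
    pref F ch S j ∈ F ∧ pref F ch S j ⊆ S ∧ s ∈ pref F ch S j := by
  have h' := source_eq_some.1 h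
  induction j, hj using Nat.le_induction with
  | base => rw [pref_one h]; exact ⟨h'.1.2, by simpa using h'.1.1, by simp⟩
  | succ j hj ih =>
    rw [pref_succ h hj, grow]
    cases hc : ch (pref F ch S j) S with
    | none => exact ih
    | some y =>
      have := mem_addable.1 (K.mem hc)
      exact ⟨this.2.2, insert_subset this.1 ih.2.1, mem_insert_of_mem ih.2.2⟩

theorem KeyChooser.pref_mem (K : KeyChooser F ch key) {S : Finset (Fin n)} {s : Fin n}
    (h : source F S = some s) {j : ℕ} (hj : 1 ≤ j) : pref F ch S j ∈ F := (K.pref_spec h hj).1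

theorem KeyChooser.pref_subset (K : KeyChooser F ch key) {S : Finset (Fin n)} {s : Fin n}
    (h : source F S = some s) {j : ℕ} (hj : 1 ≤ j) : pref F ch S j ⊆ S := (K.pref_spec h hj).2.1

theorem KeyChooser.pref_nonempty (K : KeyChooser F ch key) {S : Finset (Fin n)} {s : Fin n}
    (h : source F S = some s) {j : ℕ} (hj : 1 ≤ j) : (pref F ch S j).Nonempty :=
  ⟨s, (K.pref_spec h hj).2.2⟩

theorem KeyChooser.source_pref (K : KeyChooser F ch key) {S : Finset (Fin n)} {s : Fin n}
    (h : source F S = some s) {j : ℕ} (hj : 1 ≤ j) : source F (pref F ch S j) = some s :=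
  source_of_subset h (K.pref_subset h hj) (K.pref_spec h hj).2.2

theorem pref_mono {S : Finset (Fin n)} {s : Fin n} (h : source F S = some s) {i j : ℕ} (hi : 1 ≤ i)
    (hij : i ≤ j) : pref F ch S i ⊆ pref F ch S j := by
  induction j, hij using Nat.le_induction with
  | base => exact Subset.rfl
  | succ j hj ih =>
    rw [pref_succ h (hi.trans hj), grow]
    cases ch (pref F ch S j) S with
    | none => exact ih
    | some y => exact ih.trans (subset_insert _ _)

theorem KeyChooser.choose_pref (K : KeyChooser F ch key) (hs : StronglyAccessible F)
    {S : Finset (Fin n)} {s : Fin n} (hS : S ∈ F) (h : source F S = some s) {j : ℕ} (hj : 1 ≤ j)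
    (hne : pref F ch S j ≠ S) : ∃ y, ch (pref F ch S j) S = some y := by
  cases hc : ch (pref F ch S j) S with
  | some y => exact ⟨y, rfl⟩
  | none =>
    have := K.complete_eq hs (K.pref_mem h hj) (K.pref_nonempty h hj) hS (K.pref_subset h hj)
    rw [complete_of_none hc] at this
    exact absurd this hne

/-- Until S is exhausted each iteration adds an element. Hence the n-th prefix is S, and a bounded
search for pi(S) is enough. -/
theorem KeyChooser.pref_card (K : KeyChooser F ch key) (hs : StronglyAccessible F)
    {S : Finset (Fin n)} {s : Fin n} (hS : S ∈ F) (h : source F S = some s) {j : ℕ} (hj : 1 ≤ j)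
    (hne : pref F ch S j ≠ S) : j ≤ #(pref F ch S j) := by
  induction j, hj using Nat.le_induction with
  | base => simp [pref_one h]
  | succ j hj ih =>
    have hne' : pref F ch S j ≠ S := fun heq =>
      by
      have h1 := pref_mono (ch := ch) h hj (Nat.le_succ j)
      rw [heq] at h1
      exact hne (Subset.antisymm (K.pref_subset h (hj.trans (Nat.le_succ j))) h1)
    obtain ⟨y, hy⟩ := K.choose_pref hs hS h hj hne'
    rw [pref_succ_of_some h hj hy, card_insert_of_notMem (mem_addable.1 (K.mem hy)).2.1]
    exact Nat.succ_le_succ (ih hne')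

theorem KeyChooser.pref_last (K : KeyChooser F ch key) (hs : StronglyAccessible F)
    {S : Finset (Fin n)} {s : Fin n} (hS : S ∈ F) (h : source F S = some s) :
    pref F ch S n = S := by
  by_contra hne
  have hn : 1 ≤ n := Nat.succ_le_of_lt (lt_of_le_of_lt (Nat.zero_le _) s.2)
  have h1 := K.pref_card hs hS h hn hne
  have h2 := card_lt_card ((K.pref_subset h hn).ssubset_of_ne hne)
  have h3 := card_le_univ S
  simp only [Fintype.card_fin] at h3
  omega

theorem KeyChooser.piIndex_spec (K : KeyChooser F ch key) (hs : StronglyAccessible F)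
    {S : Finset (Fin n)} {s : Fin n} (hS : IsMaxSol F S) (h : source F S = some s) :
    1 ≤ piIndex F ch S ∧ complete ch (pref F ch S (piIndex F ch S)) univ = S ∧
      ∀ j, 1 ≤ j → j < piIndex F ch S → complete ch (pref F ch S j) univ ≠ S := by
  have hn : 1 ≤ n := Nat.succ_le_of_lt (lt_of_le_of_lt (Nat.zero_le _) s.2)
  unfold piIndex
  cases hf : (List.range (n + 1)).find?
      (fun j => decide (1 ≤ j ∧ complete ch (pref F ch S j) univ = S)) with
  | none =>
    rw [List.find?_eq_none] at hf
    -- The search cannot fail: n is a candidate, because the n-th prefix is S, which by maximality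
    -- completes to itself.
    have := hf n (by simp)
    simp only [decide_eq_true_eq, not_and] at this
    refine absurd ?_ (this hn)
    rw [K.pref_last hs hS.1 h]
    exact hS.eq_of_subset (K.complete_mem hS.1 _) (subset_complete _ _)
  | some j =>
    rw [List.find?_range_eq_some] at hf
    simp only [Option.getD_some]
    refine ⟨(by simpa using hf.1 : _ ∧ _).1, (by simpa using hf.1 : _ ∧ _).2, fun i hi hij => ?_⟩
    have := hf.2.2 i hij
    simpa [hi] using this

theorem KeyChooser.piIndex_eq (K : KeyChooser F ch key) (hs : StronglyAccessible F)
    {S : Finset (Fin n)} {s : Fin n} (hS : IsMaxSol F S) (h : source F S = some s) {j : ℕ}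
    (hj : 1 ≤ j) (hc : complete ch (pref F ch S j) univ = S)
    (hlt : ∀ i, 1 ≤ i → i < j → complete ch (pref F ch S i) univ ≠ S) : piIndex F ch S = j := by
  obtain ⟨h1, h2, h3⟩ := K.piIndex_spec hs hS h
  rcases lt_trichotomy (piIndex F ch S) j with hl | he | hg
  · exact absurd h2 (hlt _ h1 hl)
  · exact he
  · exact absurd hc (h3 _ hj hg)

/-- Adding the next canonical element keeps the completion, when it is the free choice. -/
theorem complete_pref_succ {S : Finset (Fin n)} {s y : Fin n} (h : source F S = some s) {j : ℕ} (hj : 1 ≤ j)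
    (hy : ch (pref F ch S j) S = some y) (hv : ch (pref F ch S j) univ = some y) :
    complete ch (pref F ch S (j + 1)) univ = complete ch (pref F ch S j) univ := by
  rw [pref_succ_of_some h hj hy, complete_insert hv]

/-- The free choice at X belongs to the completion of X, so if that is S, then it is also the choice
inside S. -/
theorem KeyChooser.choose_of_complete_eq (K : KeyChooser F ch key)
    {S X : Finset (Fin n)} {v : Fin n} (hX : X ∈ F) (hne : X.Nonempty)
    (hc : complete ch X univ = S) (hv : ch X univ = some v) : ch X S = some v := by
  refine K.eq_of_subset hX hne hv (subset_univ _) ?_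
  rw [← hc, ← complete_insert hv]
  exact subset_complete _ _ (mem_insert_self _ _)

/-- At a prefix that completes to S the free choice is the next canonical element, so the next
prefix has the same completion. The good indices are thus upward closed, which allows pi(S) to be
found as the last place where free and canonical choice disagree. -/
theorem KeyChooser.complete_pref_of_le (K : KeyChooser F ch key)
    {S : Finset (Fin n)} {s : Fin n} (hS : IsMaxSol F S) (h : source F S = some s) {i j : ℕ}
    (hi : 1 ≤ i) (hij : i ≤ j) (hc : complete ch (pref F ch S i) univ = S) :
    complete ch (pref F ch S j) univ = S := by
  induction j, hij using Nat.le_induction with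
  | base => exact hc
  | succ j hj ih =>
    have hj1 := hi.trans hj
    cases hv : ch (pref F ch S j) univ with
    | none =>
      rw [complete_of_none hv] at ih
      have := hS.addable_eq S
      have h2 : ch S S = none := by
        cases h3 : ch S S with
        | none => rfl
        | some y => have := K.mem h3; rw [hS.addable_eq] at this; simp at this
      rw [pref_succ h hj1, ih, grow, h2]
      rw [ih] at hv
      exact complete_of_none hv
    | some v =>
      have := K.choose_of_complete_eq (K.pref_mem h hj1) (K.pref_nonempty h hj1) ih hv
      rw [complete_pref_succ h hj1 this hv, ih]

/-- If the free choice at a prefix differs from the canonical one, the completion is not `S`. -/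
theorem KeyChooser.complete_pref_ne (K : KeyChooser F ch key)
    {S : Finset (Fin n)} {s y : Fin n} (h : source F S = some s) {j : ℕ} (hj : 1 ≤ j)
    (hy : ch (pref F ch S j) S = some y) (hv : ch (pref F ch S j) univ ≠ some y) :
    complete ch (pref F ch S j) univ ≠ S := by
  intro hc
  cases hv' : ch (pref F ch S j) univ with
  | none =>
    have := K.eq_empty (K.pref_mem h hj) (K.pref_nonempty h hj) hv'
    have h2 := mem_addable.1 (K.mem hy)
    have : y ∈ addable F (pref F ch S j) univ := mem_addable.2 ⟨mem_univ _, h2.2⟩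
    simp_all
  | some v =>
    have := K.choose_of_complete_eq (K.pref_mem h hj) (K.pref_nonempty h hj) hc hv'
    rw [hy] at this
    exact hv (hv'.trans this.symm)

/-- The data of a solution that is not a root. -/
theorem KeyChooser.nonroot_spec (K : KeyChooser F ch key) (hs : StronglyAccessible F)
    {S : Finset (Fin n)} {s : Fin n} (hS : IsMaxSol F S) (h : source F S = some s)
    (hp : 1 < piIndex F ch S) : ∃ j w v, 1 ≤ j ∧ piIndex F ch S = j + 1 ∧
      core F ch S = pref F ch S j ∧ parent F ch S = some (complete ch (pref F ch S j) univ) ∧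
      pi F ch S = some w ∧ ch (pref F ch S j) S = some w ∧ pref F ch S (j + 1) = insert w (pref F ch S j) ∧
      ch (pref F ch S j) univ = some v ∧ v ≠ w ∧ v ∉ S ∧ key (pref F ch S j) v < key (pref F ch S j) w ∧
      complete ch (insert w (pref F ch S j)) univ = S ∧
      complete ch (pref F ch S j) univ ≠ S := by
  obtain ⟨h1, h2, h3⟩ := K.piIndex_spec hs hS h
  obtain ⟨j, hj⟩ : ∃ j, piIndex F ch S = j + 1 := ⟨piIndex F ch S - 1, by omega⟩
  have hj1 : 1 ≤ j := by omega
  have hne : complete ch (pref F ch S j) univ ≠ S := h3 j hj1 (by omega)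
  have hpne : pref F ch S j ≠ S := by
    intro heq
    rw [heq] at hne
    exact hne (hS.eq_of_subset (K.complete_mem hS.1 _) (subset_complete _ _))
  obtain ⟨w, hw⟩ := K.choose_pref hs hS.1 h hj1 hpne
  have hwa := mem_addable.1 (K.mem hw)
  have hwu : w ∈ addable F (pref F ch S j) univ := mem_addable.2 ⟨mem_univ _, hwa.2⟩
  have hcore : core F ch S = pref F ch S j := by simp [core, hj, show 0 < j by omega]
  obtain ⟨v, hv⟩ : ∃ v, ch (pref F ch S j) univ = some v := by
    cases hv : ch (pref F ch S j) univ with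
    | some v => exact ⟨v, rfl⟩
    | none => simp [K.eq_empty (K.pref_mem h hj1) (K.pref_nonempty h hj1) hv] at hwu
  -- If the free choice were w, the prefix before w would have the same completion as the one with
  -- w, against the minimality of the index.
  have hvw : v ≠ w := by
    rintro rfl
    apply hne
    rw [← complete_pref_succ h hj1 hw hv, ← hj, h2]
  have hpj := pref_succ_of_some h hj1 hw
  refine ⟨j, w, v, hj1, hj, hcore, ?_, ?_, hw, hpj, hv, hvw, ?_, ?_, ?_, hne⟩
  · simp [parent, hp, hcore]
  · simp [pi, canon, hj, show j ≠ 0 by omega, hw]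
  -- A free choice inside S would be the canonical choice, that is, w.
  · intro hvS
    have := K.eq_of_subset (K.pref_mem h hj1) (K.pref_nonempty h hj1) hv (subset_univ _) hvS
    rw [hw] at this
    exact hvw (Option.some.inj this).symm
  · exact lt_of_le_of_ne (K.le hv hwu) fun h => hvw (K.inj _ h)
  · rw [← hpj, ← hj, h2]

theorem parent_eq_none_iff {S : Finset (Fin n)} : parent F ch S = none ↔ ¬ 1 < piIndex F ch S := by
  unfold parent; split_ifs <;> simp_all

end Systems

-- A lexicographic rank that increases from parents to children

section Order

variable {n : ℕ} {F : Finset (Finset (Fin n))} {ch : Chooser n}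
  {key : Finset (Fin n) → Fin n → ℕ ×ₗ Fin n}

/-- The keys of the elements that `complete(X, A)` adds, in order. -/
def keyTrail (ch : Chooser n) (key : Finset (Fin n) → Fin n → ℕ ×ₗ Fin n) (A : Finset (Fin n)) :
    ℕ → Finset (Fin n) → List (ℕ ×ₗ Fin n)
  | 0, _ => []
  | m + 1, X =>
    match ch X A with
    | none => []
    | some y => key X y :: keyTrail ch key A m (insert y X)

/-- The source of `S`, followed by the keys of the further elements in canonical order. -/
def keyList (F : Finset (Finset (Fin n))) (ch : Chooser n)
    (key : Finset (Fin n) → Fin n → ℕ ×ₗ Fin n) (S : Finset (Fin n)) : List (ℕ ×ₗ Fin n) :=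
  match source F S with
  | none => []
  | some s => toLex (0, s) :: keyTrail ch key S n {s}

/-- Run the completions inside P and inside S in parallel along the prefixes of S. Before the core
is complete, P contains the next canonical element, so its own choice has a key that is at most as
large; either this is strict and decides the comparison, or both make the same choice and go on in
step. At the core, P takes v and S takes w, whose key is larger. -/
theorem KeyChooser.keyTrail_lt (K : KeyChooser F ch key) {S P : Finset (Fin n)} {s v w : Fin n}
    (h : source F S = some s) {j : ℕ} (hj : 1 ≤ j) (hw : ch (pref F ch S j) S = some w)
    (hv : ch (pref F ch S j) univ = some v) (hlt : key (pref F ch S j) v < key (pref F ch S j) w)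
    (hP : complete ch (pref F ch S j) univ = P) (i m : ℕ) (hi : 1 ≤ i) (hij : i ≤ j)
    (hm : j < i + m) :
    keyTrail ch key P m (pref F ch S i) < keyTrail ch key S m (pref F ch S i) := by
  induction m generalizing i with
  | zero => omega
  | succ m ih =>
    -- A null choice would freeze the prefixes from i on, and w could not be chosen at j.
    have hSne : ch (pref F ch S i) S ≠ none := by
      intro hn
      have hfix : ∀ l, i ≤ l → pref F ch S l = pref F ch S i := by
        intro l hl
        induction l, hl using Nat.le_induction with
        | base => rfl
        | succ l hl ihl => rw [pref_succ h (hi.trans hl), ihl, grow, hn]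
      rw [hfix j hij, hn] at hw
      cases hw
    obtain ⟨y, hy⟩ := Option.ne_none_iff_exists'.1 hSne
    have hps := pref_succ_of_some h hi hy
    rcases hij.eq_or_lt with rfl | hlt'
    -- Here the prefix is the core, P is its completion, and the free choice v is therefore the
    -- choice inside P.
    · have hPv := K.choose_of_complete_eq (K.pref_mem h hi) (K.pref_nonempty h hi) hP hv
      rw [hw] at hy
      obtain rfl := Option.some.inj hy
      simp only [keyTrail, hPv, hw]
      exact List.cons_lt_cons_iff.2 (Or.inl hlt)
    · have hya := mem_addable.1 (K.mem hy)
      have hyP : y ∈ P := by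
        rw [← hP]
        refine subset_complete _ _ (pref_mono h (by omega) (show i + 1 ≤ j from hlt') ?_)
        rw [hps]; exact mem_insert_self _ _
      have hyPa : y ∈ addable F (pref F ch S i) P := mem_addable.2 ⟨hyP, hya.2⟩
      obtain ⟨x, hx⟩ : ∃ x, ch (pref F ch S i) P = some x := by
        cases hc : ch (pref F ch S i) P with
        | some x => exact ⟨x, rfl⟩
        | none => simp [K.eq_empty (K.pref_mem h hi) (K.pref_nonempty h hi) hc] at hyPa
      simp only [keyTrail, hx, hy]
      rcases (K.le hx hyPa).lt_or_eq with hl | he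
      · exact List.cons_lt_cons_iff.2 (Or.inl hl)
      · obtain rfl := K.inj _ he
        refine List.cons_lt_cons_iff.2 (Or.inr ⟨rfl, ?_⟩)
        rw [← hps]
        exact ih (i + 1) (by omega) (by omega) (by omega)

/-- The parent contains the source of S, so its own source is at most that. If the sources agree,
both canonical orders start from the same singleton and the trails decide. The lexicographic order
on lists need not be well founded; the finiteness of the set of nodes makes up for it later. -/
theorem KeyChooser.keyList_parent_lt (K : KeyChooser F ch key) (h0 : ∅ ∈ F)
    (hs : StronglyAccessible F) {S P : Finset (Fin n)} {s : Fin n} (hS : IsMaxSol F S)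
    (h : source F S = some s) (hP : parent F ch S = some P) :
    keyList F ch key P < keyList F ch key S := by
  have hp : 1 < piIndex F ch S := by
    by_contra hn
    rw [parent_eq_none_iff.2 hn] at hP; cases hP
  obtain ⟨j, w, v, hj, hpj, -, hpar, -, hw, -, hv, -, -, hlt, -⟩ := K.nonroot_spec hs hS h hp
  rw [hpar] at hP
  obtain rfl := Option.some.inj hP
  set P := complete ch (pref F ch S j) univ with hPdef
  have hPF : P ∈ F := K.complete_mem (K.pref_mem h hj) _
  have hsP : s ∈ P := subset_complete _ _ (K.pref_spec h hj).2.2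
  obtain ⟨p, hp'⟩ := exists_source h0 hs hPF ⟨s, hsP⟩
  have hps : p ≤ s := (source_eq_some.1 hp').2 s hsP (source_eq_some.1 h).1.2
  simp only [keyList, h, hp']
  rcases hps.lt_or_eq with hl | rfl
  · refine List.cons_lt_cons_iff.2 (Or.inl ?_)
    simpa [Prod.Lex.toLex_lt_toLex] using hl
  · refine List.cons_lt_cons_iff.2 (Or.inr ⟨rfl, ?_⟩)
    rw [← pref_one (ch := ch) h]
    -- Trails of length n reach position j: from index n on the prefix is S itself and has nothing
    -- left to choose.
    have hjn : j ≤ n := by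
      by_contra hgt
      have h2 := K.pref_last hs hS.1 h
      have h3 : S ⊆ pref F ch S j := by
        have := pref_mono (ch := ch) h (show 1 ≤ n from Nat.succ_le_of_lt
          (lt_of_le_of_lt (Nat.zero_le _) p.2)) (show n ≤ j by omega)
        rwa [h2] at this
      have h4 := mem_addable.1 (K.mem hw)
      exact h4.2.1 (h3 h4.1)
    exact K.keyTrail_lt h hj hw hv hlt rfl 1 n le_rfl hj (by omega)

end Order

-- Layers in strongly accessible commutable systems

section Commutable

variable {n : ℕ} {F : Finset (Finset (Fin n))}

/-- Inside a solution, an addable element stays addable. -/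
theorem insert_mem_of_subset (hs : StronglyAccessible F) (hc : Commutable F)
    {X X' T : Finset (Fin n)} {y : Fin n} (hX : X ∈ F) (hne : X.Nonempty) (hX' : X' ∈ F)
    (hsub : X ⊆ X') (hy : y ∉ X') (hyX : insert y X ∈ F) (hT : T ∈ F) (hyT : y ∈ T)
    (hX'T : X' ⊆ T) : insert y X' ∈ F := by
  induction hk : #(X' \ X) using Nat.strong_induction_on generalizing X with
  | _ k ih =>
    rcases hsub.eq_or_ssubset with rfl | hss
    · exact hyX
    · obtain ⟨z, hz, hzF⟩ := hs X hX X' hX' hss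
      have hz' := mem_sdiff.1 hz
      have hyX0 : y ∉ X := fun h => hy (hsub h)
      have hXT : X ⊂ T := Finset.ssubset_of_ssubset_of_subset hss hX'T
      -- Accessibility gives a path from X to X' and commutability, applied inside T, carries the
      -- addability of y over each of its steps.
      have h1 := hc X hX T hT hne hXT y (mem_sdiff.2 ⟨hyT, hyX0⟩) z
        (mem_sdiff.2 ⟨hX'T hz'.1, hz'.2⟩) hyX hzF
      refine ih _ ?_ hzF (insert_nonempty _ _) (insert_subset hz'.1 hsub) h1 rfl
      rw [← hk]
      refine card_lt_card ⟨sdiff_subset_sdiff Subset.rfl (subset_insert _ _), fun hle => ?_⟩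
      have := hle hz
      simp at this

/-- Elements that can be added to B separately can be added one after the other, since inside X each
of them stays addable. This makes the layer sets solutions. -/
theorem union_mem_of_addable (hs : StronglyAccessible F) (hc : Commutable F)
    {B X Z : Finset (Fin n)} (hB : B ∈ F) (hne : B.Nonempty) (hX : X ∈ F) (hBX : B ⊆ X)
    (hZ : Z ⊆ X) (hZB : ∀ z ∈ Z, insert z B ∈ F) : B ∪ Z ∈ F := by
  induction Z using Finset.induction_on with
  | empty => simpa using hB
  | insert z Z hz ih =>
    have h1 := ih ((subset_insert _ _).trans hZ) (fun z hz => hZB z (mem_insert_of_mem hz))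
    have hzX : z ∈ X := hZ (mem_insert_self _ _)
    rw [union_insert]
    by_cases hz' : z ∈ B ∪ Z
    · rwa [insert_eq_of_mem hz']
    · exact insert_mem_of_subset hs hc hB hne h1 subset_union_left hz'
        (hZB z (mem_insert_self _ _)) hX hzX
        (union_subset hBX ((subset_insert _ _).trans hZ))

theorem layerSet_subset {X : Finset (Fin n)} {t : Fin n} (ht : t ∈ X) (i : ℕ) :
    layerSet F X t i ⊆ X := by
  induction i with
  | zero => simpa [layerSet] using ht
  | succ i ih => exact union_subset ih inter_subset_right

theorem mem_layerSet (X : Finset (Fin n)) (t : Fin n) (i : ℕ) : t ∈ layerSet F X t i := by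
  induction i with
  | zero => simp [layerSet]
  | succ i ih => exact mem_union_left _ ih

theorem layerSet_mem (hs : StronglyAccessible F) (hc : Commutable F) {X : Finset (Fin n)} {t : Fin n}
    (hX : X ∈ F) (htX : t ∈ X) (ht : {t} ∈ F) (i : ℕ) : layerSet F X t i ∈ F := by
  induction i with
  | zero => exact ht
  | succ i ih =>
    exact union_mem_of_addable hs hc ih ⟨t, mem_layerSet X t i⟩ hX (layerSet_subset htX i)
      inter_subset_right (fun z hz => (mem_addable.1 (mem_inter.1 hz).1).2.2)

theorem layerSet_ssubset (hs : StronglyAccessible F) (hc : Commutable F) {X : Finset (Fin n)}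
    {t : Fin n} (hX : X ∈ F) (htX : t ∈ X) (ht : {t} ∈ F) {i : ℕ} (hne : layerSet F X t i ≠ X) :
    layerSet F X t i ⊂ layerSet F X t (i + 1) := by
  obtain ⟨z, hz, hzF⟩ := hs _ (layerSet_mem hs hc hX htX ht i) X hX
    ((layerSet_subset htX i).ssubset_of_ne hne)
  have hz' := mem_sdiff.1 hz
  refine ⟨subset_union_left, fun hle => hz'.2 (hle ?_)⟩
  exact mem_union_right _ (mem_inter.2 ⟨mem_addable.2 ⟨mem_univ _, hz'.2, hzF⟩, hz'.1⟩)

theorem card_layerSet (hs : StronglyAccessible F) (hc : Commutable F) {X : Finset (Fin n)}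
    {t : Fin n} (hX : X ∈ F) (htX : t ∈ X) (ht : {t} ∈ F) {i : ℕ} (hne : layerSet F X t i ≠ X) :
    i + 1 ≤ #(layerSet F X t i) := by
  induction i with
  | zero => simp [layerSet]
  | succ i ih =>
    have hne' : layerSet F X t i ≠ X := fun heq =>
      hne (Subset.antisymm (layerSet_subset htX _)
        (by conv_lhs => rw [← heq]
            exact subset_union_left))
    exact lt_of_le_of_lt (ih hne') (card_lt_card (layerSet_ssubset hs hc hX htX ht hne'))

/-- Starting from one element, each round that has not yet exhausted X adds at least one more. -/
theorem layerSet_eq (hs : StronglyAccessible F) (hc : Commutable F) {X : Finset (Fin n)}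
    {t : Fin n} (hX : X ∈ F) (htX : t ∈ X) (ht : {t} ∈ F) {i : ℕ} (hi : #X ≤ i + 1) :
    layerSet F X t i = X := by
  by_contra hne
  have h1 := card_layerSet hs hc hX htX ht hne
  have h2 := card_lt_card ((layerSet_subset htX i).ssubset_of_ne hne)
  omega

/-- An element addable to some B_i with i < n has a layer in the range that is searched, so the
default value 0 is not used. -/
theorem lay_spec {X : Finset (Fin n)} {t y : Fin n} {i : ℕ} (hi : i < n)
    (hy : y ∈ addable F (layerSet F X t i) univ) :
    1 ≤ lay F X t y ∧ lay F X t y ≤ i + 1 ∧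
      y ∈ addable F (layerSet F X t (lay F X t y - 1)) univ ∧
      ∀ r, y ∈ addable F (layerSet F X t r) univ → lay F X t y ≤ r + 1 := by
  unfold lay
  cases hf : (List.range (n + 1)).find?
    (fun i => decide (1 ≤ i ∧ y ∈ addable F (layerSet F X t (i - 1)) univ)) with
  | none =>
    rw [List.find?_eq_none] at hf
    have := hf (i + 1) (by simp; omega)
    simp [hy] at this
  | some l =>
    rw [List.find?_range_eq_some] at hf
    simp only [Option.getD_some]
    have h1 : 1 ≤ l ∧ y ∈ addable F (layerSet F X t (l - 1)) univ := by simpa using hf.1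
    have h2 : ∀ r, y ∈ addable F (layerSet F X t r) univ → l ≤ r + 1 := by
      intro r hr
      by_contra hlt
      have := hf.2.2 (r + 1) (by omega)
      simp [hr] at this
    exact ⟨h1.1, h2 i hy, h1.2, h2⟩

/-- An addable element has a layer. -/
theorem exists_mem_addable_layerSet (hs : StronglyAccessible F) (hc : Commutable F)
    {X : Finset (Fin n)} {t y : Fin n} (hX : X ∈ F) (htX : t ∈ X) (ht : {t} ∈ F) (hy : y ∉ X)
    (hyX : insert y X ∈ F) : ∃ i < n, y ∈ addable F (layerSet F X t i) univ := by
  have h1 : #X + 1 ≤ n := by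
    rw [← card_insert_of_notMem hy]
    simpa using card_le_univ (insert y X)
  refine ⟨#X, h1, ?_⟩
  rw [layerSet_eq hs hc hX htX ht (Nat.le_succ _)]
  exact mem_addable.2 ⟨mem_univ _, hy, hyX⟩

theorem layerSet_mono (hs : StronglyAccessible F) (hc : Commutable F) {X X' : Finset (Fin n)}
    {t : Fin n} (hX : X ∈ F) (hX' : X' ∈ F) (hsub : X ⊆ X') (htX : t ∈ X) (ht : {t} ∈ F) (i : ℕ) :
    layerSet F X t i ⊆ layerSet F X' t i := by
  induction i with
  | zero => exact Subset.rfl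
  | succ i ih =>
    refine union_subset (ih.trans subset_union_left) fun z hz => ?_
    by_cases hz' : z ∈ layerSet F X' t i
    · exact mem_union_left _ hz'
    · have h1 := mem_inter.1 hz
      refine mem_union_right _ (mem_inter.2 ⟨mem_addable.2 ⟨mem_univ _, hz', ?_⟩, hsub h1.2⟩)
      exact insert_mem_of_subset hs hc (layerSet_mem hs hc hX htX ht i) ⟨t, mem_layerSet X t i⟩
        (layerSet_mem hs hc hX' (hsub htX) ht i) ih hz' (mem_addable.1 h1.1).2.2 hX' (hsub h1.2)
        (layerSet_subset (hsub htX) i)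

/-- Layer sets grow with X. The layer set that first admits y inside X has a larger counterpart
inside X', and within the solution X' ∪ {y} the element y remains addable to it. -/
theorem lay_anti (hs : StronglyAccessible F) (hc : Commutable F) {X X' : Finset (Fin n)}
    {t y : Fin n} (hX : X ∈ F) (hX' : X' ∈ F) (hsub : X ⊆ X') (htX : t ∈ X) (ht : {t} ∈ F)
    (hy : y ∉ X') (hyX : insert y X ∈ F) (hyX' : insert y X' ∈ F) :
    lay F X' t y ≤ lay F X t y := by
  obtain ⟨i, hi, hyi⟩ := exists_mem_addable_layerSet hs hc hX htX ht (fun h => hy (hsub h)) hyX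
  obtain ⟨i', hi', hyi'⟩ := exists_mem_addable_layerSet hs hc hX' (hsub htX) ht hy hyX'
  obtain ⟨h1, -, h2, -⟩ := lay_spec hi hyi
  have h3 : y ∈ addable F (layerSet F X' t (lay F X t y - 1)) univ := by
    refine mem_addable.2 ⟨mem_univ _, fun h => hy (layerSet_subset (hsub htX) _ h), ?_⟩
    exact insert_mem_of_subset hs hc (layerSet_mem hs hc hX htX ht _) ⟨t, mem_layerSet X t _⟩
      (layerSet_mem hs hc hX' (hsub htX) ht _) (layerSet_mono hs hc hX hX' hsub htX ht _)
      (fun h => hy (layerSet_subset (hsub htX) _ h)) (mem_addable.1 h2).2.2 hyX'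
      (mem_insert_self _ _) ((layerSet_subset (hsub htX) _).trans (subset_insert _ _))
  have := (lay_spec hi' hyi').2.2.2 _ h3
  omega

theorem layKey_lt_iff {X X' : Finset (Fin n)} {t a b : Fin n} (h : source F X = some t)
    (h' : source F X' = some t) : layKey F X a < layKey F X' b ↔
      lay F X t a < lay F X' t b ∨ lay F X t a = lay F X' t b ∧ a < b := by
  simp [layKey, h, h', Prod.Lex.toLex_lt_toLex]

/-- Keys increase along the canonical order, one step. -/
theorem layKey_lt_succ (hs : StronglyAccessible F) (hc : Commutable F)
    (K : KeyChooser F (chooseLay F) (layKey F)) {S X : Finset (Fin n)} {s a b : Fin n}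
    (hS : S ∈ F) (h : source F S = some s) (hX : X ∈ F) (hXS : X ⊆ S) (hsX : s ∈ X)
    (ha : chooseLay F X S = some a) (hb : chooseLay F (insert a X) S = some b) :
    layKey F X a < layKey F (insert a X) b := by
  have hs1 := (source_eq_some.1 h).1.2
  have haa := mem_addable.1 (K.mem ha)
  have hba := mem_addable.1 (K.mem hb)
  have hXS' : insert a X ⊆ S := insert_subset haa.1 hXS
  have hbX : b ∉ X := fun h => hba.2.1 (mem_insert_of_mem h)
  have hba' : b ≠ a := fun h => hba.2.1 (h ▸ mem_insert_self _ _)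
  rw [layKey_lt_iff (source_of_subset h hXS hsX)
    (source_of_subset h hXS' (mem_insert_of_mem hsX))]
  obtain ⟨ia, hia, hai⟩ := exists_mem_addable_layerSet hs hc hX hsX hs1 haa.2.1 haa.2.2
  obtain ⟨ha1, ha2, ha3, ha4⟩ := lay_spec hia hai
  obtain ⟨ib, hib, hbi⟩ := exists_mem_addable_layerSet hs hc haa.2.2 (mem_insert_of_mem hsX) hs1
    hba.2.1 hba.2.2
  obtain ⟨hb1, hb2, hb3, hb4⟩ := lay_spec hib hbi
  rcases lt_or_ge (lay F X s a) (lay F (insert a X) s b) with hl | hge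
  · exact Or.inl hl
  -- Below its own layer a is not addable to the layer sets, so putting a into X does not change
  -- them.
  have hB : ∀ r, r < lay F X s a → layerSet F (insert a X) s r = layerSet F X s r := by
    intro r
    induction r with
    | zero => intro _; rfl
    | succ r ih =>
      intro hr
      rw [layerSet, layerSet, ih (by omega)]
      have hna : a ∉ addable F (layerSet F X s r) univ := fun h => by
        have := ha4 r h; omega
      congr 1
      rw [inter_insert_of_notMem hna]
  rw [hB _ (by omega)] at hb3
  -- If b had a layer in X ∪ {a} not above that of a, then b was already addable to X, with a layer
  -- there at most as large. As a was preferred to b, both layers must equal that of a, and a < b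
  -- decides.
  have hbF : insert b X ∈ F :=
    insert_mem_of_subset hs hc (layerSet_mem hs hc hX hsX hs1 _) ⟨s, mem_layerSet X s _⟩ hX
      (layerSet_subset hsX _) hbX (mem_addable.1 hb3).2.2 hS hba.1 hXS
  obtain ⟨ic, hic, hci⟩ := exists_mem_addable_layerSet hs hc hX hsX hs1 hbX hbF
  have hle := (lay_spec hic hci).2.2.2 _ hb3
  have hk := K.le ha (mem_addable.2 ⟨hba.1, hbX, hbF⟩)
  have hk' := lt_of_le_of_ne hk fun h => hba' (K.inj _ h).symm
  rw [layKey_lt_iff (source_of_subset h hXS hsX) (source_of_subset h hXS hsX)] at hk'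
  right
  omega

theorem layKey_pref_lt (hs : StronglyAccessible F) (hc : Commutable F)
    (K : KeyChooser F (chooseLay F) (layKey F)) {S : Finset (Fin n)} {s a b : Fin n}
    (hS : S ∈ F) (h : source F S = some s) {i j : ℕ} (hi : 1 ≤ i) (hij : i < j)
    (ha : chooseLay F (pref F (chooseLay F) S i) S = some a)
    (hb : chooseLay F (pref F (chooseLay F) S j) S = some b) :
    layKey F (pref F (chooseLay F) S i) a < layKey F (pref F (chooseLay F) S j) b := by
  induction j, (show i + 1 ≤ j from hij) using Nat.le_induction generalizing b with
  | base =>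
    rw [pref_succ_of_some h hi ha] at hb ⊢
    exact layKey_lt_succ hs hc K hS h (K.pref_mem h hi) (K.pref_subset h hi)
      (K.pref_spec h hi).2.2 ha hb
  | succ j hj ih =>
    have hj1 : 1 ≤ j := by omega
    cases hd : chooseLay F (pref F (chooseLay F) S j) S with
    | none =>
      rw [pref_succ h hj1, grow, hd] at hb
      simp only at hb
      rw [hd] at hb; cases hb
    | some d =>
      refine (ih (by omega) hd).trans ?_
      rw [pref_succ_of_some h hj1 hd] at hb ⊢
      exact layKey_lt_succ hs hc K hS h (K.pref_mem h hj1) (K.pref_subset h hj1)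
        (K.pref_spec h hj1).2.2 hd hb

/-- An element outside `S` that was preferable to a canonical one before `pi(S)` cannot be added to
a prefix whose completion is `S`. -/
theorem insert_pref_notMem (hs : StronglyAccessible F) (hc : Commutable F)
    (K : KeyChooser F (chooseLay F) (layKey F)) {S : Finset (Fin n)} {s y a : Fin n}
    (hS : IsMaxSol F S) (h : source F S = some s) {i j : ℕ} (hi : 1 ≤ i) (hij : i < j)
    (hcomp : complete (chooseLay F) (pref F (chooseLay F) S j) univ = S) (hy : y ∉ S)
    (hyi : insert y (pref F (chooseLay F) S i) ∈ F)
    (ha : chooseLay F (pref F (chooseLay F) S i) S = some a)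
    (hlt : layKey F (pref F (chooseLay F) S i) y < layKey F (pref F (chooseLay F) S i) a) :
    insert y (pref F (chooseLay F) S j) ∉ F := by
  intro hyj
  have hj : 1 ≤ j := by omega
  have hyp : y ∉ pref F (chooseLay F) S j := fun h' => hy (K.pref_subset h hj h')
  have hya : y ∈ addable F (pref F (chooseLay F) S j) univ :=
    mem_addable.2 ⟨mem_univ _, hyp, hyj⟩
  cases hv : chooseLay F (pref F (chooseLay F) S j) univ with
  | none => simp [K.eq_empty (K.pref_mem h hj) (K.pref_nonempty h hj) hv] at hya
  | some v =>
    have hvS := K.choose_of_complete_eq (K.pref_mem h hj) (K.pref_nonempty h hj) hcomp hv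
    have h1 := K.le hv hya
    have h2 := layKey_pref_lt hs hc K hS.1 h hi hij ha hvS
    -- The contradiction is a cycle of keys: that of y at j is at most that of y at i (layers drop),
    -- which is below that of a at i, which is below that of v at j (keys increase), which is at
    -- most that of y at j.
    have h3 : layKey F (pref F (chooseLay F) S j) y < layKey F (pref F (chooseLay F) S j) y := by
      refine lt_of_lt_of_le ?_ (h1.trans le_rfl)
      refine lt_of_le_of_lt ?_ (hlt.trans h2)
      have hl := lay_anti hs hc (K.pref_mem h hi) (K.pref_mem h hj) (pref_mono h hi hij.le)
        (K.pref_spec h hi).2.2 (source_eq_some.1 h).1.2 hyp hyi hyj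
      simp only [layKey, K.source_pref h hi, K.source_pref h hj, Prod.Lex.toLex_le_toLex]
      rcases hl.lt_or_eq with hl | hl
      · exact Or.inl hl
      · exact Or.inr ⟨hl, le_rfl⟩
    exact lt_irrefl _ h3

/-- Up to `pi(S)`, the canonical order of `S` is followed in each solution that contains
`core(S) ∪ {pi(S)}`. -/
theorem chooseLay_pref_eq (hs : StronglyAccessible F) (hc : Commutable F)
    (K : KeyChooser F (chooseLay F) (layKey F)) {S R : Finset (Fin n)} {s a : Fin n}
    (hS : IsMaxSol F S) (h : source F S = some s) {i j : ℕ} (hi : 1 ≤ i) (hij : i < j)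
    (hcomp : complete (chooseLay F) (pref F (chooseLay F) S j) univ = S)
    (ha : chooseLay F (pref F (chooseLay F) S i) S = some a) (hR : R ∈ F)
    (hsub : pref F (chooseLay F) S j ⊆ R) :
    chooseLay F (pref F (chooseLay F) S i) R = some a := by
  have haa := mem_addable.1 (K.mem ha)
  have haR : a ∈ R := by
    refine hsub (pref_mono h (by omega) (show i + 1 ≤ j from hij) ?_)
    rw [pref_succ_of_some h hi ha]; exact mem_insert_self _ _
  have haR' : a ∈ addable F (pref F (chooseLay F) S i) R := mem_addable.2 ⟨haR, haa.2⟩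
  cases hy : chooseLay F (pref F (chooseLay F) S i) R with
  | none => simp [K.eq_empty (K.pref_mem h hi) (K.pref_nonempty h hi) hy] at haR'
  | some y =>
    -- A different choice y inside R would have a smaller key than a and so lie outside S. By
    -- commutability inside R it could still be added to the j-th prefix, which `insert_pref_notMem`
    -- excludes.
    by_contra hne
    have hya : y ≠ a := fun h => hne (h ▸ rfl)
    have hlt := lt_of_le_of_ne (K.le hy haR') fun h => hya (K.inj _ h)
    have hyR := mem_addable.1 (K.mem hy)
    have hyS : y ∉ S := fun hyS =>
      absurd (K.le ha (mem_addable.2 ⟨hyS, hyR.2⟩)) (not_le.2 hlt)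
    refine insert_pref_notMem hs hc K hS h hi hij hcomp hyS hyR.2.2 ha hlt ?_
    exact insert_mem_of_subset hs hc (K.pref_mem h hi) (K.pref_nonempty h hi)
      (K.pref_mem h (by omega)) (pref_mono h hi hij.le)
      (fun h' => hyS (K.pref_subset h (by omega) h')) hyR.2.2 hR hyR.1 hsub

end Commutable

-- Both frameworks are reverse searches

section Soundness

variable {n : ℕ} {ι : Type}

/-- What makes a scheme a reverse search over the sets that satisfy `M`. -/
structure Scheme.Sound (A : Scheme n ι) (M : Finset (Fin n) → Prop) : Prop where
  root_iff : ∀ z S, A.root z = some S ↔ M S ∧ A.parent S = none ∧ A.source S = some z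
  source_spec : ∀ S, M S → ∃ z, A.source S = some z
  parent_spec : ∀ S P, M S → A.parent S = some P → M P ∧ ∃ i ∈ A.iters P, A.child P i = some S
  child_spec : ∀ P i S, M P → i ∈ A.iters P → A.child P i = some S →
    M S ∧ A.parent S = some P ∧ A.resume S = some i
  nodup : ∀ P, M P → (A.iters P).Nodup
  rank_lt : ∃ rk : Finset (Fin n) → List (ℕ ×ₗ Fin n), ∀ S P, M S → A.parent S = some P → rk P < rk S

variable {F : Finset (Finset (Fin n))} {ch : Chooser n}
  {key : Finset (Fin n) → Fin n → ℕ ×ₗ Fin n}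

/-- For a root the index of pi is 1, so it is the completion of the singleton of its source; hence
trying every singleton finds all roots, one for each source at most. -/
theorem KeyChooser.rootAt_eq_some_iff (K : KeyChooser F ch key)
    (hs : StronglyAccessible F) (z : Fin n) (S : Finset (Fin n)) :
    rootAt F ch z = some S ↔ IsMaxSol F S ∧ parent F ch S = none ∧ source F S = some z := by
  unfold rootAt
  constructor
  · intro h
    split_ifs at h with hc
    obtain rfl := Option.some.inj h
    exact ⟨K.isMaxSol_complete hs hc.1 (singleton_nonempty z), hc.2.2, hc.2.1⟩
  · rintro ⟨hS, hp, hz⟩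
    have hz1 : {z} ∈ F := (source_eq_some.1 hz).1.2
    have h1 := K.piIndex_spec hs hS hz
    have h2 : piIndex F ch S = 1 := by
      have := parent_eq_none_iff.1 hp
      omega
    have h3 : complete ch {z} univ = S := by
      have := h1.2.1
      rwa [h2, pref_one hz] at this
    rw [if_pos]
    · rw [h3]
    · rw [h3]; exact ⟨hz1, hz, hp⟩

theorem KeyChooser.isMaxSol_parent (K : KeyChooser F ch key) (h0 : ∅ ∈ F)
    (hs : StronglyAccessible F) (hn : ∃ X ∈ F, X.Nonempty) {S P : Finset (Fin n)}
    (hS : IsMaxSol F S) (hP : parent F ch S = some P) : IsMaxSol F P := by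
  obtain ⟨s, h⟩ := exists_source h0 hs hS.1 (hS.nonempty hn)
  have hp : 1 < piIndex F ch S := by
    by_contra hn
    rw [parent_eq_none_iff.2 hn] at hP; cases hP
  obtain ⟨j, w, v, hj, -, -, hpar, -⟩ := K.nonroot_spec hs hS h hp
  rw [hpar] at hP
  obtain rfl := Option.some.inj hP
  exact K.isMaxSol_complete hs (K.pref_mem h hj) (K.pref_nonempty h hj)

theorem KeyChooser.one_lt_piIndex (_ : KeyChooser F ch key) {S P : Finset (Fin n)}
    (hP : parent F ch S = some P) : 1 < piIndex F ch S := by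
  by_contra hn
  rw [parent_eq_none_iff.2 hn] at hP; cases hP

theorem mem_iters_basic {P : Finset (Fin n)} {i : Fin n × Finset (Fin n)} :
    i ∈ (basic F).iters P ↔ i.2 ⊂ P.erase i.1 ∧ insert i.1 i.2 ∈ F := by
  obtain ⟨w, X⟩ := i
  simp only [basic, List.mem_flatMap, List.mem_finRange, true_and, List.mem_map, List.mem_filter,
    List.mem_sublists, Prod.mk.injEq, decide_eq_true_eq]
  constructor
  · rintro ⟨w', X', ⟨-, h⟩, rfl, rfl⟩; exact h
  · intro h
    refine ⟨w, X, ⟨⟨sorted X, ?_, toFinset_sorted X⟩, h⟩, rfl, rfl⟩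
    have h1 : sorted X = (sorted (P.erase w)).filter (fun x => x ∈ X) := by
      simp only [sorted, List.filter_filter]
      refine List.filter_congr fun x _ => ?_
      have : x ∈ X → x ∈ P.erase w := fun hx => h.1.1 hx
      simp only [← Bool.decide_and, decide_eq_decide]
      tauto
    rw [h1]; exact List.filter_sublist

theorem nodup_map_toFinset_sublists {l : List (Fin n)} (hl : l.Pairwise (· < ·)) :
    (l.sublists.map List.toFinset).Nodup := by
  have hnd : l.Nodup := hl.imp (fun h => h.ne)
  refine (List.nodup_map_iff_inj_on (List.nodup_sublists.2 hnd)).2 fun x hx y hy hxy => ?_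
  have hx' := hl.sublist (List.mem_sublists.1 hx)
  have hy' := hl.sublist (List.mem_sublists.1 hy)
  refine List.Perm.eq_of_pairwise (le := (· < ·)) (fun a b _ _ h1 h2 => absurd h1 (lt_asymm h2)) hx' hy' ?_
  rw [List.perm_ext_iff_of_nodup (hx'.imp fun h => h.ne) (hy'.imp fun h => h.ne)]
  intro a
  rw [← List.mem_toFinset, hxy, List.mem_toFinset]

theorem nodup_flatMap_map {α β γ : Type} {l : List α} (hl : l.Nodup) {f : α → List β}
    (g : α → β → γ) (hg : ∀ a b a' b', g a b = g a' b' → a = a' ∧ b = b')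
    (hf : ∀ a ∈ l, (f a).Nodup) : (l.flatMap fun a => (f a).map (g a)).Nodup := by
  rw [List.nodup_flatMap]
  refine ⟨fun a ha => (hf a ha).map fun b b' h => (hg _ _ _ _ h).2, hl.imp fun {a a'} hne => ?_⟩
  simp only [Function.onFun, List.disjoint_left, List.mem_map]
  rintro _ ⟨b, -, rfl⟩ ⟨b', -, h⟩
  exact hne (hg _ _ _ _ h).1.symm

theorem nodup_iters_basic (P : Finset (Fin n)) : ((basic F).iters P).Nodup := by
  refine nodup_flatMap_map (List.nodup_finRange n) (fun w X => (w, X))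
    (fun a b a' b' h => by simpa using h) fun w _ => ?_
  exact (nodup_map_toFinset_sublists (pairwise_lt_sorted _)).filter _

/-- The pass that yields S carries its own pi and core, so the tests hold automatically; what needs
an argument is that this pass occurs in the loop of the parent. -/
theorem sound_basic (h0 : ∅ ∈ F) (hn : ∃ X ∈ F, X.Nonempty) (hs : StronglyAccessible F) :
    (basic F).Sound (IsMaxSol F) := by
  have K := keyChooser_chooseMin (F := F)
  refine ⟨K.rootAt_eq_some_iff hs, fun S hS => exists_source h0 hs hS.1 (hS.nonempty hn), ?_, ?_,
    fun P _ => nodup_iters_basic P, ⟨keyList F (chooseMin F) (fun _ y => toLex (0, y)), ?_⟩⟩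
  · intro S P hS hP
    change parent F (chooseMin F) S = some P at hP
    have hPm := K.isMaxSol_parent h0 hs hn hS hP
    refine ⟨hPm, ?_⟩
    obtain ⟨s, h⟩ := exists_source h0 hs hS.1 (hS.nonempty hn)
    have hlt := K.keyList_parent_lt h0 hs hS h hP
    obtain ⟨j, w, v, hj, -, hcore, hpar, hpi, hw, hps, -, -, -, -, hcomp, hne⟩ :=
      K.nonroot_spec hs hS h (K.one_lt_piIndex hP)
    rw [hpar] at hP
    obtain rfl := Option.some.inj hP
    have hwa := mem_addable.1 (K.mem hw)
    refine ⟨(w, pref F (chooseMin F) S j), mem_iters_basic.2 ⟨?_, hwa.2.2⟩, ?_⟩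
    -- The inclusion has to be strict. If the core were P \ {w} with w ∈ P, then adding w would give
    -- P, and S would be P. If w ∉ P, the core would be the maximal solution P, to which w cannot be
    -- added.
    · have hsub : pref F (chooseMin F) S j ⊆ (complete (chooseMin F) (pref F (chooseMin F) S j) univ).erase w :=
        fun x hx => mem_erase.2 ⟨fun h => hwa.2.1 (h ▸ hx), subset_complete _ _ hx⟩
      refine hsub.ssubset_of_ne fun heq => hne ?_
      by_cases hwP : w ∈ complete (chooseMin F) (pref F (chooseMin F) S j) univ
      · have h1 : insert w (pref F (chooseMin F) S j) =
            complete (chooseMin F) (pref F (chooseMin F) S j) univ := by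
          conv_lhs => rw [heq]
          exact insert_erase hwP
        rw [h1] at hcomp
        rw [← hPm.eq_of_subset (K.complete_mem hPm.1 univ) (subset_complete _ _), hcomp]
      · rw [erase_eq_of_notMem hwP] at heq
        have := hPm.addable_eq univ
        rw [← heq] at this
        have h2 := mem_addable.2 ⟨mem_univ _, hwa.2⟩
        simp [this] at h2
    · simp only [basic, hcomp]
      rw [if_pos]
      exact ⟨hpar, hpi, hcore⟩
  · intro P i S hP hi hc
    simp only [basic] at hc
    split_ifs at hc with hcond
    obtain rfl := Option.some.inj hc
    refine ⟨K.isMaxSol_complete hs (mem_iters_basic.1 hi).2 (insert_nonempty _ _), hcond.1, ?_⟩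
    simp [basic, hcond.2.1, hcond.2.2]
  · intro S P hS hP
    obtain ⟨s, h⟩ := exists_source h0 hs hS.1 (hS.nonempty hn)
    exact K.keyList_parent_lt h0 hs hS h hP

/-- Every solution containing the core and w follows the canonical order of S up to w. Used for P,
this shows w ∉ P; used for r(S), it shows that the completion inside r(S) from the source, stopped
before w, is exactly the core. -/
theorem refined_nonroot (h0 : ∅ ∈ F) (hn : ∃ X ∈ F, X.Nonempty) (hs : StronglyAccessible F)
    (hc : Commutable F) {S P : Finset (Fin n)} {s : Fin n} (hS : IsMaxSol F S)
    (h : source F S = some s) (hP : parent F (chooseLay F) S = some P) :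
    ∃ w R, pi F (chooseLay F) S = some w ∧ rSol F (chooseLay F) S = some R ∧ w ∉ P ∧
      Maximal (fun X => X ∈ F ∧ X ⊆ insert w P) R ∧ R ≠ P ∧ s ∈ R ∧ {s} ∈ F ∧ s ≠ w ∧
      complete (chooseLay F) (insert w (completeUntil (chooseLay F) w {s} R)) univ = S := by
  have K := keyChooser_chooseLay h0 hs
  have hPm := K.isMaxSol_parent h0 hs hn hS hP
  obtain ⟨j, w, v, hj, -, hcore, hpar, hpi, hw, hps, hv, hvw, -, -, hcomp, -⟩ :=
    K.nonroot_spec hs hS h (K.one_lt_piIndex hP)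
  have hP' := hP
  rw [hpar] at hP
  have hPeq := Option.some.inj hP
  have hcomp' : complete (chooseLay F) (pref F (chooseLay F) S (j + 1)) univ = S := by rw [hps, hcomp]
  have hcP : pref F (chooseLay F) S j ⊆ P := by rw [← hPeq]; exact subset_complete _ _
  have hwa := mem_addable.1 (K.mem hw)
  -- Otherwise P would choose w after the core, whereas as the completion of the core it chooses v.
  have hwP : w ∉ P := by
    intro hwP
    have h1 := chooseLay_pref_eq hs hc K hS h hj (Nat.lt_succ_self j) hcomp' hw hPm.1
      (by rw [hps]; exact insert_subset hwP hcP)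
    have h2 := K.choose_of_complete_eq (K.pref_mem h hj) (K.pref_nonempty h hj) hPeq hv
    exact hvw (Option.some.inj (h2.symm.trans h1))
  set R := complete (chooseLay F) (insert w (pref F (chooseLay F) S j)) (insert w P) with hR
  have hsubR : insert w (pref F (chooseLay F) S j) ⊆ R := subset_complete _ _
  have hRm := K.complete_maximal hs hwa.2.2 (insert_nonempty _ _)
    (insert_subset_insert w hcP)
  have hsj := (K.pref_spec h hj).2.2
  have hsw : s ≠ w := fun hsw => hwa.2.1 (hsw ▸ hsj)
  refine ⟨w, R, hpi, ?_, hwP, hRm, ?_, hsubR (mem_insert_of_mem hsj), (source_eq_some.1 h).1.2, hsw, ?_⟩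
  · simp [rSol, hP', hpi, hcore, hR]
  · rintro hRP
    exact hwP (hRP ▸ hsubR (mem_insert_self _ _))
  -- The truncated completion retraces the prefixes of S; it does not stop early, because w is not
  -- in the core.
  · have hfollow : ∀ i, 1 ≤ i → i ≤ j → completeStop (chooseLay F) (some w) {s} R =
        completeStop (chooseLay F) (some w) (pref F (chooseLay F) S i) R := by
      intro i hi
      induction i, hi using Nat.le_induction with
      | base => intro _; rw [pref_one h]
      | succ i hi ih =>
        intro hij
        rw [ih (by omega)]
        have hpne : chooseLay F (pref F (chooseLay F) S i) S ≠ none := by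
          intro hnone
          have hfix : ∀ l, i ≤ l → pref F (chooseLay F) S l = pref F (chooseLay F) S i := by
            intro l hl
            induction l, hl using Nat.le_induction with
            | base => rfl
            | succ l hl ihl => rw [pref_succ h (hi.trans hl), ihl, grow, hnone]
          rw [hfix j (by omega), hnone] at hw
          cases hw
        obtain ⟨a, ha⟩ := Option.ne_none_iff_exists'.1 hpne
        have h1 := chooseLay_pref_eq hs hc K hS h hi (show i < j + 1 by omega) hcomp' ha hRm.1.1
          (by rw [hps]; exact hsubR)
        have hpi' := pref_succ_of_some h hi ha
        rw [hpi', completeStop_insert h1]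
        rintro heq
        refine hwa.2.1 (pref_mono h (by omega) hij ?_)
        rw [hpi', Option.some.inj heq]
        exact mem_insert_self _ _
    have h1 := chooseLay_pref_eq hs hc K hS h hj (Nat.lt_succ_self j) hcomp' hw hRm.1.1
          (by rw [hps]; exact hsubR)
    rw [← completeStop_some, hfollow j hj le_rfl, completeStop_of_growStop_eq, hcomp]
    rw [growStop, hR, h1]
    simp

/-- The lists of restricted problems are right. -/
def RestrSpec (F : Finset (Finset (Fin n))) (restr : Finset (Fin n) → Fin n → List (Finset (Fin n))) :
    Prop :=
  ∀ P, IsMaxSol F P → ∀ w, w ∉ P → (restr P w).Nodup ∧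
    ∀ R, R ∈ restr P w ↔ Maximal (fun X => X ∈ F ∧ X ⊆ insert w P) R ∧ R ≠ P

theorem mem_iters_refined {restr : Finset (Fin n) → Fin n → List (Finset (Fin n))}
    {P : Finset (Fin n)} {w s : Fin n} {R : Finset (Fin n)} :
    (w, R, s) ∈ (refined F restr).iters P ↔
      w ∉ P ∧ R ∈ restr P w ∧ R ≠ P ∧ s ∈ R ∧ {s} ∈ F ∧ s ≠ w := by
  simp only [refined, List.mem_flatMap, List.mem_finRange, true_and]
  constructor
  · rintro ⟨w', h⟩
    split_ifs at h with hw
    · simp at h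
    · simp only [List.mem_flatMap, List.mem_filter, List.mem_map, mem_sorted, mem_erase, mem_inter,
        Prod.mk.injEq, decide_eq_true_eq] at h
      obtain ⟨R', ⟨hR, hRP⟩, s', ⟨hsw, hsR, hsZ⟩, rfl, rfl, rfl⟩ := h
      exact ⟨hw, hR, hRP, hsR, by simpa [singles] using hsZ, hsw⟩
  · rintro ⟨hw, hR, hRP, hsR, hsZ, hsw⟩
    refine ⟨w, ?_⟩
    rw [if_neg hw]
    simp only [List.mem_flatMap, List.mem_filter, List.mem_map, mem_sorted, mem_erase, mem_inter,
        Prod.mk.injEq, decide_eq_true_eq]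
    exact ⟨R, ⟨hR, hRP⟩, s, ⟨hsw, hsR, by simpa [singles] using hsZ⟩, by simp⟩

theorem nodup_iters_refined {restr : Finset (Fin n) → Fin n → List (Finset (Fin n))}
    (hr : RestrSpec F restr) {P : Finset (Fin n)} (hP : IsMaxSol F P) :
    ((refined F restr).iters P).Nodup := by
  have : (refined F restr).iters P = (List.finRange n).flatMap fun w =>
      ((if w ∈ P then [] else ((restr P w).filter (fun R => R ≠ P)).flatMap fun R =>
        (sorted ((R ∩ singles F).erase w)).map fun s => (R, s)).map fun x => (w, x)) := by
    simp only [refined]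
    congr 1
    funext w
    split_ifs
    · rfl
    · simp [List.map_flatMap, Function.comp_def]
  rw [this]
  refine nodup_flatMap_map (List.nodup_finRange n) (fun w X => (w, X))
    (fun a b a' b' h => by simpa using h) fun w _ => ?_
  split_ifs with hw
  · exact List.nodup_nil
  · exact nodup_flatMap_map ((hr P hP w hw).1.filter _) (fun w X => (w, X))
      (fun a b a' b' h => by simpa using h) fun R _ => nodup_sorted _

/-- A solution of the restricted problem contains the new element. -/
theorem mem_of_restr {P R : Finset (Fin n)} {w : Fin n} (hP : IsMaxSol F P)
    (hR : Maximal (fun X => X ∈ F ∧ X ⊆ insert w P) R) (hRP : R ≠ P) : w ∈ R := by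
  by_contra hw
  have h1 : R ⊆ P := (subset_insert_iff_of_notMem hw).1 hR.1.2
  exact hRP (Subset.antisymm h1 (hR.2 ⟨hP.1, subset_insert _ _⟩ h1))

/-- The starting set of the completion in the refined framework is a solution. -/
theorem insert_completeUntil_mem (h0 : ∅ ∈ F) (hs : StronglyAccessible F) {P R : Finset (Fin n)}
    {w s : Fin n} (hP : IsMaxSol F P) (hR : Maximal (fun X => X ∈ F ∧ X ⊆ insert w P) R)
    (hRP : R ≠ P) (hsR : s ∈ R) (hsF : {s} ∈ F) :
    insert w (completeUntil (chooseLay F) w {s} R) ∈ F ∧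
      completeUntil (chooseLay F) w {s} R ⊆ R := by
  have K := keyChooser_chooseLay h0 hs
  rw [← completeStop_some]
  set Y := completeStop (chooseLay F) (some w) {s} R with hY
  have hYR : Y ⊆ R := K.completeStop_subset (by simpa using hsR) Subset.rfl
  refine ⟨?_, hYR⟩
  have hYF : Y ∈ F := K.completeStop_mem hsF
  have hwR := mem_of_restr hP hR hRP
  have hfix := growStop_completeStop (ch := chooseLay F) (some w) {s} R
  rw [← hY] at hfix
  unfold growStop at hfix
  cases hc : chooseLay F Y R with
  | none =>
    have h2 := K.complete_eq hs hYF ⟨s, subset_completeStop _ _ _ (mem_singleton_self s)⟩ hR.1.1 hYR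
    rw [complete_of_none hc] at h2
    rw [h2, insert_eq_of_mem hwR]
    exact hR.1.1
  | some x =>
    have hx := mem_addable.1 (K.mem hc)
    rw [hc] at hfix
    simp only at hfix
    split_ifs at hfix with hxw
    · rw [← Option.some.inj hxw]; exact hx.2.2
    · exact absurd (hfix ▸ mem_insert_self _ _) hx.2.1

theorem sound_refined {restr : Finset (Fin n) → Fin n → List (Finset (Fin n))} (h0 : ∅ ∈ F)
    (hn : ∃ X ∈ F, X.Nonempty) (hs : StronglyAccessible F) (hc : Commutable F)
    (hr : RestrSpec F restr) : (refined F restr).Sound (IsMaxSol F) := by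
  have K := keyChooser_chooseLay h0 hs
  refine ⟨K.rootAt_eq_some_iff hs, fun S hS => exists_source h0 hs hS.1 (hS.nonempty hn), ?_, ?_,
    fun P hP => nodup_iters_refined hr hP, ⟨keyList F (chooseLay F) (layKey F), ?_⟩⟩
  · intro S P hS hP
    change parent F (chooseLay F) S = some P at hP
    have hPm := K.isMaxSol_parent h0 hs hn hS hP
    obtain ⟨s, h⟩ := exists_source h0 hs hS.1 (hS.nonempty hn)
    obtain ⟨w, R, hpi, hrS, hwP, hRm, hRP, hsR, hsF, hsw, hcomp⟩ :=
      refined_nonroot h0 hn hs hc hS h hP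
    refine ⟨hPm, (w, R, s), mem_iters_refined.2
      ⟨hwP, ((hr P hPm w hwP).2 R).2 ⟨hRm, hRP⟩, hRP, hsR, hsF, hsw⟩, ?_⟩
    simp only [refined, hcomp]
    rw [if_pos]
    exact ⟨hP, hpi, hrS, h⟩
  · rintro P ⟨w, R, s⟩ S hP hi hc
    simp only [refined] at hc
    split_ifs at hc with hcond
    obtain rfl := Option.some.inj hc
    obtain ⟨hwP, hR, hRP, hsR, hsF, hsw⟩ := mem_iters_refined.1 hi
    have hRm := ((hr P hP w hwP).2 R).1 hR
    have := insert_completeUntil_mem h0 hs hP hRm.1 hRP hsR hsF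
    refine ⟨K.isMaxSol_complete hs this.1 (insert_nonempty _ _), hcond.1, ?_⟩
    simp [refined, hcond.2.1, hcond.2.2.1, hcond.2.2.2]
  · intro S P hS hP
    obtain ⟨s, h⟩ := exists_source h0 hs hS.1 (hS.nonempty hn)
    exact K.keyList_parent_lt h0 hs hS h hP

end Soundness

-- The recursion and the stateless traversal agree

section Traversal

variable {n : ℕ} {ι : Type} [DecidableEq ι]

/-- The stateless traversal from a node on: it stays in `M`, stops, and outputs the given list. -/
inductive Scheme.Trav (A : Scheme n ι) (M : Finset (Fin n) → Prop) :
    Node n → List (Finset (Fin n)) → Prop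
  | last (t : Node n) : M t.cur → A.next t = none → Trav A M t (A.emit t)
  | step (t t' : Node n) (out : List (Finset (Fin n))) : M t.cur → A.next t = some t' →
      Trav A M t' out → Trav A M t (A.emit t ++ out)

/-- Where the traversal goes when the loop of `P` still has the passes `rest` to make. -/
def Scheme.arrive (A : Scheme n ι) (P : Finset (Fin n)) (odd : Bool) (rest : List ι) : Node n :=
  match rest.findSome? (A.child P) with
  | some S => ⟨S, false, !odd⟩
  | none => ⟨P, true, odd⟩

/-- `S` is an ancestor of `X`, or `X` itself. -/
def Scheme.Anc (A : Scheme n ι) (M : Finset (Fin n) → Prop) :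
    Finset (Fin n) → Finset (Fin n) → Prop :=
  Relation.ReflTransGen fun X P => M X ∧ A.parent X = some P

/-- In a list without repetition the loop values determine the position; this is why nothing but the
current node has to be remembered. -/
theorem after_append {α : Type} [DecidableEq α] {pre rest : List α} {a : α}
    (h : (pre ++ a :: rest).Nodup) : after (pre ++ a :: rest) (some a) = rest := by
  have ha : ∀ b ∈ pre, b ≠ a := fun b hb hba =>
    (List.disjoint_of_nodup_append h) (hba ▸ hb) (by simp)
  simp only [after]
  rw [List.dropWhile_append_of_pos (by simpa using ha)]
  simp

variable {A : Scheme n ι} {M : Finset (Fin n) → Prop}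

theorem Scheme.next_enter (P : Finset (Fin n)) (odd : Bool) :
    A.next ⟨P, false, odd⟩ = some (A.arrive P odd (A.iters P)) := by
  simp only [Scheme.next, Scheme.arrive]
  cases (A.iters P).findSome? (A.child P) <;> simp

theorem Scheme.next_leave {S P : Finset (Fin n)} (odd : Bool) (h : A.parent S = some P) :
    A.next ⟨S, true, !odd⟩ = some (A.arrive P odd (after (A.iters P) (A.resume S))) := by
  simp only [Scheme.next, Scheme.arrive, h]
  cases (after (A.iters P) (A.resume S)).findSome? (A.child P) <;> simp

omit [DecidableEq ι] in
theorem Scheme.Sound.anc_mem (hA : A.Sound M) {X S : Finset (Fin n)} (hX : M X)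
    (h : A.Anc M X S) : M S := by
  induction h with
  | refl => exact hX
  | tail _ h ih => exact (hA.parent_spec _ _ ih h.2).1

omit [DecidableEq ι] in
theorem Scheme.rank_anc {rk : Finset (Fin n) → List (ℕ ×ₗ Fin n)}
    (hrk : ∀ S P, M S → A.parent S = some P → rk P < rk S) {X S : Finset (Fin n)}
    (h : A.Anc M X S) : rk S ≤ rk X := by
  induction h with
  | refl => exact le_rfl
  | tail _ h ih => exact (hrk _ _ h.1 h.2).le.trans ih

omit [DecidableEq ι] in
/-- Different solutions with the same parent, or without one, have no common descendants. -/
theorem Scheme.Sound.anc_unique (hA : A.Sound M) {X S T : Finset (Fin n)}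
    (hS : A.Anc M X S) (hT : A.Anc M X T) (hp : A.parent S = A.parent T) : S = T := by
  obtain ⟨rk, hrk⟩ := hA.rank_lt
  -- If T were a proper ancestor of S, it would be an ancestor of the parent of S, which is also the
  -- parent of T; then T would have a smaller rank than itself.
  have key : ∀ {S T : Finset (Fin n)}, A.Anc M S T → A.parent S = A.parent T → S = T := by
    intro S T h hp
    rcases Relation.ReflTransGen.cases_head h with h | ⟨P, hP, hPT⟩
    · exact h
    · have h1 := Scheme.rank_anc hrk hPT
      have h2 := hrk S P hP.1 hP.2
      have h3 : M T := hA.anc_mem (hA.parent_spec _ _ hP.1 hP.2).1 hPT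
      have h4 := hrk T P h3 (hp ▸ hP.2)
      exact absurd (h4.trans_le h1) (lt_irrefl _)
  rcases Relation.ReflTransGen.total_of_right_unique
    (fun a b c h1 h2 => Option.some.inj (h1.2.symm.trans h2.2)) hS hT with h | h
  · exact key h hp
  · exact (key h hp.symm).symm

/-- What the recursive call on `S` and the traversal of its subtree do. -/
def Scheme.Explores (A : Scheme n ι) (M : Finset (Fin n) → Prop) (S : Finset (Fin n)) : Prop :=
  ∀ odd, ∃ out, Spawn A odd S out ∧ out.Nodup ∧ (∀ X, X ∈ out ↔ M X ∧ A.Anc M X S) ∧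
    ∀ l, A.Trav M ⟨S, true, odd⟩ (A.emit ⟨S, true, odd⟩ ++ l) → A.Trav M ⟨S, false, odd⟩ (out ++ l)

/-- The induction runs over suffixes of the loop of P, in step for recursion and traversal. The list
l stands for everything the traversal outputs from the moment it leaves P, so subtrees can be
chained by appending. -/
theorem Scheme.Sound.explore_children (hA : A.Sound M) {P : Finset (Fin n)} (hP : M P)
    (ih : ∀ S, M S → A.parent S = some P → A.Explores M S) (odd : Bool) (pre rest : List ι)
    (hpre : A.iters P = pre ++ rest) :
    ∃ out, SpawnAll A (!odd) (rest.filterMap (A.child P)) out ∧ out.Nodup ∧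
      (∀ X, X ∈ out ↔ M X ∧ ∃ i ∈ rest, ∃ S, A.child P i = some S ∧ A.Anc M X S) ∧
      ∀ l, A.Trav M ⟨P, true, odd⟩ l → A.Trav M (A.arrive P odd rest) (out ++ l) := by
  induction rest generalizing pre with
  | nil =>
    refine ⟨[], .nil _, List.nodup_nil, by simp, fun l hl => ?_⟩
    simpa [Scheme.arrive] using hl
  | cons i rest ihr =>
    obtain ⟨out, h1, h2, h3, h4⟩ := ihr (pre ++ [i]) (by simp [hpre])
    have hnd := hA.nodup P hP
    rw [hpre] at hnd
    cases hc : A.child P i with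
    | none =>
      refine ⟨out, by simpa [hc] using h1, h2, fun X => ?_, fun l hl => ?_⟩
      · rw [h3]; simp [hc]
      · simpa [Scheme.arrive, hc] using h4 l hl
    | some S =>
      obtain ⟨hS, hSP, hSi⟩ := hA.child_spec P i S hP (by simp [hpre]) hc
      obtain ⟨outS, g1, g2, g3, g4⟩ := ih S hS hSP (!odd)
      refine ⟨outS ++ out, ?_, ?_, fun X => ?_, fun l hl => ?_⟩
      · simp only [List.filterMap_cons, hc]
        exact .cons _ _ _ _ _ g1 h1
      · refine List.nodup_append.2 ⟨g2, h2, ?_⟩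
        rintro X hX _ hX' rfl
        obtain ⟨-, hX⟩ := (g3 X).1 hX
        obtain ⟨-, i', hi', S', hc', hX'⟩ := (h3 X).1 hX'
        obtain ⟨hS', hSP', hSi'⟩ := hA.child_spec P i' S' hP (by simp [hpre, hi']) hc'
        obtain rfl := hA.anc_unique hX hX' (hSP.trans hSP'.symm)
        obtain rfl := Option.some.inj (hSi.symm.trans hSi')
        have := (List.nodup_append.1 hnd).2.1
        exact (List.nodup_cons.1 this).1 hi'
      · rw [List.mem_append, g3, h3]
        simp only [List.mem_cons, exists_eq_or_imp, hc, Option.some.injEq, exists_eq_left']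
        tauto
      · have harr : A.arrive P odd (i :: rest) = ⟨S, false, !odd⟩ := by simp [Scheme.arrive, hc]
        rw [harr, List.append_assoc]
        apply g4
        refine .step _ (A.arrive P odd rest) _ hS ?_ (h4 l hl)
        -- Leaving S recomputes the pass i, and what follows i in the loop of P is precisely the
        -- remaining suffix.
        rw [Scheme.next_leave odd hSP, hSi, hpre, after_append hnd]

/-- Children have larger ranks than their parents, so the induction goes from large ranks to small
ones; it is well founded because there are finitely many sets. -/
theorem Scheme.Sound.explores (hA : A.Sound M) {S : Finset (Fin n)} (hS : M S) :
    A.Explores M S := by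
  obtain ⟨rk, hrk⟩ := hA.rank_lt
  have wf : WellFounded fun S P : Finset (Fin n) => rk P < rk S := by
    have : IsTrans (Finset (Fin n)) fun S P => rk P < rk S := ⟨fun a b c h1 h2 => h2.trans h1⟩
    have : Std.Irrefl fun S P : Finset (Fin n) => rk P < rk S := ⟨fun a => lt_irrefl _⟩
    exact Finite.wellFounded_of_trans_of_irrefl _
  induction S using wf.induction with
  | _ S ih =>
    intro odd
    obtain ⟨out, h1, h2, h3, h4⟩ := hA.explore_children hS
      (fun T hT hTS => ih T (hrk T S hT hTS) hT) odd [] (A.iters S) rfl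
    have hout : ∀ X, X ∈ out ↔ M X ∧ A.Anc M X S ∧ X ≠ S := by
      intro X
      rw [h3]
      refine and_congr_right fun hX => ⟨?_, ?_⟩
      · rintro ⟨i, hi, T, hT, hXT⟩
        obtain ⟨hTM, hTS, -⟩ := hA.child_spec S i T hS hi hT
        refine ⟨hXT.tail ⟨hTM, hTS⟩, ?_⟩
        rintro rfl
        exact absurd (Scheme.rank_anc hrk hXT) (not_le.2 (hrk _ _ hTM hTS))
      · rintro ⟨hXS, hne⟩
        rcases Relation.ReflTransGen.cases_tail hXS with h | ⟨T, hXT, hTM, hTS⟩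
        · exact absurd h.symm hne
        · obtain ⟨-, i, hi, hc⟩ := hA.parent_spec T S hTM hTS
          exact ⟨i, hi, T, hc, hXT⟩
    refine ⟨_, .call odd S out h1, ?_, fun X => ?_, fun l hl => ?_⟩
    · have : S ∉ out := fun h => ((hout S).1 h).2.2 rfl
      cases odd <;> simp [List.nodup_append, h2, this]
      exact fun X hX => fun h => this (h ▸ hX)
    · have h5 : X ∈ out ∨ X = S ↔ M X ∧ A.Anc M X S := by
        rw [hout]
        constructor
        · rintro (h | rfl)
          · exact ⟨h.1, h.2.1⟩
          · exact ⟨hS, .refl⟩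
        · intro h
          by_cases hXS : X = S
          · exact Or.inr hXS
          · exact Or.inl ⟨h.1, h.2, hXS⟩
      rw [← h5]
      cases odd <;> simp [or_comm]
    · have h6 := Scheme.Trav.step _ _ _ hS (Scheme.next_enter S odd) (h4 _ hl)
      cases odd <;> simpa [Scheme.emit] using h6

theorem Scheme.Sound.explore_roots (hA : A.Sound M) (pre rest : List (Fin n))
    (hpre : List.finRange n = pre ++ rest) :
    ∃ out, SpawnAll A false (rest.filterMap A.root) out ∧ out.Nodup ∧
      (∀ X, X ∈ out ↔ M X ∧ ∃ z ∈ rest, ∃ S, A.root z = some S ∧ A.Anc M X S) ∧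
      match rest.findSome? A.root with
      | none => out = []
      | some R => A.Trav M ⟨R, false, false⟩ out := by
  induction rest generalizing pre with
  | nil => exact ⟨[], .nil _, List.nodup_nil, by simp, by simp⟩
  | cons z rest ih =>
    obtain ⟨out, h1, h2, h3, h4⟩ := ih (pre ++ [z]) (by simp [hpre])
    have hnd := List.nodup_finRange n
    rw [hpre] at hnd
    cases hc : A.root z with
    | none =>
      refine ⟨out, by simpa [hc] using h1, h2, fun X => ?_, by simpa [hc] using h4⟩
      rw [h3]; simp [hc]
    | some S =>
      obtain ⟨hS, hSP, hSz⟩ := (hA.root_iff z S).1 hc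
      obtain ⟨outS, g1, g2, g3, g4⟩ := hA.explores hS false
      refine ⟨outS ++ out, ?_, ?_, fun X => ?_, ?_⟩
      · simp only [List.filterMap_cons, hc]
        exact .cons _ _ _ _ _ g1 h1
      · refine List.nodup_append.2 ⟨g2, h2, ?_⟩
        rintro X hX _ hX' rfl
        obtain ⟨-, hX⟩ := (g3 X).1 hX
        obtain ⟨-, z', hz', S', hc', hX'⟩ := (h3 X).1 hX'
        obtain ⟨hS', hSP', hSz'⟩ := (hA.root_iff z' S').1 hc'
        obtain rfl := hA.anc_unique hX hX' (hSP.trans hSP'.symm)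
        obtain rfl := Option.some.inj (hSz.symm.trans hSz')
        have := (List.nodup_append.1 hnd).2.1
        exact (List.nodup_cons.1 this).1 hz'
      · rw [List.mem_append, g3, h3]
        simp only [List.mem_cons, exists_eq_or_imp, hc, Option.some.injEq, exists_eq_left']
        tauto
      · simp only [List.findSome?_cons, hc]
        apply g4
        have haft : after (List.finRange n) (A.source S) = rest := by
          rw [hSz, hpre, after_append hnd]
        cases hr : rest.findSome? A.root with
        | none =>
          rw [hr] at h4
          simp only at h4
          rw [h4, List.append_nil]
          refine .last _ hS ?_
          simp [Scheme.next, hSP, haft, hr]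
        | some R =>
          rw [hr] at h4
          refine .step _ ⟨R, false, false⟩ _ hS ?_ h4
          simp [Scheme.next, hSP, haft, hr]

/-- The recursive algorithm lists `M`, each member once, and the traversal outputs the same list. -/
theorem Scheme.Sound.run (hA : A.Sound M) :
    ∃ out, RecursiveRun A out ∧ out.Nodup ∧ (∀ X, X ∈ out ↔ M X) ∧
      match A.start with
      | none => out = []
      | some t => A.Trav M t out := by
  obtain ⟨out, h1, h2, h3, h4⟩ := hA.explore_roots [] (List.finRange n) rfl
  refine ⟨out, h1, h2, fun X => ?_, ?_⟩
  · rw [h3]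
    refine ⟨fun h => h.1, fun hX => ⟨hX, ?_⟩⟩
    obtain ⟨rk, hrk⟩ := hA.rank_lt
    have wf : WellFounded fun P S : Finset (Fin n) => rk P < rk S := by
      have : IsTrans (Finset (Fin n)) fun P S => rk P < rk S := ⟨fun a b c h1 h2 => h1.trans h2⟩
      have : Std.Irrefl fun P S : Finset (Fin n) => rk P < rk S := ⟨fun a => lt_irrefl _⟩
      exact Finite.wellFounded_of_trans_of_irrefl _
    induction X using wf.induction with
    | _ X ih =>
      cases hp : A.parent X with
      | none =>
        obtain ⟨z, hz⟩ := hA.source_spec X hX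
        exact ⟨z, List.mem_finRange z, X, (hA.root_iff z X).2 ⟨hX, hp, hz⟩, .refl⟩
      | some P =>
        obtain ⟨z, hz, S, hS, hPS⟩ := ih P (hrk X P hX hp) (hA.parent_spec X P hX hp).1
        exact ⟨z, hz, S, hS, hPS.head ⟨hX, hp⟩⟩
  · simp only [Scheme.start]
    cases hr : (List.finRange n).findSome? A.root with
    | none => simpa [hr] using h4
    | some R => simpa [hr] using h4

/-- One of two consecutive moves produces an output. -/
theorem Scheme.emit_next {t t' : Node n} (h : A.emit t = []) (hn : A.next t = some t') :
    A.emit t' ≠ [] := by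
  obtain ⟨S, lv, odd⟩ := t
  have hlo : lv = odd := by
    by_contra hne
    simp [Scheme.emit, hne] at h
  subst hlo
  have hl : t'.leaving ≠ t'.odd := by
    cases lv
    · rw [Scheme.next_enter] at hn
      obtain rfl := Option.some.inj hn
      unfold Scheme.arrive
      split <;> simp
    · cases hp : A.parent S with
      | none =>
        simp only [Scheme.next, hp, if_true, Option.map_eq_some_iff] at hn
        obtain ⟨R, -, rfl⟩ := hn
        simp
      | some P =>
        have := Scheme.next_leave false hp
        rw [Bool.not_false, hn] at this
        obtain rfl := Option.some.inj this
        unfold Scheme.arrive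
        split <;> simp
  simp [Scheme.emit, hl]

end Traversal

-- Delay and space of concatenated runs

section Traces

variable {n : ℕ}

/-- The time up to the first output is at most `H`. -/
def HeadLE (tr : List (Event n)) (H : ℕ) : Prop :=
  ∀ p, p <+: tr → (∀ e ∈ p.dropLast, e.out = none) → (p.map Event.time).sum ≤ H

/-- Total time of a run. -/
def duration (tr : List (Event n)) : ℕ := (tr.map Event.time).sum

theorem duration_append (a b : List (Event n)) : duration (a ++ b) = duration a + duration b := by
  simp [duration]

theorem outputs_append (a b : List (Event n)) : outputs (a ++ b) = outputs a ++ outputs b := by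
  simp [outputs]

theorem duration_le_of_sublist {a b : List (Event n)} (h : a.Sublist b) : duration a ≤ duration b :=
  (h.map _).sum_le_sum fun _ _ => Nat.zero_le _

theorem SpaceLE.append {a b : List (Event n)} {B : ℕ} (ha : SpaceLE a B) (hb : SpaceLE b B) :
    SpaceLE (a ++ b) B := by
  intro e he
  rcases List.mem_append.1 he with h | h
  exacts [ha e h, hb e h]

theorem prefix_append_cases {α : Type} {p a b : List α} (h : p <+: a ++ b) :
    p <+: a ∨ ∃ p', p = a ++ p' ∧ p' <+: b := by
  obtain ⟨t, ht⟩ := h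
  rcases List.append_eq_append_iff.1 ht with ⟨a', h1, -⟩ | ⟨c', h1, h2⟩
  · exact Or.inl ⟨a', h1.symm⟩
  · exact Or.inr ⟨c', h1, ⟨t, h2.symm⟩⟩

theorem HeadLE.append {a b : List (Event n)} {D H : ℕ} (ha : duration a ≤ D) (hb : HeadLE b H) :
    HeadLE (a ++ b) (D + H) := by
  intro p hp hs
  rcases prefix_append_cases hp with h | ⟨p', hp', h⟩
  · exact (duration_le_of_sublist h.sublist).trans (ha.trans (Nat.le_add_right _ _))
  · subst hp'
    rw [List.map_append, List.sum_append]
    refine Nat.add_le_add ha (hb p' h fun e he => hs e ?_)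
    have : p' ≠ [] := by rintro rfl; simp at he
    rw [List.dropLast_append_of_ne_nil this]
    exact List.mem_append_right _ he

/-- A prefix whose proper part is silent cannot extend beyond a run that contains an output,
whatever comes after it. -/
theorem HeadLE.append_of_output {a b : List (Event n)} {D : ℕ} (ha : duration a ≤ D)
    (ho : outputs a ≠ []) : HeadLE (a ++ b) D := by
  intro p hp hs
  rcases prefix_append_cases hp with h | ⟨p', hp', h⟩
  · exact (duration_le_of_sublist h.sublist).trans ha
  · subst hp'
    by_cases hp0 : p' = []
    · subst hp0; rw [List.append_nil]; exact ha
    · rw [List.dropLast_append_of_ne_nil hp0] at hs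
      refine absurd ?_ ho
      rw [outputs, List.filterMap_eq_nil_iff]
      exact fun e he => hs e (List.mem_append_left _ he)

/-- A silent block across the border consists of a part of the first run, of length at most D, and
of the silent beginning of the second one. -/
theorem DelayLE.append {a b : List (Event n)} {D H T : ℕ} (ha : duration a ≤ D) (hb : HeadLE b H)
    (hT : D + H ≤ T) (hd : DelayLE b T) : DelayLE (a ++ b) T := by
  intro blk hblk hs
  rcases List.infix_append_iff.1 hblk with h | h | ⟨s, p, rfl, hsa, hp⟩
  · exact (duration_le_of_sublist h.sublist).trans (ha.trans (by omega))
  · exact hd blk h hs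
  · refine (HeadLE.append (a := s) (b := b) (D := D) (H := H)
      ((duration_le_of_sublist hsa.sublist).trans ha) hb (s ++ p) ?_ hs).trans hT
    exact (List.prefix_append_right_inj s).2 hp

theorem HeadLE.mono {tr : List (Event n)} {H H' : ℕ} (h : HeadLE tr H) (hH : H ≤ H') :
    HeadLE tr H' := fun p hp hs => (h p hp hs).trans hH

variable {ι : Type} [DecidableEq ι] {A : Scheme n ι} {M : Finset (Fin n) → Prop} {k : ℕ}

/-- The run of the main loop along a traversal. -/
theorem Scheme.Trav.exec {O : Oracle n} {body : Cmd (k + 3)} {D B : ℕ}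
    (hmove : ∀ t : Node n, M t.cur → ∃ tr, Exec O body (encode k (some t)) tr (encode k (A.next t)) ∧
      outputs tr = A.emit t ∧ duration tr ≤ D ∧ SpaceLE tr B)
    (hw : ∀ t : Node n, M t.cur → (encode k (some t)).words O ≤ B)
    (hw0 : (encode k (none : Option (Node n))).words O ≤ B)
    {t : Node n} {out : List (Finset (Fin n))} (h : A.Trav M t out) :
    ∃ tr, Exec O (.loop 0 body) (encode k (some t)) tr (encode k none) ∧ outputs tr = out ∧
      SpaceLE tr B ∧ HeadLE tr (2 * (D + 1)) ∧ (A.emit t ≠ [] → HeadLE tr (D + 1)) ∧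
      DelayLE tr (3 * (D + 1)) := by
  have hseg : ∀ (t : Node n) (tr : List (Event n)), outputs tr = A.emit t → duration tr ≤ D →
      outputs (⟨1, (encode k (some t)).words O, none⟩ :: tr) = A.emit t ∧
      duration (⟨1, (encode k (some t)).words O, none⟩ :: tr) ≤ D + 1 := by
    intro t tr h1 h2
    refine ⟨by simpa [outputs] using h1, ?_⟩
    simp only [duration, List.map_cons, List.sum_cons] at h2 ⊢
    omega
  have hsp : ∀ (t : Node n) (tr : List (Event n)), M t.cur → SpaceLE tr B →
      SpaceLE (⟨1, (encode k (some t)).words O, none⟩ :: tr) B := by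
    intro t tr ht h e he
    rcases List.mem_cons.1 he with rfl | he
    exacts [hw t ht, h e he]
  have hflag : ∀ t : Node n, (encode k (some t)).flag 0 = true := fun t => by simp [encode]
  induction h with
  | last t ht hn =>
    obtain ⟨tr, h1, h2, h3, h4⟩ := hmove t ht
    rw [hn] at h1
    have hend := Exec.loopStop (O := O) (0 : Fin (k + 3)) body (encode k none) (by simp [encode])
    obtain ⟨g1, g2⟩ := hseg t tr h2 h3
    have hhead : HeadLE [(⟨1, (encode k (none : Option (Node n))).words O, none⟩ : Event n)] 1 := by
      intro p hp _
      simpa [duration] using duration_le_of_sublist hp.sublist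
    refine ⟨_, Exec.loopStep _ _ _ _ _ _ _ (hflag t) h1 hend, ?_, ?_, ?_, fun ho => ?_, ?_⟩
    · rw [outputs_append, g1]; simp [outputs]
    · exact (hsp t tr ht h4).append (by intro e he; simp at he; subst he; exact hw0)
    · exact (HeadLE.append g2 hhead).mono (by omega)
    · exact HeadLE.append_of_output g2 (by rwa [g1])
    · refine DelayLE.append g2 hhead (by omega) ?_
      intro p hp _
      have := duration_le_of_sublist hp.sublist
      simp [duration] at this ⊢
      omega
  | step t t' out ht hn _ ih =>
    obtain ⟨tr, h1, h2, h3, h4⟩ := hmove t ht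
    rw [hn] at h1
    obtain ⟨tr', e1, e2, e3, e4, e5, e6⟩ := ih
    obtain ⟨g1, g2⟩ := hseg t tr h2 h3
    refine ⟨_, Exec.loopStep _ _ _ _ _ _ _ (hflag t) h1 e1, ?_, ?_, ?_, fun ho => ?_, ?_⟩
    · rw [outputs_append, g1, e2]
    · exact (hsp t tr ht h4).append e3
    -- A silent move is followed by one with an output, so the first output comes within two passes.
    -- The unit in `D + 1` is the test of the loop flag.
    · by_cases ho : A.emit t = []
      · exact (HeadLE.append g2 (e5 (Scheme.emit_next ho hn))).mono (by omega)
      · exact (HeadLE.append_of_output g2 (by rwa [g1])).mono (by omega)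
    · exact HeadLE.append_of_output g2 (by rwa [g1])
    -- The rest of the pass that made the last output, and at most two more passes up to the next
    -- one.
    · exact DelayLE.append g2 e4 (by omega) e6

end Traces

-- Named registers for the machine memory

section Registers

variable {n : ℕ}

/-- The memory with named registers. -/
structure Mem (n : ℕ) where
  go : Bool
  lv : Bool
  od : Bool
  ua : Bool
  lp : Bool
  lp2 : Bool
  lp3 : Bool
  lp4 : Bool
  t : Bool
  ok : Bool
  fd : Bool
  y : Option (Fin n)
  z : Option (Fin n)
  sx : Option (Fin n)
  v : Option (Fin n)
  src : Option (Fin n)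
  pi : Option (Fin n)
  w : Option (Fin n)
  s : Option (Fin n)
  ws : Option (Fin n)
  z0 : Option (Fin n)
  cur : Finset (Fin n)
  S : Finset (Fin n)
  X : Finset (Fin n)
  A : Finset (Fin n)
  B : Finset (Fin n)
  D : Finset (Fin n)
  E : Finset (Fin n)
  core : Finset (Fin n)
  Q : Finset (Fin n)
  C : Finset (Fin n)
  R : Finset (Fin n)
  rs : Finset (Fin n)
  lister : Option (Finset (Fin n) × Fin n × ℕ)

/-- The blank memory. -/
def Mem.blank (n : ℕ) : Mem n :=
  { go := false, lv := false, od := false, ua := false, lp := false, lp2 := false, lp3 := false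
    lp4 := false, t := false, ok := false, fd := false
    y := none, z := none, sx := none, v := none, src := none, pi := none, w := none, s := none
    ws := none, z0 := none
    cur := ∅, S := ∅, X := ∅, A := ∅, B := ∅, D := ∅, E := ∅, core := ∅, Q := ∅, C := ∅, R := ∅
    rs := ∅, lister := none }

/-- Names of the flags. -/
inductive FReg | go | lv | od | ua | lp | lp2 | lp3 | lp4 | t | ok | fd
/-- Names of the words. -/
inductive EReg | y | z | sx | v | src | pi | w | s | ws | z0
/-- Names of the sets. -/
inductive SReg | cur | S | X | A | B | D | E | core | Q | C | R | rs

/-- The numbers 0, 1, 2 of `go`, `lv`, `od` here, and 0 of `cur` below, are those that `encode`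
reserves for the node; the other numbers are arbitrary. -/
def FReg.idx : FReg → Fin 12
  | go => 0 | lv => 1 | od => 2 | ua => 3 | lp => 4 | lp2 => 5 | lp3 => 6 | lp4 => 7 | t => 8
  | ok => 9 | fd => 10

def FReg.get : FReg → Mem n → Bool
  | go => Mem.go | lv => Mem.lv | od => Mem.od | ua => Mem.ua | lp => Mem.lp | lp2 => Mem.lp2
  | lp3 => Mem.lp3 | lp4 => Mem.lp4 | t => Mem.t | ok => Mem.ok | fd => Mem.fd

def FReg.set (m : Mem n) (x : Bool) : FReg → Mem n
  | go => { m with go := x } | lv => { m with lv := x } | od => { m with od := x }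
  | ua => { m with ua := x } | lp => { m with lp := x } | lp2 => { m with lp2 := x }
  | lp3 => { m with lp3 := x } | lp4 => { m with lp4 := x } | t => { m with t := x }
  | ok => { m with ok := x } | fd => { m with fd := x }

def EReg.idx : EReg → Fin 12
  | y => 0 | z => 1 | sx => 2 | v => 3 | src => 4 | pi => 5 | w => 6 | s => 7 | ws => 8 | z0 => 9

def EReg.get : EReg → Mem n → Option (Fin n)
  | y => Mem.y | z => Mem.z | sx => Mem.sx | v => Mem.v | src => Mem.src | pi => Mem.pi
  | w => Mem.w | s => Mem.s | ws => Mem.ws | z0 => Mem.z0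

def EReg.set (m : Mem n) (x : Option (Fin n)) : EReg → Mem n
  | y => { m with y := x } | z => { m with z := x } | sx => { m with sx := x }
  | v => { m with v := x } | src => { m with src := x } | pi => { m with pi := x }
  | w => { m with w := x } | s => { m with s := x } | ws => { m with ws := x }
  | z0 => { m with z0 := x }

def SReg.idx : SReg → Fin 12
  | cur => 0 | S => 1 | X => 2 | A => 3 | B => 4 | D => 5 | E => 6 | core => 7 | Q => 8 | C => 9
  | R => 10 | rs => 11

def SReg.get : SReg → Mem n → Finset (Fin n)
  | cur => Mem.cur | S => Mem.S | X => Mem.X | A => Mem.A | B => Mem.B | D => Mem.D | E => Mem.E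
  | core => Mem.core | Q => Mem.Q | C => Mem.C | R => Mem.R | rs => Mem.rs

def SReg.set (m : Mem n) (x : Finset (Fin n)) : SReg → Mem n
  | cur => { m with cur := x } | S => { m with S := x } | X => { m with X := x }
  | A => { m with A := x } | B => { m with B := x } | D => { m with D := x }
  | E => { m with E := x } | core => { m with core := x } | Q => { m with Q := x }
  | C => { m with C := x } | R => { m with R := x } | rs => { m with rs := x }

/-- The flag with a given number. -/
def FReg.ofIdx : Fin 12 → Option FReg :=
  ![some go, some lv, some od, some ua, some lp, some lp2, some lp3, some lp4, some t, some ok,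
    some fd, none]

/-- The word with a given number. -/
def EReg.ofIdx : Fin 12 → Option EReg :=
  ![some y, some z, some sx, some v, some src, some pi, some w, some s, some ws, some z0, none, none]

/-- The set with a given number. -/
def SReg.ofIdx : Fin 12 → Option SReg :=
  ![some cur, some S, some X, some A, some B, some D, some E, some core, some Q, some C, some R,
    some rs]

def Mem.toStore (m : Mem n) : Store n 12 where
  flag i := match FReg.ofIdx i with | some r => r.get m | none => false
  elt i := match EReg.ofIdx i with | some r => r.get m | none => none
  fset i := match SReg.ofIdx i with | some r => r.get m | none => ∅
  lister := m.lister

theorem flag_toStore (m : Mem n) (r : FReg) : m.toStore.flag r.idx = r.get m := by cases r <;> rfl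

theorem elt_toStore (m : Mem n) (r : EReg) : m.toStore.elt r.idx = r.get m := by cases r <;> rfl

theorem fset_toStore (m : Mem n) (r : SReg) : m.toStore.fset r.idx = r.get m := by cases r <;> rfl

theorem Mem.flag_congr {m m' : Mem n} (h : ∀ r : FReg, r.get m = r.get m') :
    m.toStore.flag = m'.toStore.flag := by
  funext i; simp only [Mem.toStore, h]

theorem Mem.elt_congr {m m' : Mem n} (h : ∀ r : EReg, r.get m = r.get m') :
    m.toStore.elt = m'.toStore.elt := by
  funext i; simp only [Mem.toStore, h]

theorem Mem.fset_congr {m m' : Mem n} (h : ∀ r : SReg, r.get m = r.get m') :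
    m.toStore.fset = m'.toStore.fset := by
  funext i; simp only [Mem.toStore, h]

theorem Mem.mk_eq_toStore {m : Mem n} {f g h l} (hf : m.toStore.flag = f) (hg : m.toStore.elt = g)
    (hh : m.toStore.fset = h) (hl : m.lister = l) : (⟨f, g, h, l⟩ : Store n 12) = m.toStore := by
  subst hf hg hh hl; rfl

theorem FReg.idx_of_ofIdx {i : Fin 12} : ∀ {r : FReg}, FReg.ofIdx i = some r → r.idx = i := by
  fin_cases i <;> (intro r h; cases h; try rfl)

theorem FReg.get_set_self (m : Mem n) (r : FReg) (x : Bool) : r.get (r.set m x) = x := by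
  cases r <;> rfl

theorem FReg.get_set_of_ne (m : Mem n) {r r' : FReg} (h : r' ≠ r) (x : Bool) :
    r'.get (r.set m x) = r'.get m := by
  cases r <;> cases r' <;> first | rfl | exact absurd rfl h

/-- Together with its analogues for words and sets, this replaces function updates on numbered
registers by record updates, on which states of the memory can be compared by simplification. -/
theorem putFlag_toStore (m : Mem n) (r : FReg) (x : Bool) :
    m.toStore.putFlag r.idx x = (r.set m x).toStore := by
  have : Function.update m.toStore.flag r.idx x = (r.set m x).toStore.flag := by
    funext j
    by_cases h : j = r.idx
    · subst h; rw [Function.update_self, flag_toStore, FReg.get_set_self]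
    · rw [Function.update_of_ne h]
      simp only [Mem.toStore]
      cases hj : FReg.ofIdx j with
      | none => rfl
      | some r' =>
        have hne : r' ≠ r := fun hr => h (by rw [← FReg.idx_of_ofIdx hj, hr])
        simp only [FReg.get_set_of_ne m hne]
  rw [Store.putFlag, this]
  refine Mem.mk_eq_toStore rfl (Mem.elt_congr fun r' => ?_) (Mem.fset_congr fun r' => ?_) ?_
  · cases r <;> cases r' <;> rfl
  · cases r <;> cases r' <;> rfl
  · cases r <;> rfl

theorem EReg.idx_of_ofIdx {i : Fin 12} : ∀ {r : EReg}, EReg.ofIdx i = some r → r.idx = i := by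
  fin_cases i <;> (intro r h; cases h; try rfl)

theorem EReg.get_set_self (m : Mem n) (r : EReg) (x : Option (Fin n)) : r.get (r.set m x) = x := by
  cases r <;> rfl

theorem EReg.get_set_of_ne (m : Mem n) {r r' : EReg} (h : r' ≠ r) (x : Option (Fin n)) :
    r'.get (r.set m x) = r'.get m := by
  cases r <;> cases r' <;> first | rfl | exact absurd rfl h

theorem putElt_toStore (m : Mem n) (r : EReg) (x : Option (Fin n)) :
    m.toStore.putElt r.idx x = (r.set m x).toStore := by
  have : Function.update m.toStore.elt r.idx x = (r.set m x).toStore.elt := by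
    funext j
    by_cases h : j = r.idx
    · subst h; rw [Function.update_self, elt_toStore, EReg.get_set_self]
    · rw [Function.update_of_ne h]
      simp only [Mem.toStore]
      cases hj : EReg.ofIdx j with
      | none => rfl
      | some r' =>
        have hne : r' ≠ r := fun hr => h (by rw [← EReg.idx_of_ofIdx hj, hr])
        simp only [EReg.get_set_of_ne m hne]
  rw [Store.putElt, this]
  refine Mem.mk_eq_toStore (Mem.flag_congr fun r' => ?_) rfl (Mem.fset_congr fun r' => ?_) ?_
  · cases r <;> cases r' <;> rfl
  · cases r <;> cases r' <;> rfl
  · cases r <;> rfl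

theorem SReg.idx_of_ofIdx {i : Fin 12} : ∀ {r : SReg}, SReg.ofIdx i = some r → r.idx = i := by
  fin_cases i <;> (intro r h; cases h; try rfl)

theorem SReg.get_set_self (m : Mem n) (r : SReg) (x : Finset (Fin n)) : r.get (r.set m x) = x := by
  cases r <;> rfl

theorem SReg.get_set_of_ne (m : Mem n) {r r' : SReg} (h : r' ≠ r) (x : Finset (Fin n)) :
    r'.get (r.set m x) = r'.get m := by
  cases r <;> cases r' <;> first | rfl | exact absurd rfl h

theorem putSet_toStore (m : Mem n) (r : SReg) (x : Finset (Fin n)) :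
    m.toStore.putSet r.idx x = (r.set m x).toStore := by
  have : Function.update m.toStore.fset r.idx x = (r.set m x).toStore.fset := by
    funext j
    by_cases h : j = r.idx
    · subst h; rw [Function.update_self, fset_toStore, SReg.get_set_self]
    · rw [Function.update_of_ne h]
      simp only [Mem.toStore]
      cases hj : SReg.ofIdx j with
      | none => rfl
      | some r' =>
        have hne : r' ≠ r := fun hr => h (by rw [← SReg.idx_of_ofIdx hj, hr])
        simp only [SReg.get_set_of_ne m hne]
  rw [Store.putSet, this]
  refine Mem.mk_eq_toStore (Mem.flag_congr fun r' => ?_) (Mem.elt_congr fun r' => ?_) rfl ?_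
  · cases r <;> cases r' <;> rfl
  · cases r <;> cases r' <;> rfl
  · cases r <;> rfl

/-- Replacing the lister. -/
def Mem.setLister (m : Mem n) (l : Option (Finset (Fin n) × Fin n × ℕ)) : Mem n :=
  { m with lister := l }

theorem Mem.toStore_setLister (m : Mem n) (l : Option (Finset (Fin n) × Fin n × ℕ)) :
    (⟨m.toStore.flag, m.toStore.elt, m.toStore.fset, l⟩ : Store n 12) = (m.setLister l).toStore :=
  Mem.mk_eq_toStore (Mem.flag_congr fun r => by cases r <;> rfl)
    (Mem.elt_congr fun r => by cases r <;> rfl) (Mem.fset_congr fun r => by cases r <;> rfl) rfl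

theorem encode_none : encode 9 (none : Option (Node n)) = (Mem.blank n).toStore := by
  simp only [encode, Mem.toStore, Mem.blank, Store.mk.injEq, and_true]
  refine ⟨?_, ?_, ?_⟩ <;> funext i <;> fin_cases i <;> rfl

/-- The memory that holds a node. -/
def Mem.ofNode (t : Node n) : Mem n :=
  { Mem.blank n with go := true, lv := t.leaving, od := t.odd, cur := t.cur }

theorem encode_some (t : Node n) : encode 9 (some t) = (Mem.ofNode t).toStore := by
  simp only [encode, Mem.toStore, Mem.ofNode, Mem.blank, Store.mk.injEq, and_true]
  refine ⟨?_, ?_, ?_⟩ <;> funext i <;> fin_cases i <;> rfl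

end Registers

-- Triples with amortized time and bounded space

section Logic

/-- An instance with bounds: `u` for the time of an instruction, `RT` for that of a lister, which may
be started where `may` says, and `B` for the space. -/
structure Env (n : ℕ) where
  O : Oracle n
  may : Finset (Fin n) → Fin n → Prop
  u : ℕ
  RT : ℕ
  LS : ℕ
  GS : ℕ
  B : ℕ
  query_le : ∀ X, #X ≤ rank O.fam + 1 → O.queryTime X ≤ u ∧ O.memSpace X ≤ GS
  size_le : 2 * rank O.fam + 3 ≤ u
  lister_le : ∀ P w, may P w → ∑ i ∈ range ((O.restr P w).length + 1), O.restrTime P w i ≤ RT ∧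
    O.restrSpace P w ≤ LS ∧ ∀ R ∈ O.restr P w, #R ≤ rank O.fam + 1
  space_le : 36 + 12 * (rank O.fam + 1) + LS + GS ≤ B

variable {n : ℕ} (e : Env n)

/-- The invariant of the memory. -/
def Env.Good (σ : Store n 12) : Prop :=
  (∀ s, #(σ.fset s) ≤ rank e.O.fam + 1) ∧
    ∀ P w i, σ.lister = some (P, w, i) → e.may P w ∧ i ≤ (e.O.restr P w).length

/-- The time that the active lister still has. -/
def Env.pot : Option (Finset (Fin n) × Fin n × ℕ) → ℕ
  | none => 0
  | some (P, w, i) => ∑ j ∈ Ico i ((e.O.restr P w).length + 1), e.O.restrTime P w j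

/-- What has to be known in order to execute an instruction. -/
def Env.Side (σ : Store n 12) : Instr 12 → Prop
  | .insertElt s x => ∀ a, σ.elt x = some a → #(insert a (σ.fset s)) ≤ rank e.O.fam + 1
  | .startList s x => ∀ a, σ.elt x = some a → e.may (σ.fset s) a
  | _ => True

/-- Amortized time of an instruction. -/
def Env.cost : Instr 12 → ℕ
  | .startList _ _ => e.u + e.RT
  | _ => e.u

variable {e}

theorem Env.Good.putSet {σ : Store n 12} (h : e.Good σ) (s : Fin 12) {X : Finset (Fin n)}
    (hX : #X ≤ rank e.O.fam + 1) : e.Good (σ.putSet s X) := by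
  refine ⟨fun s' => ?_, h.2⟩
  simp only [Store.putSet]
  by_cases hs : s' = s
  · subst hs; rwa [Function.update_self]
  · rw [Function.update_of_ne hs]; exact h.1 s'

/-- The bound counts 3·12 registers, twelve sets of at most q + 1 elements and the active lister,
and leaves room for the working space of a query. -/
theorem Env.Good.words_le {σ : Store n 12} (h : e.Good σ) : σ.words e.O + e.GS ≤ e.B := by
  have h1 : ∑ s, #(σ.fset s) ≤ 12 * (rank e.O.fam + 1) := by
    simpa using sum_le_card_nsmul univ (fun s => #(σ.fset s)) _ (fun s _ => h.1 s)
  have h2 := e.space_le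
  unfold Store.words
  cases hl : σ.lister with
  | none => simp only; omega
  | some x =>
    obtain ⟨P, w, i⟩ := x
    have := (e.lister_le P w (h.2 P w i hl).1).2.1
    simp only
    omega

theorem Env.pot_step {P : Finset (Fin n)} {w : Fin n} {i : ℕ} (hi : i ≤ (e.O.restr P w).length) :
    e.O.restrTime P w i + e.pot (some (P, w, i + 1)) = e.pot (some (P, w, i)) := by
  simp only [Env.pot]
  rw [← sum_eq_sum_Ico_succ_bot (by omega)]

/-- Stored sets have at most q + 1 elements, so an instruction handling two of them takes at most 2q
+ 3 ≤ u, apart from the lister. Starting the lister is charged its total time in advance; each of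
its answers is then paid from the potential, and stopping it only discards potential. -/
theorem Env.Good.instr {σ : Store n 12} (h : e.Good σ) {i : Instr 12} (hi : e.Side σ i) :
    e.Good (i.eval e.O σ) ∧
      i.time e.O σ + e.pot (i.eval e.O σ).lister ≤ e.cost i + e.pot σ.lister ∧
      i.space e.O σ ≤ e.B := by
  have hu := e.size_le
  have hgood : e.Good (i.eval e.O σ) := by
    cases i with
    | insertElt s x =>
      simp only [Instr.eval]
      split
      · rename_i v hv; exact h.putSet s (hi v hv)
      · exact h
    | eraseElt s x =>
      simp only [Instr.eval]
      split
      · exact h.putSet s ((card_le_card (erase_subset _ _)).trans (h.1 s))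
      · exact h
    | clearSet s => exact h.putSet s (by simp)
    | copySet s t => exact h.putSet s (h.1 t)
    | ltElt b x y => simp only [Instr.eval]; split <;> exact h
    | memElt b x y => simp only [Instr.eval]; split <;> exact h
    | startList s x =>
      refine ⟨h.1, fun P w i hl => ?_⟩
      simp only [Instr.eval, Option.map_eq_some_iff, Prod.mk.injEq] at hl
      obtain ⟨a, ha, rfl, rfl, rfl⟩ := hl
      exact ⟨hi a ha, Nat.zero_le _⟩
    | nextList b s =>
      simp only [Instr.eval]
      split
      · exact h
      · rename_i P w i hl
        have hP := h.2 P w i hl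
        split
        · rename_i R hR
          refine ⟨(h.putSet s ((e.lister_le P w hP.1).2.2 R (List.mem_of_getElem? hR))).1, ?_⟩
          intro P' w' i' hl'
          simp only [Option.some.injEq, Prod.mk.injEq] at hl'
          obtain ⟨rfl, rfl, rfl⟩ := hl'
          exact ⟨hP.1, (List.getElem?_eq_some_iff.1 hR).1⟩
        · exact ⟨h.1, fun P w i hl => by cases hl⟩
    | stopList => exact ⟨h.1, fun P w i hl => by cases hl⟩
    | _ => exact h
  refine ⟨hgood, ?_, ?_⟩
  · cases i with
    | query b s =>
      have := (e.query_le _ (h.1 s)).1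
      simp only [Instr.time, Env.cost, Instr.eval, Store.putFlag]
      omega
    | insertElt s x =>
      have := h.1 s
      have hl : ((Instr.insertElt s x).eval e.O σ).lister = σ.lister := by
        simp only [Instr.eval]; split <;> rfl
      rw [hl]; simp only [Instr.time, Env.cost]; omega
    | eraseElt s x =>
      have := h.1 s
      have hl : ((Instr.eraseElt s x).eval e.O σ).lister = σ.lister := by
        simp only [Instr.eval]; split <;> rfl
      rw [hl]; simp only [Instr.time, Env.cost]; omega
    | ltElt b x y =>
      have hl : ((Instr.ltElt b x y).eval e.O σ).lister = σ.lister := by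
        simp only [Instr.eval]; split <;> rfl
      rw [hl]; simp only [Instr.time, Env.cost]; omega
    | memElt b x s =>
      have := h.1 s
      have hl : ((Instr.memElt b x s).eval e.O σ).lister = σ.lister := by
        simp only [Instr.eval]; split <;> rfl
      rw [hl]; simp only [Instr.time, Env.cost]; omega
    | copySet s t =>
      have h1 := h.1 s; have h2 := h.1 t
      simp only [Instr.time, Env.cost, Instr.eval, Store.putSet]; omega
    | eqSet b s t =>
      have h1 := h.1 s; have h2 := h.1 t
      simp only [Instr.time, Env.cost, Instr.eval, Store.putFlag]; omega
    | nextElt x s =>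
      have h1 := h.1 s
      simp only [Instr.time, Env.cost, Instr.eval, Store.putElt]; omega
    | clearSet s =>
      have h1 := h.1 s
      simp only [Instr.time, Env.cost, Instr.eval, Store.putSet]; omega
    | output s =>
      have h1 := h.1 s
      simp only [Instr.time, Env.cost, Instr.eval]; omega
    | startList s x =>
      have h1 := h.1 s
      simp only [Instr.time, Env.cost, Instr.eval]
      have h2 : e.pot ((σ.elt x).map fun w => (σ.fset s, w, 0)) ≤ e.RT := by
        cases hx : σ.elt x with
        | none => simp [Env.pot]
        | some w =>
          have := (e.lister_le _ w (hi w hx)).1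
          rwa [range_eq_Ico] at this
      omega
    | nextList b s =>
      have h1 := h.1 s
      cases hl : σ.lister with
      | none =>
        have : ((Instr.nextList b s).eval e.O σ).lister = none := by
          simp only [Instr.eval, hl, Store.putFlag]
        rw [this]; simp only [Instr.time, Env.cost, hl]; omega
      | some x =>
        obtain ⟨P, w, i⟩ := x
        obtain ⟨hP, hi'⟩ := h.2 P w i hl
        have hps := e.pot_step hi'
        simp only [Instr.time, Env.cost, Instr.eval, hl]
        cases hR : (e.O.restr P w)[i]? with
        | none =>
          have : e.pot none = 0 := rfl
          simp only [Option.getD_none, card_empty]; omega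
        | some R =>
          have h2 := (e.lister_le P w hP).2.2 R (List.mem_of_getElem? hR)
          simp only [Option.getD_some]; omega
    | stopList =>
      have : e.pot none = 0 := rfl
      simp only [Instr.time, Env.cost, Instr.eval, this]; omega
    | _ =>
      simp only [Instr.time, Env.cost, Instr.eval, Store.putFlag, Store.putElt]; omega
  · have h1 := h.words_le
    have h2 := hgood.words_le
    have h3 : max (σ.words e.O) ((i.eval e.O σ).words e.O) + e.GS ≤ e.B := by omega
    unfold Instr.space
    cases i with
    | query b s =>
      have := (e.query_le _ (h.1 s)).2
      simp only at h3 ⊢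
      omega
    | _ => simp only at h3 ⊢; omega

variable (e)

/-- The program `c` halts on `m` without output, within amortized time `T`, and the final memory
satisfies `Q`. -/
def Tri (c : Cmd 12) (m : Mem n) (T : ℕ) (Q : Mem n → Prop) : Prop :=
  e.Good m.toStore → ∃ tr m', Exec e.O c m.toStore tr m'.toStore ∧ outputs tr = [] ∧
    duration tr + e.pot m'.lister ≤ T + e.pot m.lister ∧ SpaceLE tr e.B ∧ e.Good m'.toStore ∧ Q m'

variable {e}

theorem Tri.mono {c : Cmd 12} {m : Mem n} {T T' : ℕ} {Q Q' : Mem n → Prop} (h : Tri e c m T Q)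
    (hT : T ≤ T') (hQ : ∀ m', Q m' → Q' m') : Tri e c m T' Q' := by
  intro hg
  obtain ⟨tr, m', h1, h2, h3, h4, h5, h6⟩ := h hg
  exact ⟨tr, m', h1, h2, h3.trans (by omega), h4, h5, hQ _ h6⟩

theorem Tri.le {c : Cmd 12} {m : Mem n} {T T' : ℕ} {Q : Mem n → Prop} (h : Tri e c m T Q)
    (hT : T ≤ T') : Tri e c m T' Q := h.mono hT fun _ h => h

theorem Tri.seq {c d : Cmd 12} {m : Mem n} {T T' : ℕ} {Q : Mem n → Prop}
    (h : Tri e c m T fun m' => Tri e d m' T' Q) : Tri e (.seq c d) m (T + T') Q := by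
  intro hg
  obtain ⟨tr, m', h1, h2, h3, h4, h5, h6⟩ := h hg
  obtain ⟨tr', m'', g1, g2, g3, g4, g5, g6⟩ := h6 h5
  refine ⟨tr ++ tr', m'', .seq _ _ _ _ _ _ _ h1 g1, ?_, ?_, h4.append g4, g5, g6⟩
  · rw [outputs_append, h2, g2]; rfl
  · rw [duration_append]; omega

theorem Tri.call {c d : Cmd 12} {m m1 : Mem n} {T T' : ℕ} {Q : Mem n → Prop}
    (h : Tri e c m T (· = m1)) (h' : Tri e d m1 T' Q) : Tri e (.seq c d) m (T + T') Q :=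
  Tri.seq (h.mono le_rfl fun m' hm' => by rw [hm']; exact h')

theorem Tri.cond {c d : Cmd 12} {m : Mem n} {T : ℕ} {Q : Mem n → Prop} {b : FReg}
    (h : b.get m = true → Tri e c m T Q) (h' : b.get m = false → Tri e d m T Q) :
    Tri e (.cond b.idx c d) m (e.u + T) Q := by
  intro hg
  have hu := e.size_le
  have hw := hg.words_le
  have hsp : ∀ tr : List (Event n), SpaceLE tr e.B →
      SpaceLE (⟨1, m.toStore.words e.O, none⟩ :: tr) e.B := by
    intro tr htr x hx
    rcases List.mem_cons.1 hx with rfl | hx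
    · simp only; omega
    · exact htr x hx
  have hdur : ∀ tr : List (Event n),
      duration (⟨1, m.toStore.words e.O, none⟩ :: tr) = 1 + duration tr := fun tr => by
    simp [duration]
  cases hb : b.get m with
  | true =>
    obtain ⟨tr, m', h1, h2, h3, h4, h5, h6⟩ := h hb hg
    refine ⟨_, m', .condTrue _ _ _ _ _ _ (by rw [flag_toStore, hb]) h1, by simpa [outputs] using h2,
      ?_, hsp _ h4, h5, h6⟩
    rw [hdur]; omega
  | false =>
    obtain ⟨tr, m', h1, h2, h3, h4, h5, h6⟩ := h' hb hg
    refine ⟨_, m', .condFalse _ _ _ _ _ _ (by rw [flag_toStore, hb]) h1, by simpa [outputs] using h2,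
      ?_, hsp _ h4, h5, h6⟩
    rw [hdur]; omega

/-- Loops: `I τ m` says that the time `τ` suffices from `m` on. -/
theorem Tri.loop {b : FReg} {c : Cmd 12} {Q : Mem n → Prop} (I : ℕ → Mem n → Prop)
    (hstep : ∀ τ m, I τ m → b.get m = true → ∃ T τ', e.u + T + τ' ≤ τ ∧ Tri e c m T (I τ'))
    (hexit : ∀ τ m, I τ m → b.get m = false → e.u ≤ τ ∧ Q m) {τ : ℕ} {m : Mem n} (h : I τ m) :
    Tri e (.loop b.idx c) m τ Q := by
  induction τ using Nat.strong_induction_on generalizing m with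
  | _ τ ih =>
    intro hg
    have hu := e.size_le
    have hw := hg.words_le
    cases hb : b.get m with
    | false =>
      obtain ⟨h1, h2⟩ := hexit τ m h hb
      refine ⟨_, m, .loopStop _ _ _ (by rw [flag_toStore, hb]), rfl, ?_, ?_, hg, h2⟩
      · simp [duration]; omega
      · intro x hx
        rw [List.mem_singleton] at hx
        subst hx
        simp only; omega
    | true =>
      obtain ⟨T, τ', h1, h2⟩ := hstep τ m h hb
      obtain ⟨tr, m', g1, g2, g3, g4, g5, g6⟩ := h2 hg
      -- Testing the flag alone uses up u > 0 of the budget, so the remaining budget is the measure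
      -- that proves termination.
      obtain ⟨tr', m'', f1, f2, f3, f4, f5, f6⟩ := ih τ' (by omega) g6 g5
      refine ⟨_, m'', .loopStep _ _ _ _ _ _ _ (by rw [flag_toStore, hb]) g1 f1, ?_, ?_, ?_, f5, f6⟩
      · rw [outputs_append, f2, List.append_nil]; simpa [outputs] using g2
      · rw [duration_append]
        have : duration (⟨1, m.toStore.words e.O, none⟩ :: tr) = 1 + duration tr := by
          simp [duration]
        omega
      · refine SpaceLE.append ?_ f4
        intro x hx
        rcases List.mem_cons.1 hx with rfl | hx
        · simp only; omega
        · exact g4 x hx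

/-- Loops with a bound for the number of passes. -/
theorem Tri.loop_count {b : FReg} {c : Cmd 12} {Q : Mem n → Prop} (I : ℕ → Mem n → Prop) (T : ℕ)
    (hstep : ∀ k m, I k m → b.get m = true → ∃ k', k = k' + 1 ∧ Tri e c m T (I k'))
    (hexit : ∀ k m, I k m → b.get m = false → Q m) {k : ℕ} {m : Mem n} (h : I k m) :
    Tri e (.loop b.idx c) m (k * (T + e.u) + e.u) Q := by
  refine Tri.loop (fun τ m => ∃ k, I k m ∧ τ = k * (T + e.u) + e.u) ?_ ?_ ⟨k, h, rfl⟩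
  · rintro τ m ⟨k, hI, rfl⟩ hb
    obtain ⟨k', rfl, hT⟩ := hstep k m hI hb
    refine ⟨T, k' * (T + e.u) + e.u, ?_, hT.mono le_rfl fun m' hm' => ⟨k', hm', rfl⟩⟩
    rw [Nat.succ_mul]; omega
  · rintro τ m ⟨k, hI, rfl⟩ hb
    exact ⟨by omega, hexit k m hI hb⟩

theorem Tri.instr {i : Instr 12} {m m' : Mem n} (hout : (i.event e.O m.toStore).out = none)
    (hside : e.Side m.toStore i) (heval : i.eval e.O m.toStore = m'.toStore) :
    Tri e (.instr i) m (e.cost i) (· = m') := by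
  intro hg
  obtain ⟨h1, h2, h3⟩ := hg.instr hside
  rw [heval] at h1 h2
  refine ⟨_, m', heval ▸ Exec.instr i _, by simp [outputs, hout], ?_, ?_, h1, rfl⟩
  · simpa [duration, Instr.event, Mem.toStore] using h2
  · intro x hx
    rw [List.mem_singleton] at hx
    subst hx
    exact h3

/-- The instructions that do not call the lister, with named registers. -/
inductive Op
  | setF (b : FReg) (x : Bool)
  | clrE (x : EReg)
  | cpE (x x' : EReg)
  | succE (x : EReg)
  | nextE (x : EReg) (s : SReg)
  | nullE (b : FReg) (x : EReg)
  | eqE (b : FReg) (x x' : EReg)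
  | clrS (s : SReg)
  | cpS (s t : SReg)
  | insE (s : SReg) (x : EReg)
  | delE (s : SReg) (x : EReg)
  | memE (b : FReg) (x : EReg) (s : SReg)
  | eqS (b : FReg) (s t : SReg)
  | qry (b : FReg) (s : SReg)
  | stopL

def Op.toInstr : Op → Instr 12
  | setF b x => .setFlag b.idx x
  | clrE x => .clearElt x.idx
  | cpE x x' => .copyElt x.idx x'.idx
  | succE x => .succElt x.idx
  | nextE x s => .nextElt x.idx s.idx
  | nullE b x => .isNull b.idx x.idx
  | eqE b x x' => .eqElt b.idx x.idx x'.idx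
  | clrS s => .clearSet s.idx
  | cpS s t => .copySet s.idx t.idx
  | insE s x => .insertElt s.idx x.idx
  | delE s x => .eraseElt s.idx x.idx
  | memE b x s => .memElt b.idx x.idx s.idx
  | eqS b s t => .eqSet b.idx s.idx t.idx
  | qry b s => .query b.idx s.idx
  | stopL => .stopList

/-- Adding an element that may be null. -/
def insertOpt (a : Option (Fin n)) (X : Finset (Fin n)) : Finset (Fin n) :=
  match a with
  | none => X
  | some a => insert a X

/-- Removing an element that may be null. -/
def eraseOpt (a : Option (Fin n)) (X : Finset (Fin n)) : Finset (Fin n) :=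
  match a with
  | none => X
  | some a => X.erase a

/-- Testing an element that may be null. -/
def memOpt (a : Option (Fin n)) (X : Finset (Fin n)) : Bool :=
  match a with
  | none => false
  | some a => decide (a ∈ X)

/-- Effect of an instruction on the named registers. -/
def Op.app (F : Finset (Finset (Fin n))) (m : Mem n) : Op → Mem n
  | setF b x => b.set m x
  | clrE x => x.set m none
  | cpE x x' => x.set m (x'.get m)
  | succE x => x.set m (nextIn (List.finRange n) (x.get m))
  | nextE x s => x.set m (nextIn (sorted (s.get m)) (x.get m))
  | nullE b x => b.set m (x.get m).isNone
  | eqE b x x' => b.set m (decide (x.get m = x'.get m))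
  | clrS s => s.set m ∅
  | cpS s t => s.set m (t.get m)
  | insE s x => s.set m (insertOpt (x.get m) (s.get m))
  | delE s x => s.set m (eraseOpt (x.get m) (s.get m))
  | memE b x s => b.set m (memOpt (x.get m) (s.get m))
  | eqS b s t => b.set m (decide (s.get m = t.get m))
  | qry b s => b.set m (decide (s.get m ∈ F))
  | stopL => m.setLister none

/-- What has to be known in order to execute an instruction. -/
def Op.Ok (q : ℕ) (m : Mem n) : Op → Prop
  | insE s x => #(insertOpt (x.get m) (s.get m)) ≤ q + 1
  | _ => True

theorem SReg.set_get (r : SReg) (m : Mem n) : r.set m (r.get m) = m := by cases r <;> rfl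

theorem Op.eval_toInstr (O : Oracle n) (o : Op) (m : Mem n) :
    o.toInstr.eval O m.toStore = (o.app O.fam m).toStore := by
  cases o with
  | insE s x =>
    simp only [Op.toInstr, Instr.eval, Op.app, elt_toStore, fset_toStore]
    cases x.get m with
    | none => simp only [insertOpt, SReg.set_get]
    | some a => simp only [insertOpt, putSet_toStore]
  | delE s x =>
    simp only [Op.toInstr, Instr.eval, Op.app, elt_toStore, fset_toStore]
    cases x.get m with
    | none => simp only [eraseOpt, SReg.set_get]
    | some a => simp only [eraseOpt, putSet_toStore]
  | memE b x s =>
    simp only [Op.toInstr, Instr.eval, Op.app, elt_toStore, fset_toStore]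
    cases x.get m with
    | none => simp only [memOpt, putFlag_toStore]
    | some a => simp only [memOpt, putFlag_toStore]
  | stopL => exact m.toStore_setLister none
  | _ =>
    simp only [Op.toInstr, Instr.eval, Op.app, elt_toStore, fset_toStore, putFlag_toStore,
      putElt_toStore, putSet_toStore]

theorem Op.tri (o : Op) {m : Mem n} (h : o.Ok (rank e.O.fam) m) :
    Tri e (.instr o.toInstr) m e.u (· = o.app e.O.fam m) := by
  have hc : e.cost o.toInstr = e.u := by cases o <;> rfl
  rw [← hc]
  refine Tri.instr (by cases o <;> rfl) ?_ (o.eval_toInstr e.O m)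
  cases o with
  | insE s x =>
    intro a ha
    rw [elt_toStore] at ha
    simp only [Op.Ok, ha, insertOpt] at h
    rwa [fset_toStore]
  | _ => trivial

/-- A block of instructions. -/
def blk : List Op → Cmd 12
  | [] => .instr (Op.cpE .y .y).toInstr
  | o :: l => .seq (.instr o.toInstr) (blk l)

/-- Effect of a block. -/
def runBlk (F : Finset (Finset (Fin n))) : List Op → Mem n → Mem n
  | [], m => m
  | o :: l, m => runBlk F l (o.app F m)

/-- What has to be known in order to execute a block. -/
def OkBlk (F : Finset (Finset (Fin n))) : List Op → Mem n → Prop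
  | [], _ => True
  | o :: l, m => o.Ok (rank F) m ∧ OkBlk F l (o.app F m)

/-- The additional unit pays for the copy of a word onto itself that ends each block and serves as
the empty program. -/
theorem Tri.blk (l : List Op) {m : Mem n} (h : OkBlk e.O.fam l m) :
    Tri e (blk l) m ((l.length + 1) * e.u) (· = runBlk e.O.fam l m) := by
  induction l generalizing m with
  | nil => exact (Op.tri (e := e) (.cpE .y .y) (m := m) trivial).le (by simp)
  | cons o l ih =>
    have := Tri.call (Op.tri o h.1) (ih h.2)
    refine this.le (le_of_eq ?_)
    simp only [List.length_cons]; ring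

theorem Tri.call_le {c d : Cmd 12} {m m1 : Mem n} {T T' T0 : ℕ} {Q : Mem n → Prop}
    (h : Tri e c m T (· = m1)) (h' : Tri e d m1 T' Q) (hT : T + T' ≤ T0) :
    Tri e (.seq c d) m T0 Q := (Tri.call h h').le hT

theorem Tri.cond_le {c d : Cmd 12} {m : Mem n} {T T0 : ℕ} {Q : Mem n → Prop} {b : FReg}
    (h : b.get m = true → Tri e c m T Q) (h' : b.get m = false → Tri e d m T Q)
    (hT : e.u + T ≤ T0) : Tri e (.cond b.idx c d) m T0 Q := (Tri.cond h h').le hT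

theorem tri_startList {s : SReg} {x : EReg} {m : Mem n}
    (h : ∀ a, x.get m = some a → e.may (s.get m) a) :
    Tri e (.instr (.startList s.idx x.idx)) m (e.u + e.RT)
      (· = m.setLister ((x.get m).map fun w => (s.get m, w, 0))) := by
  refine Tri.instr (i := .startList s.idx x.idx) rfl ?_ ?_
  · intro a ha
    rw [elt_toStore] at ha
    rw [fset_toStore]; exact h a ha
  · simp only [Instr.eval, elt_toStore, fset_toStore, Mem.toStore_setLister]

theorem tri_nextList {b : FReg} {s : SReg} {m : Mem n} :
    Tri e (.instr (.nextList b.idx s.idx)) m e.u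
      (· = match m.lister with
        | none => b.set m false
        | some (P, w, i) =>
          match (e.O.restr P w)[i]? with
          | some R => (b.set (s.set m R) true).setLister (some (P, w, i + 1))
          | none => (b.set m false).setLister none) := by
  refine Tri.instr (i := .nextList b.idx s.idx) rfl trivial ?_
  have hl : m.toStore.lister = m.lister := rfl
  simp only [Instr.eval, hl]
  cases m.lister with
  | none => simp only [putFlag_toStore]
  | some x =>
    obtain ⟨P, w, i⟩ := x
    simp only
    cases (e.O.restr P w)[i]? with
    | none => simp only [putFlag_toStore, Mem.toStore_setLister]
    | some R => simp only [putFlag_toStore, putSet_toStore, Mem.toStore_setLister]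

end Logic

-- Loop-free code, cursors in sorted lists and the basic search for an element

section Code

variable {n : ℕ}

infixr:60 " ;; " => Cmd.seq

/-- Loop-free programs. -/
inductive Code
  | ops (l : List Op)
  | ite (b : FReg) (c d : Code)
  | seq (c d : Code)

/-- The program. -/
def Code.cmd : Code → Cmd 12
  | ops l => blk l
  | ite b c d => .cond b.idx c.cmd d.cmd
  | seq c d => .seq c.cmd d.cmd

/-- The effect of a loop-free program. -/
def Code.exec (F : Finset (Finset (Fin n))) : Code → Mem n → Mem n
  | ops l, m => runBlk F l m
  | ite b c d, m => bif b.get m then c.exec F m else d.exec F m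
  | seq c d, m => d.exec F (c.exec F m)

/-- What has to be known in order to execute a loop-free program. -/
def Code.Ok (F : Finset (Finset (Fin n))) : Code → Mem n → Prop
  | ops l, m => OkBlk F l m
  | ite b c d, m => (b.get m = true → c.Ok F m) ∧ (b.get m = false → d.Ok F m)
  | seq c d, m => c.Ok F m ∧ d.Ok F (c.exec F m)

/-- A bound for the number of steps. -/
def Code.len : Code → ℕ
  | ops l => l.length + 1
  | ite _ c d => 1 + max c.len d.len
  | seq c d => c.len + d.len

theorem Code.exec_ops (F : Finset (Finset (Fin n))) (l : List Op) (m : Mem n) :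
    (ops l).exec F m = runBlk F l m := rfl

theorem Code.exec_ite (F : Finset (Finset (Fin n))) (b : FReg) (c d : Code) (m : Mem n) :
    (ite b c d).exec F m = bif b.get m then c.exec F m else d.exec F m := rfl

theorem Code.exec_seq_ops (F : Finset (Finset (Fin n))) (l : List Op) (d : Code) (m : Mem n) :
    (seq (ops l) d).exec F m = d.exec F (runBlk F l m) := rfl

theorem Code.exec_seq_seq (F : Finset (Finset (Fin n))) (b c d : Code) (m : Mem n) :
    (seq (seq b c) d).exec F m = (seq b (seq c d)).exec F m := rfl

/-- The continuation is pushed into the branches, so that simplification evaluates a program along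
one path as soon as the flag is known. -/
theorem Code.exec_seq_ite (F : Finset (Finset (Fin n))) (b : FReg) (c c' d : Code) (m : Mem n) :
    (seq (ite b c c') d).exec F m = bif b.get m then (seq c d).exec F m else (seq c' d).exec F m := by
  cases h : b.get m <;> simp [Code.exec, h]

theorem Code.ok_seq_ops {F : Finset (Finset (Fin n))} {l : List Op} {d : Code} {m : Mem n} :
    (seq (ops l) d).Ok F m ↔ OkBlk F l m ∧ d.Ok F (runBlk F l m) := Iff.rfl

theorem Code.ok_seq_ite {F : Finset (Finset (Fin n))} {b : FReg} {c c' d : Code} {m : Mem n} :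
    (seq (ite b c c') d).Ok F m ↔
      (b.get m = true → (seq c d).Ok F m) ∧ (b.get m = false → (seq c' d).Ok F m) := by
  cases h : b.get m <;> simp [Code.Ok, Code.exec, h]

theorem Code.ok_ops {F : Finset (Finset (Fin n))} {l : List Op} {m : Mem n} :
    (ops l).Ok F m ↔ OkBlk F l m := Iff.rfl

theorem Code.ok_ite {F : Finset (Finset (Fin n))} {b : FReg} {c d : Code} {m : Mem n} :
    (ite b c d).Ok F m ↔ (b.get m = true → c.Ok F m) ∧ (b.get m = false → d.Ok F m) := Iff.rfl

attribute [simp] Code.exec_ops Code.exec_ite Code.exec_seq_ops Code.exec_seq_seq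
  Code.exec_seq_ite Code.ok_ops Code.ok_ite Code.ok_seq_ops Code.ok_seq_ite
  runBlk OkBlk Op.app Op.Ok FReg.set FReg.get EReg.set EReg.get SReg.set SReg.get Code.len

variable {e : Env n}

/-- Loop-free code thereby gets its triple from a syntactic length and an evaluation; only loops
require invariants. -/
theorem Code.tri (c : Code) {m : Mem n} (h : c.Ok e.O.fam m) :
    Tri e c.cmd m (c.len * e.u) (· = c.exec e.O.fam m) := by
  induction c generalizing m with
  | ops l => exact Tri.blk l h
  | ite b c d ihc ihd =>
    refine Tri.cond_le (T := max c.len d.len * e.u) (fun hb => ?_) (fun hb => ?_) ?_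
    · refine (ihc (h.1 hb)).mono (Nat.mul_le_mul_right _ (le_max_left _ _)) fun m' hm' => ?_
      rw [hm', Code.exec, hb, cond_true]
    · refine (ihd (h.2 hb)).mono (Nat.mul_le_mul_right _ (le_max_right _ _)) fun m' hm' => ?_
      rw [hm', Code.exec, hb, cond_false]
    · rw [Code.len, Nat.add_mul, one_mul]
  | seq c d ihc ihd =>
    refine (Tri.call (ihc h.1) (ihd h.2)).le (le_of_eq ?_)
    rw [Code.len, Nat.add_mul]

/-- A loop-free program at the end. -/
theorem Code.tri_end {c : Code} {m : Mem n} {T : ℕ} {Q : Mem n → Prop} (h : c.Ok e.O.fam m)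
    (hT : c.len * e.u ≤ T) (hQ : Q (c.exec e.O.fam m)) : Tri e c.cmd m T Q :=
  (c.tri h).mono hT fun m' hm' => by rw [hm']; exact hQ

/-- A loop-free program in front. -/
theorem Code.tri_seq {c : Code} {m m1 : Mem n} {d : Cmd 12} {T T' : ℕ} {Q : Mem n → Prop}
    (h : c.Ok e.O.fam m) (hm1 : c.exec e.O.fam m = m1) (h' : Tri e d m1 T' Q)
    (hT : c.len * e.u + T' ≤ T) : Tri e (.seq c.cmd d) m T Q :=
  (Tri.call (c.tri h) (hm1 ▸ h')).le hT

/-- The part of the increasing list `l` after the cursor `x` is `rest`. -/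
def Cursor (l : List (Fin n)) (x : Option (Fin n)) (rest : List (Fin n)) : Prop :=
  ∃ pre, l = pre ++ rest ∧ x = pre.getLast?

theorem Cursor.start (l : List (Fin n)) : Cursor l none l := ⟨[], rfl, rfl⟩

theorem Cursor.step {l : List (Fin n)} {x : Option (Fin n)} {a : Fin n} {rest : List (Fin n)}
    (h : Cursor l x (a :: rest)) : Cursor l (some a) rest := by
  obtain ⟨pre, h1, -⟩ := h
  exact ⟨pre ++ [a], by simp [h1], by simp⟩

/-- In an increasing list the first member larger than the last visited one is the head of the
unvisited part; a null cursor means that nothing has been visited. -/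
theorem Cursor.next {l : List (Fin n)} {x : Option (Fin n)} {rest : List (Fin n)}
    (h : Cursor l x rest) (hl : l.Pairwise (· < ·)) : nextIn l x = rest.head? := by
  obtain ⟨pre, rfl, rfl⟩ := h
  rcases List.eq_nil_or_concat pre with rfl | ⟨pre, a, rfl⟩
  · rfl
  · rw [List.concat_eq_append] at hl ⊢
    have h1 : ∀ b ∈ pre, ¬ a < b := fun b hb => by
      have := (List.pairwise_append.1 (List.pairwise_append.1 hl).1).2.2 b hb a (by simp)
      exact not_lt.2 this.le
    have h2 : ∀ b ∈ rest, a < b := fun b hb =>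
      (List.pairwise_append.1 hl).2.2 a (by simp) b hb
    simp only [List.getLast?_append, List.getLast?_singleton, Option.some_or,
      nextIn, List.find?_append]
    have h3 : pre.find? (fun y => decide (a < y)) = none := by
      simpa [List.find?_eq_none] using h1
    have h4 : rest.find? (fun y => decide (a < y)) = rest.head? := by
      cases rest with
      | nil => rfl
      | cons b rest => simp [h2 b (by simp)]
    simp [h3, h4]

/-- One pass of `pickProg`. -/
def pickBody : Code :=
  .seq (.ops [.succE .y, .nullE .t .y]) <|
  .ite .t (.ops [.setF .lp false]) <|
  .seq (.ops [.memE .t .y .X, .setF .ok true]) <|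
  .ite .t (.ops []) <|
  .seq (.ite .ua (.ops [.memE .ok .y .A]) (.ops [])) <|
  .ite .ok
    (.seq (.ops [.cpS .D .X, .insE .D .y, .qry .t .D, .cpS .D .B, .insE .D .y, .qry .ok .D])
      (.ite .t (.ite .ok (.ops [.setF .lp false]) (.ops [])) (.ops [])))
    (.ops [])

/-- The first `y` with `y ∉ X`, `X ∪ {y} ∈ F`, `B ∪ {y} ∈ F`, and `y ∈ A` if `ua` is set. -/
def pickProg : Cmd 12 :=
  (Code.ops [.clrE .y, .setF .lp true]).cmd ;;
  .loop FReg.lp.idx pickBody.cmd ;;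
  (Code.ops [.setF .t false, .setF .ok false, .clrS .D]).cmd

/-- The set that `A` stands for. -/
def Mem.dom (m : Mem n) : Finset (Fin n) := if m.ua then m.A else univ

/-- The condition that is tested by `pickProg`. -/
def pickCond (F : Finset (Finset (Fin n))) (m : Mem n) (y : Fin n) : Bool :=
  decide (y ∈ addable F m.X m.dom ∧ insert y m.B ∈ F)

theorem card_insertOpt {x : Option (Fin n)} {X : Finset (Fin n)} {q : ℕ} (h : #X ≤ q) :
    #(insertOpt x X) ≤ q + 1 := by
  cases x with
  | none => exact h.trans (Nat.le_succ _)
  | some a => exact (card_insert_le _ _).trans (Nat.succ_le_succ h)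

theorem tri_pick {m : Mem n} (hX : #m.X ≤ rank e.O.fam) (hB : #m.B ≤ rank e.O.fam) :
    Tri e pickProg m ((30 * n + 50) * e.u)
      (· = { m with
        y := (List.finRange n).find? (pickCond e.O.fam m)
        lp := false, t := false, ok := false, D := ∅ }) := by
  unfold pickProg
  set r := (List.finRange n).find? (pickCond e.O.fam m) with hr
  refine Code.tri_seq (T' := (n + 1) * (25 * e.u + e.u) + e.u + 4 * e.u) ?_ rfl ?_ ?_
  · simp [Code.Ok, OkBlk, Op.Ok]
  -- While the loop goes on, searching the unvisited elements gives the same result as searching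
  -- all. The pass beyond n is the one that meets the end of the list.
  · refine Tri.seq (Tri.loop_count (b := .lp) (k := n + 1) (fun k m' => ∃ rest yv b tv okv Dv,
      m' = { m with y := yv, lp := b, t := tv, ok := okv, D := Dv } ∧
      (b = true → rest.length + 1 = k ∧ Cursor (List.finRange n) yv rest ∧
        rest.find? (pickCond e.O.fam m) = r) ∧ (b = false → yv = r)) (25 * e.u) ?_ ?_ ?_)
    · rintro k m' ⟨rest, yv, b, tv, okv, Dv, rfl, h1, -⟩ hb
      obtain ⟨hk, hcur, hf⟩ := h1 hb
      simp only [FReg.get] at hb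
      subst hb
      refine ⟨rest.length, hk.symm, Code.tri_end ?_ ?_ ?_⟩
      · simp [pickBody, card_insertOpt hX, card_insertOpt hB]
      · exact Nat.mul_le_mul_right _ (by simp [pickBody])
      · have hn := hcur.next (List.pairwise_lt_finRange n)
        cases rest with
        | nil =>
          refine ⟨[], none, false, true, okv, Dv, ?_, by simp, fun _ => hf⟩
          simp [pickBody, hn]
        | cons x rest =>
          have hex : ∃ tv' okv' Dv',
              pickBody.exec e.O.fam { m with y := yv, lp := true, t := tv, ok := okv, D := Dv } =
              { m with y := some x, lp := !pickCond e.O.fam m x, t := tv', ok := okv', D := Dv' } := by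
            by_cases h1 : x ∈ m.X
            · simp [pickBody, hn, memOpt, pickCond, mem_addable, h1]
            · cases h2 : m.ua <;> by_cases h3 : x ∈ m.A <;> by_cases h4 : insert x m.X ∈ e.O.fam <;>
                by_cases h5 : insert x m.B ∈ e.O.fam <;>
                simp [pickBody, hn, memOpt, insertOpt, pickCond, mem_addable, Mem.dom, h1, h2, h3, h4, h5]
          obtain ⟨tv', okv', Dv', hex⟩ := hex
          refine ⟨rest, _, _, _, _, _, hex, fun hp => ⟨rfl, hcur.step, ?_⟩, fun hp => ?_⟩
          · rw [← hf, List.find?_cons_of_neg (by simpa using hp)]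
          · rw [← hf, List.find?_cons_of_pos (by simpa using hp)]
    · rintro k m' ⟨rest, yv, b, tv, okv, Dv, rfl, -, h1⟩ hb
      simp only [FReg.get] at hb
      obtain rfl := h1 hb
      refine Code.tri_end ?_ ?_ ?_
      · simp
      · simp
      · simp [hb]
    · refine ⟨List.finRange n, none, true, m.t, m.ok, m.D, by simp, fun _ => ⟨by simp, Cursor.start _, rfl⟩, by simp⟩
  · simp only [Code.len, List.length_cons, List.length_nil]
    ring_nf
    nlinarith [Nat.zero_le (n * e.u), Nat.zero_le e.u]

end Code

-- Programs for the source, the layer sets and the two choosers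

section Choosers

variable {n : ℕ} {e : Env n}

theorem find?_finRange_eq_some {p : Fin n → Bool} {a : Fin n} :
    (List.finRange n).find? p = some a ↔ p a = true ∧ ∀ b, p b = true → a ≤ b := by
  have : (List.finRange n).find? p = (sorted (univ.filter fun x => p x = true)).head? := by
    simp [sorted]
  rw [this, head?_sorted_eq_some]
  simp

theorem source_eq_find? (F : Finset (Finset (Fin n))) (X : Finset (Fin n)) :
    source F X = (sorted X).find? fun x => decide ({x} ∈ F) := by
  rw [← List.head?_filter, source]
  congr 1
  simp only [sorted, List.filter_filter]
  refine List.filter_congr fun x _ => ?_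
  simp [singles, Bool.and_comm]

/-- One pass of `srcProg`. -/
def srcBody : Code :=
  .seq (.ops [.nextE .sx .X, .nullE .t .sx]) <|
  .ite .t (.ops [.setF .lp false]) <|
  .seq (.ops [.clrS .D, .insE .D .sx, .qry .t .D]) (.ite .t (.ops [.setF .lp false]) (.ops []))

/-- The source of `X`. -/
def srcProg : Cmd 12 :=
  (Code.ops [.clrE .sx, .setF .lp true]).cmd ;;
  .loop FReg.lp.idx srcBody.cmd ;;
  (Code.ops [.setF .t false, .clrS .D]).cmd

theorem tri_src {m : Mem n} (hX : #m.X ≤ rank e.O.fam) :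
    Tri e srcProg m ((20 * rank e.O.fam + 50) * e.u)
      (· = { m with sx := source e.O.fam m.X, lp := false, t := false, D := ∅ }) := by
  unfold srcProg
  rw [source_eq_find?]
  set r := (sorted m.X).find? (fun x => decide ({x} ∈ e.O.fam)) with hr
  refine Code.tri_seq (T' := (#m.X + 1) * (15 * e.u + e.u) + e.u + 4 * e.u) ?_ rfl ?_ ?_
  · simp
  · refine Tri.seq (Tri.loop_count (b := .lp) (k := #m.X + 1) (fun k m' => ∃ rest xv b tv Dv,
      m' = { m with sx := xv, lp := b, t := tv, D := Dv } ∧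
      (b = true → rest.length + 1 = k ∧ Cursor (sorted m.X) xv rest ∧
        rest.find? (fun x => decide ({x} ∈ e.O.fam)) = r) ∧ (b = false → xv = r)) (15 * e.u) ?_ ?_ ?_)
    · rintro k m' ⟨rest, xv, b, tv, Dv, rfl, h1, -⟩ hb
      obtain ⟨hk, hcur, hf⟩ := h1 hb
      simp only [FReg.get] at hb
      subst hb
      have hn := hcur.next (pairwise_lt_sorted m.X)
      refine ⟨rest.length, hk.symm, Code.tri_end ?_ ?_ ?_⟩
      · simp only [srcBody, Code.ok_seq_ops, Code.ok_ops, Code.ok_ite, OkBlk, runBlk, Op.app, Op.Ok,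
          FReg.set, FReg.get, EReg.set, EReg.get, SReg.set, SReg.get, true_and, and_true,
          implies_true]
        exact fun _ => card_insertOpt (by simp)
      · exact Nat.mul_le_mul_right _ (by simp only [srcBody, Code.len, List.length_cons, List.length_nil]; omega)
      · cases rest with
        | nil =>
          refine ⟨[], none, false, true, Dv, ?_, by simp, fun _ => hf⟩
          simp [srcBody, hn]
        | cons x rest =>
          have hex : ∃ tv' Dv',
              srcBody.exec e.O.fam { m with sx := xv, lp := true, t := tv, D := Dv } =
              { m with sx := some x, lp := !decide ({x} ∈ e.O.fam), t := tv', D := Dv' } := by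
            by_cases h1 : {x} ∈ e.O.fam <;> simp [srcBody, hn, insertOpt, h1]
          obtain ⟨tv', Dv', hex⟩ := hex
          refine ⟨rest, _, _, _, _, hex, fun hp => ⟨rfl, hcur.step, ?_⟩, fun hp => ?_⟩
          · rw [← hf, List.find?_cons_of_neg (by simpa using hp)]
          · rw [← hf, List.find?_cons_of_pos (by simpa using hp)]
    · rintro k m' ⟨rest, xv, b, tv, Dv, rfl, -, h1⟩ hb
      simp only [FReg.get] at hb
      obtain rfl := h1 hb
      refine Code.tri_end ?_ ?_ ?_
      · simp
      · exact Nat.mul_le_mul_right _ (by simp only [Code.len, List.length_cons, List.length_nil]; omega)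
      · simp [hb]
    · exact ⟨sorted m.X, none, true, m.t, m.D, by simp,
        fun _ => ⟨by simp [length_sorted], Cursor.start _, rfl⟩, by simp⟩
  · simp only [Code.len, List.length_cons, List.length_nil]
    have := Nat.mul_le_mul_right e.u hX
    ring_nf at this ⊢
    nlinarith [Nat.zero_le (rank e.O.fam * e.u), Nat.zero_le e.u]

/-- One pass of `growProg`. -/
def growBody : Code :=
  .seq (.ops [.nextE .z .X, .nullE .t .z]) <|
  .ite .t (.ops [.setF .lp false]) <|
  .seq (.ops [.cpS .D .B, .insE .D .z, .qry .t .D]) (.ite .t (.ops [.insE .E .z]) (.ops []))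

/-- The next layer set. -/
def growProg : Cmd 12 :=
  (Code.ops [.clrE .z, .cpS .E .B, .setF .lp true]).cmd ;;
  .loop FReg.lp.idx growBody.cmd ;;
  (Code.ops [.setF .t false, .cpS .B .E, .clrS .D, .clrS .E]).cmd

theorem tri_grow {m : Mem n} (hX : #m.X ≤ rank e.O.fam) (hB : m.B ⊆ m.X) :
    Tri e growProg m ((20 * rank e.O.fam + 50) * e.u)
      (· = { m with
        B := m.B ∪ (addable e.O.fam m.B univ ∩ m.X), z := none, lp := false, t := false, D := ∅, E := ∅ }) := by
  unfold growProg
  set r := m.B ∪ (addable e.O.fam m.B univ ∩ m.X) with hr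
  refine Code.tri_seq (T' := (#m.X + 1) * (15 * e.u + e.u) + e.u + 6 * e.u) ?_ rfl ?_ ?_
  · simp
  -- E collects the next layer set: E together with the unvisited elements of X that pass the test
  -- against the old B is the final result.
  · refine Tri.seq (Tri.loop_count (b := .lp) (k := #m.X + 1) (fun k m' => ∃ rest xv b tv Dv Ev,
      m' = { m with z := xv, lp := b, t := tv, D := Dv, E := Ev } ∧ Ev ⊆ m.X ∧
      (b = true → rest.length + 1 = k ∧ Cursor (sorted m.X) xv rest ∧
        Ev ∪ (rest.toFinset.filter fun x => insert x m.B ∈ e.O.fam) = r) ∧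
      (b = false → xv = none ∧ Ev = r)) (15 * e.u) ?_ ?_ ?_)
    · rintro k m' ⟨rest, xv, b, tv, Dv, Ev, rfl, hEv, h1, -⟩ hb
      obtain ⟨hk, hcur, hf⟩ := h1 hb
      simp only [FReg.get] at hb
      subst hb
      have hn := hcur.next (pairwise_lt_sorted m.X)
      refine ⟨rest.length, hk.symm, Code.tri_end ?_ ?_ ?_⟩
      · have h1 := card_insertOpt (x := nextIn (sorted m.X) xv) ((card_le_card hB).trans hX)
        have h2 := card_insertOpt (x := nextIn (sorted m.X) xv) ((card_le_card hEv).trans hX)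
        simp [growBody, h1, h2]
      · exact Nat.mul_le_mul_right _ (by simp only [growBody, Code.len, List.length_cons, List.length_nil]; omega)
      · cases rest with
        | nil =>
          refine ⟨[], none, false, true, Dv, Ev, ?_, hEv, by simp, fun _ => ⟨rfl, by simpa using hf⟩⟩
          simp [growBody, hn]
        | cons x rest =>
          have hxX : x ∈ m.X := by
            obtain ⟨pre, h, -⟩ := hcur
            rw [← mem_sorted, h]; simp
          have hex : ∃ tv' Dv',
              growBody.exec e.O.fam { m with z := xv, lp := true, t := tv, D := Dv, E := Ev } =
              { m with z := some x, lp := true, t := tv', D := Dv',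
                       E := if insert x m.B ∈ e.O.fam then insert x Ev else Ev } := by
            by_cases h1 : insert x m.B ∈ e.O.fam <;> simp [growBody, hn, insertOpt, h1]
          obtain ⟨tv', Dv', hex⟩ := hex
          refine ⟨rest, _, _, _, _, _, hex, ?_, fun hp => ⟨rfl, hcur.step, ?_⟩, by simp⟩
          · split_ifs
            exacts [insert_subset hxX hEv, hEv]
          · rw [← hf, List.toFinset_cons, filter_insert]
            split_ifs
            · rw [insert_union, union_insert]
            · rfl
    · rintro k m' ⟨rest, xv, b, tv, Dv, Ev, rfl, -, -, h1⟩ hb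
      simp only [FReg.get] at hb
      obtain ⟨rfl, rfl⟩ := h1 hb
      refine Code.tri_end ?_ ?_ ?_
      · simp
      · exact Nat.mul_le_mul_right _ (by simp only [Code.len, List.length_cons, List.length_nil]; omega)
      · simp [hb]
    · refine ⟨sorted m.X, none, true, m.t, m.D, m.B, by simp, hB,
        fun _ => ⟨by simp [length_sorted], Cursor.start _, ?_⟩, by simp⟩
      -- The program does not test that an element lies outside B; elements of B are in E from the
      -- start, so this changes nothing.
      ext x
      simp only [hr, toFinset_sorted, mem_union, mem_filter, mem_inter, mem_addable, mem_univ, true_and]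
      tauto
  · simp only [Code.len, List.length_cons, List.length_nil]
    have := Nat.mul_le_mul_right e.u hX
    ring_nf at this ⊢
    nlinarith [Nat.zero_le (rank e.O.fam * e.u), Nat.zero_le e.u]

/-- The memory after the result `y` of `choose` was computed. -/
def Mem.chosen (m : Mem n) (y : Option (Fin n)) : Mem n :=
  { m with y := y, sx := none, z := none, lp := false, lp2 := false, t := false, ok := false,
           B := ∅, D := ∅, E := ∅ }

/-- The program `c` computes `choose(X, A)` in time `T`. -/
def ChooseSpec (e : Env n) (c : Cmd 12) (ch : Chooser n) (T : ℕ) : Prop :=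
  ∀ m : Mem n, m.X ∈ e.O.fam → m.X.Nonempty → Tri e c m T (· = m.chosen (ch m.X m.dom))

theorem card_le_rank {F : Finset (Finset (Fin n))} {X : Finset (Fin n)} (h : X ∈ F) : #X ≤ rank F :=
  le_sup (f := Finset.card) h

theorem rank_le (F : Finset (Finset (Fin n))) : rank F ≤ n :=
  Finset.sup_le fun X _ => by simpa using card_le_univ X

/-- `choose` of the basic framework. -/
def chooseMinProg : Cmd 12 :=
  (Code.ops [.cpS .B .X]).cmd ;; pickProg ;;
  (Code.ops [.clrE .sx, .clrE .z, .setF .lp2 false, .clrS .B, .clrS .E]).cmd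

/-- With B = X the second test of `pickProg` repeats the first, so the routine made for layers also
finds the minimum. -/
theorem chooseSpec_min : ChooseSpec e chooseMinProg (chooseMin e.O.fam) ((30 * n + 60) * e.u) := by
  intro m hX _
  have hq := card_le_rank hX
  have hr : (List.finRange n).find? (pickCond e.O.fam { m with B := m.X }) =
      chooseMin e.O.fam m.X m.dom := by
    have : chooseMin e.O.fam m.X m.dom =
        (List.finRange n).find? (fun y => decide (y ∈ addable e.O.fam m.X m.dom)) := by
      rw [← List.head?_filter]; rfl
    rw [this]
    congr 1
    funext y
    simp only [pickCond, mem_addable, Mem.dom, decide_eq_decide]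
    tauto
  unfold chooseMinProg
  refine Code.tri_seq (T' := (30 * n + 50) * e.u + 6 * e.u) ?_ rfl ?_ ?_
  · simp
  · refine Tri.call (tri_pick hq hq) (Code.tri_end ?_ ?_ ?_)
    · simp
    · simp
    · simp [Mem.chosen, ← hr]
  · simp only [Code.len, List.length_cons, List.length_nil]
    ring_nf
    nlinarith [Nat.zero_le (n * e.u), Nat.zero_le e.u]

/-- Layers need not be computed or stored. When the layer sets are scanned upwards, the first that
admits an element of X⁺_A reveals the least layer, and the least such element has the least pair. -/
theorem chooseLay_eq_some {F : Finset (Finset (Fin n))} (h0 : ∅ ∈ F) (hs : StronglyAccessible F)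
    (hc : Commutable F) {X A : Finset (Fin n)} {t y : Fin n} (hX : X ∈ F)
    (ht : source F X = some t) {i : ℕ}
    (hprev : ∀ i' < i, ∀ y ∈ addable F X A, insert y (layerSet F X t i') ∉ F)
    (hy : y ∈ addable F X A) (hyi : insert y (layerSet F X t i) ∈ F)
    (hmin : ∀ b ∈ addable F X A, insert b (layerSet F X t i) ∈ F → y ≤ b) :
    chooseLay F X A = some y := by
  have K := keyChooser_chooseLay h0 hs
  obtain ⟨⟨htX, htF⟩, -⟩ := source_eq_some.1 ht
  cases hy0 : chooseLay F X A with
  | none => simp [K.eq_empty hX ⟨t, htX⟩ hy0] at hy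
  | some y0 =>
    have hy0' := K.mem hy0
    have hle := K.le hy0 hy
    have h1 := mem_addable.1 hy
    have h2 := mem_addable.1 hy0'
    obtain ⟨i1, hi1, hyi1⟩ := exists_mem_addable_layerSet hs hc hX htX htF h1.2.1 h1.2.2
    obtain ⟨i2, hi2, hyi2⟩ := exists_mem_addable_layerSet hs hc hX htX htF h2.2.1 h2.2.2
    obtain ⟨-, -, -, a1⟩ := lay_spec hi1 hyi1
    obtain ⟨b1, -, b2, -⟩ := lay_spec hi2 hyi2
    have h3 := a1 i (mem_addable.2 ⟨mem_univ _, fun h => h1.2.1 (layerSet_subset htX i h), hyi⟩)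
    have h4 : i ≤ lay F X t y0 - 1 := by
      by_contra hlt
      exact hprev _ (not_le.1 hlt) y0 hy0' (mem_addable.1 b2).2.2
    have hle' : layKey F X y ≤ layKey F X y0 := by
      simp only [layKey, ht, Prod.Lex.toLex_le_toLex]
      by_cases h5 : lay F X t y < lay F X t y0
      · exact Or.inl h5
      · have h6 : lay F X t y0 - 1 = i := by omega
        rw [h6] at b2
        exact Or.inr ⟨by omega, hmin y0 hy0' (mem_addable.1 b2).2.2⟩
    rw [K.inj X (le_antisymm hle hle')]

/-- One pass of `chooseLayProg`. -/
def layBody : Cmd 12 :=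
  pickProg ;; (Code.ops [.nullE .t .y]).cmd ;;
  .cond FReg.t.idx
    ((Code.ops [.eqS .t .B .X]).cmd ;;
      .cond FReg.t.idx (Code.ops [.setF .lp2 false]).cmd growProg)
    (Code.ops [.setF .lp2 false]).cmd

/-- `choose` of the refined framework. -/
def chooseLayProg : Cmd 12 :=
  srcProg ;; (Code.ops [.clrS .B, .insE .B .sx, .setF .lp2 true]).cmd ;;
  .loop FReg.lp2.idx layBody ;;
  (Code.ops [.clrE .sx, .clrE .z, .setF .lp false, .setF .t false, .setF .ok false, .clrS .B, .clrS .D, .clrS .E]).cmd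

theorem chooseSpec_lay (h0 : ∅ ∈ e.O.fam) (hs : StronglyAccessible e.O.fam)
    (hc : Commutable e.O.fam) :
    ChooseSpec e chooseLayProg (chooseLay e.O.fam) (500 * (rank e.O.fam * n * e.u)) := by
  intro m hX hne
  have hq := card_le_rank hX
  obtain ⟨t, ht⟩ := exists_source h0 hs hX hne
  obtain ⟨⟨htX, htF⟩, -⟩ := source_eq_some.1 ht
  have hcard : 1 ≤ #m.X := hne.card_pos
  set TB := (30 * n + 20 * rank e.O.fam + 120) * e.u with hTB
  set r := chooseLay e.O.fam m.X m.dom with hr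
  unfold chooseLayProg
  refine Tri.call_le (tri_src hq) (Code.tri_seq (T' := #m.X * (TB + e.u) + e.u + 9 * e.u) ?_ rfl ?_ le_rfl) ?_
  · simp only [Code.ok_ops, OkBlk, Op.app, Op.Ok, EReg.get, SReg.set, SReg.get,
      true_and, and_true]
    exact card_insertOpt (by simp)
  -- The number of rounds left is |X| - i; all earlier layer sets admitted no element of X⁺_A.
  · refine Tri.seq (Tri.loop_count (b := .lp2) (k := #m.X) (fun k m' => ∃ i b yv zv lpv tv okv Bv,
      m' = { m with y := yv, z := zv, sx := some t, lp := lpv, lp2 := b, t := tv, ok := okv, B := Bv, D := ∅, E := m'.E } ∧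
      (b = true → i + k = #m.X ∧ i < #m.X ∧ Bv = layerSet e.O.fam m.X t i ∧
        ∀ i' < i, ∀ y ∈ addable e.O.fam m.X m.dom, insert y (layerSet e.O.fam m.X t i') ∉ e.O.fam) ∧
      (b = false → yv = r)) TB ?_ ?_ ?_)
    · rintro k m' ⟨i, b, yv, zv, lpv, tv, okv, Bv, hm', h1, -⟩ hb
      generalize m'.E = Ev at hm'
      subst hm'
      obtain ⟨hk, hi, rfl, hprev⟩ := h1 hb
      simp only [FReg.get] at hb
      subst hb
      refine ⟨k - 1, by omega, ?_⟩
      have hBX : layerSet e.O.fam m.X t i ⊆ m.X := layerSet_subset htX i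
      refine Tri.call_le (tri_pick hq ((card_le_card hBX).trans hq)) (Code.tri_seq
        (T' := e.u + (e.u + e.u + (e.u + (20 * rank e.O.fam + 50) * e.u))) ?_ rfl ?_ le_rfl) ?_
      · simp
      · cases hf : (List.finRange n).find? (pickCond e.O.fam { m with
            y := yv, z := zv, sx := some t, lp := lpv, lp2 := true, t := tv, ok := okv,
            B := layerSet e.O.fam m.X t i, D := ∅, E := Ev }) with
        | none =>
          have hnone : ∀ y ∈ addable e.O.fam m.X m.dom, insert y (layerSet e.O.fam m.X t i) ∉ e.O.fam := by
            intro y hy hyi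
            rw [List.find?_eq_none] at hf
            exact hf y (List.mem_finRange y) (by simpa [pickCond, Mem.dom] using ⟨hy, hyi⟩)
          refine Tri.cond (fun _ => Code.tri_seq (T' := e.u + (20 * rank e.O.fam + 50) * e.u) ?_ rfl ?_ ?_)
            (fun hb => absurd hb (by simp))
          · simp
          · refine Tri.cond (fun hb => Code.tri_end (by simp) ?_ ?_) (fun hb => ?_)
            · simp only [Code.len, List.length_cons, List.length_nil]
              nlinarith [Nat.zero_le (rank e.O.fam * e.u), Nat.zero_le e.u]
            -- Once B is all of X, the failed search says that nothing in the domain can be added to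
            -- X, so null is the right answer.
            · replace hb : layerSet e.O.fam m.X t i = m.X := of_decide_eq_true hb
              refine ⟨0, false, none, zv, false, true, false, layerSet e.O.fam m.X t i, by simp [hb], by simp, fun _ => ?_⟩
              rw [hr]
              cases hy0 : chooseLay e.O.fam m.X m.dom with
              | none => rfl
              | some y0 =>
                have K := keyChooser_chooseLay h0 hs
                have hm := K.mem hy0
                exact absurd (by rw [hb]; exact (mem_addable.1 hm).2.2) (hnone y0 hm)
            · replace hb : layerSet e.O.fam m.X t i ≠ m.X := of_decide_eq_false hb
              refine (tri_grow (by exact hq) (by exact hBX)).mono le_rfl ?_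
              rintro m' rfl
              -- A proper layer set has at least i + 1 and fewer than |X| elements, so the next
              -- index is still below |X|.
              have h2 := card_layerSet hs hc hX htX htF hb
              have h3 := card_lt_card (hBX.ssubset_of_ne hb)
              refine ⟨i + 1, true, none, none, false, false, false, _, by simp [layerSet], fun _ =>
                ⟨by omega, by omega, rfl, fun i' hi' => ?_⟩, by simp⟩
              rcases Nat.lt_succ_iff_lt_or_eq.1 hi' with h | rfl
              exacts [hprev i' h, hnone]
          · simp only [Code.len, List.length_cons, List.length_nil]
            ring_nf
            nlinarith [Nat.zero_le (rank e.O.fam * e.u), Nat.zero_le e.u]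
        | some y =>
          refine Tri.cond (fun hb => absurd hb (by simp)) (fun hb => Code.tri_end ?_ ?_ ?_)
          · simp
          · simp only [Code.len, List.length_cons, List.length_nil]
            nlinarith [Nat.zero_le (rank e.O.fam * e.u), Nat.zero_le e.u]
          · refine ⟨0, false, some y, zv, false, false, false, layerSet e.O.fam m.X t i, by simp, by simp, fun _ => ?_⟩
            rw [find?_finRange_eq_some] at hf
            have h2 : y ∈ addable e.O.fam m.X m.dom ∧ insert y (layerSet e.O.fam m.X t i) ∈ e.O.fam := by
              simpa [pickCond, Mem.dom] using hf.1
            refine (chooseLay_eq_some h0 hs hc hX ht hprev h2.1 h2.2 fun b hb hbi => hf.2 b ?_).symm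
            simpa [pickCond, Mem.dom] using ⟨hb, hbi⟩
      · simp only [hTB, Code.len, List.length_cons, List.length_nil]
        ring_nf
        nlinarith [Nat.zero_le (rank e.O.fam * e.u), Nat.zero_le e.u]
    · rintro k m' ⟨i, b, yv, zv, lpv, tv, okv, Bv, hm', -, h1⟩ hb
      generalize m'.E = Ev at hm'
      subst hm'
      simp only [FReg.get] at hb
      obtain rfl := h1 hb
      refine Code.tri_end ?_ ?_ ?_
      · simp
      · simp
      · simp [Mem.chosen, hb]
    · refine ⟨0, true, m.y, m.z, false, false, m.ok, {t}, ?_, fun _ => ⟨by simp, hcard, rfl, by simp⟩, by simp⟩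
      simp [ht, insertOpt]
  · have hn := rank_le e.O.fam
    have h1 : 1 ≤ rank e.O.fam := hcard.trans hq
    have h2 : #m.X * (TB + e.u) ≤ rank e.O.fam * (TB + e.u) := Nat.mul_le_mul_right _ hq
    have h3 : rank e.O.fam * rank e.O.fam * e.u ≤ rank e.O.fam * n * e.u :=
      Nat.mul_le_mul_right _ (Nat.mul_le_mul_left _ hn)
    have h4 : rank e.O.fam * 1 * e.u ≤ rank e.O.fam * n * e.u :=
      Nat.mul_le_mul_right _ (Nat.mul_le_mul_left _ (h1.trans hn))
    have h5 : 1 * e.u ≤ rank e.O.fam * e.u := Nat.mul_le_mul_right _ h1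
    simp only [hTB, Code.len, List.length_cons, List.length_nil] at h2 ⊢
    ring_nf at h2 h3 h4 h5 ⊢
    linarith

end Choosers

-- Programs for completions and for the branching data of a solution

section Completion

variable {n : ℕ} {e : Env n} {ch : Chooser n} {key : Finset (Fin n) → Fin n → ℕ ×ₗ Fin n}
  {choose : Cmd 12} {Tc : ℕ}

/-- The memory after a completion. -/
def Mem.completed (m : Mem n) (X : Finset (Fin n)) : Mem n :=
  { m with X := X, y := none, sx := none, z := none, lp := false, lp2 := false, lp3 := false,
           t := false, ok := false, B := ∅, D := ∅, E := ∅ }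

/-- Clearing the auxiliary registers of a completion. -/
def tidyOps : List Op :=
  [.clrE .y, .clrE .sx, .clrE .z, .setF .lp false, .setF .lp2 false, .setF .lp3 false, .setF .t false,
    .setF .ok false, .clrS .B, .clrS .D, .clrS .E]

theorem runBlk_tidyOps (F : Finset (Finset (Fin n))) (m : Mem n) :
    runBlk F tidyOps m = m.completed m.X := by simp [tidyOps, Mem.completed]

theorem okBlk_tidyOps (F : Finset (Finset (Fin n))) (m : Mem n) : OkBlk F tidyOps m := by
  simp [tidyOps]

/-- The end of one pass of `completeProg`. -/
def completeTail : Code :=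
  .seq (.ops [.nullE .t .y]) <|
  .ite .t (.ops [.setF .lp3 false]) <|
  .seq (.ops [.eqE .t .y .ws]) <| .ite .t (.ops [.setF .lp3 false]) (.ops [.insE .X .y])

/-- The completion of `X` within `A` (if `ua` is set), up to `ws`. -/
def completeProg (choose : Cmd 12) : Cmd 12 :=
  (Code.ops tidyOps).cmd ;; (Code.ops [.setF .lp3 true]).cmd ;;
  .loop FReg.lp3.idx (choose ;; completeTail.cmd) ;;
  (Code.ops tidyOps).cmd

/-- X stays a solution, so its size is at most q and the loop makes at most q passes. A null `ws`
never equals the chosen element, so one program computes full and truncated completions. -/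
theorem tri_complete (K : KeyChooser e.O.fam ch key) (hch : ChooseSpec e choose ch Tc)
    (hTc : e.u ≤ Tc) {m : Mem n} (hX : m.X ∈ e.O.fam) (hne : m.X.Nonempty) :
    Tri e (completeProg choose) m (50 * (rank e.O.fam * Tc))
      (· = m.completed (completeStop ch m.ws m.X m.dom)) := by
  have hq := card_le_rank hX
  have hcard := hne.card_pos
  set r := completeStop ch m.ws m.X m.dom with hr
  unfold completeProg
  refine Code.tri_seq (okBlk_tidyOps _ _) (runBlk_tidyOps _ _) (Code.tri_seq
    (T' := (rank e.O.fam + 1 - #m.X) * (Tc + 10 * e.u + e.u) + e.u + 12 * e.u) ?_ rfl ?_ le_rfl) ?_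
  · simp
  · refine Tri.seq (Tri.loop_count (b := .lp3) (fun k m' => ∃ X yv b tv,
      m' = { m.completed X with y := yv, lp3 := b, t := tv } ∧
      (b = true → X ∈ e.O.fam ∧ X.Nonempty ∧ #X + k = rank e.O.fam + 1 ∧
        completeStop ch m.ws X m.dom = r) ∧ (b = false → X = r)) (Tc + 10 * e.u) ?_ ?_ ?_)
    · rintro k m' ⟨X, yv, b, tv, rfl, h1, -⟩ hb
      obtain ⟨hXF, hXne, hk, hres⟩ := h1 hb
      replace hb : b = true := hb
      subst hb
      have hXq := card_le_rank hXF
      refine ⟨k - 1, by omega, Tri.call_le (hch _ hXF hXne) (T' := 10 * e.u) ?_ le_rfl⟩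
      have hst : ({ m.completed X with y := yv, lp3 := true, t := tv } : Mem n).chosen
          (ch X m.dom) = { m.completed X with y := ch X m.dom, lp3 := true, t := false } := rfl
      change Tri e completeTail.cmd (({ m.completed X with y := yv, lp3 := true, t := tv } : Mem n).chosen
          (ch X m.dom)) _ _
      rw [hst]
      refine Code.tri_end ?_ (Nat.mul_le_mul_right _ (by simp [completeTail])) ?_
      · simp [completeTail, Mem.completed, card_insertOpt hXq]
      · cases hy : ch X m.dom with
        | none =>
          refine ⟨X, none, false, true, by simp [completeTail, Mem.completed], by simp, fun _ => ?_⟩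
          rw [← hres]
          exact (completeStop_of_growStop_eq (by simp [growStop, hy])).symm
        | some y =>
          by_cases hw : some y = m.ws
          · refine ⟨X, some y, false, true, by simp [completeTail, Mem.completed, ← hw], by simp,
              fun _ => ?_⟩
            rw [← hres]
            exact (completeStop_of_growStop_eq (by simp [growStop, hy, ← hw])).symm
          · have hm := mem_addable.1 (K.mem hy)
            refine ⟨insert y X, some y, true, false, by simp [completeTail, Mem.completed, hw, insertOpt],
              fun _ => ⟨hm.2.2, insert_nonempty _ _, ?_, ?_⟩, by simp⟩
            · rw [card_insert_of_notMem hm.2.1]; omega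
            · rw [← hres, completeStop_insert hy hw]
    · rintro k m' ⟨X, yv, b, tv, rfl, -, h1⟩ hb
      obtain rfl := h1 hb
      exact Code.tri_end (okBlk_tidyOps _ _) (Nat.mul_le_mul_right _ (by simp [tidyOps]))
        (by simp [tidyOps, Mem.completed])
    · exact ⟨m.X, none, true, false, rfl, fun _ => ⟨hX, hne, by omega, rfl⟩, by simp⟩
  · have h1 : (rank e.O.fam + 1 - #m.X) * (Tc + 10 * e.u + e.u) ≤ rank e.O.fam * (12 * Tc) :=
      Nat.mul_le_mul (by omega) (by omega)
    have h2 : 1 * Tc ≤ rank e.O.fam * Tc := Nat.mul_le_mul_right _ (Nat.succ_le_of_lt hcard |>.trans hq)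
    simp only [Code.len, tidyOps, List.length_cons, List.length_nil]
    rw [Nat.mul_left_comm] at h1
    omega

theorem tri_complete_univ (K : KeyChooser e.O.fam ch key) (hch : ChooseSpec e choose ch Tc)
    (hTc : e.u ≤ Tc) {m : Mem n} (hX : m.X ∈ e.O.fam) (hne : m.X.Nonempty) (hws : m.ws = none)
    (hua : m.ua = false) :
    Tri e (completeProg choose) m (50 * (rank e.O.fam * Tc))
      (· = m.completed (complete ch m.X univ)) := by
  have := tri_complete K hch hTc hX hne
  rwa [hws, completeStop_none, show m.dom = univ by simp [Mem.dom, hua]] at this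

/-- `pi(S)`, where it is null for a root. -/
def branch (F : Finset (Finset (Fin n))) (ch : Chooser n) (S : Finset (Fin n)) : Option (Fin n) :=
  if 1 < piIndex F ch S then pi F ch S else none

/-- The end of one pass of `branchProg`. -/
def branchTail : Code :=
  .seq (.ops [.nullE .t .y]) <|
  .ite .t (.ops [.setF .lp3 false]) <|
  .seq (.ops [.eqE .t .v .y]) <|
  .seq (.ite .t (.ops []) (.ops [.cpE .pi .y, .cpS .core .X])) (.ops [.insE .X .y])

/-- The source, the branching element and the core of `S`. -/
def branchProg (choose : Cmd 12) : Cmd 12 :=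
  (Code.ops tidyOps).cmd ;; (Code.ops [.cpS .X .S]).cmd ;; srcProg ;;
  (Code.ops [.cpE .src .sx, .clrS .X, .insE .X .sx, .clrE .pi, .clrS .core, .cpS .A .S, .clrE .sx,
    .clrE .v, .setF .lp3 true]).cmd ;;
  .loop FReg.lp3.idx
    ((Code.ops [.setF .ua false]).cmd ;; choose ;; (Code.ops [.cpE .v .y, .setF .ua true]).cmd ;;
      choose ;; branchTail.cmd) ;;
  (Code.ops tidyOps).cmd ;;
  (Code.ops [.clrS .X, .clrS .A, .clrE .v, .setF .ua false]).cmd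

/-- No completions of prefixes are computed. Where the free choice is canonical, a prefix and its
successor have the same completion; where it is not, the prefix does not complete to S. Hence the
last disagreement along the canonical order gives core and pi, and O(q) calls of `choose` suffice.
-/
theorem tri_branch (h0 : ∅ ∈ e.O.fam) (hs : StronglyAccessible e.O.fam)
    (K : KeyChooser e.O.fam ch key) (hch : ChooseSpec e choose ch Tc)
    (hTc : e.u ≤ Tc) {m : Mem n} (hS : IsMaxSol e.O.fam m.S) (hne : m.S.Nonempty) :
    Tri e (branchProg choose) m (200 * (rank e.O.fam * Tc))
      (· = { m.completed ∅ with
        src := source e.O.fam m.S, pi := branch e.O.fam ch m.S, core := core e.O.fam ch m.S, A := ∅, v := none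
        ua := false }) := by
  have hq := card_le_rank hS.1
  have hcard := hne.card_pos
  obtain ⟨s, hsrc⟩ := exists_source h0 hs hS.1 hne
  set a := branch e.O.fam ch m.S with ha
  set c := core e.O.fam ch m.S with hc
  unfold branchProg
  refine Code.tri_seq (okBlk_tidyOps _ _) (runBlk_tidyOps _ _) (Code.tri_seq (m1 := { m.completed m.S with X := m.S }) ?_ rfl
    (Tri.call_le (tri_src (by exact hq))
    (Code.tri_seq (m1 := { m.completed {s} with
        src := some s, A := m.S, pi := none, core := ∅, v := none, lp3 := true })
    (T' := #m.S * (2 * Tc + 30 * e.u + e.u) + e.u + 17 * e.u) ?_ ?_ ?_ le_rfl) le_rfl) le_rfl) ?_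
  · simp
  · simpa using card_insertOpt (by simp)
  · simp [Mem.completed, hsrc, insertOpt]
  -- The recorded disagreement is claimed to be right only if the current prefix completes to S; at
  -- the end of the scan the prefix is S itself and the claim applies.
  · refine Tri.seq (Tri.loop_count (b := .lp3) (fun k m' => ∃ i yv b tv uv pv cv vv,
      m' = { m.completed (pref e.O.fam ch m.S i) with
        src := some s, A := m.S, y := yv, lp3 := b, t := tv, pi := pv, core := cv, v := vv, ua := uv } ∧
      (b = true → 1 ≤ i ∧ i ≤ #m.S ∧ i + k = #m.S + 1 ∧
        (complete ch (pref e.O.fam ch m.S i) univ = m.S → pv = a ∧ cv = c)) ∧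
      (b = false → pv = a ∧ cv = c)) (2 * Tc + 30 * e.u) ?_ ?_ ?_)
    · rintro k m' ⟨i, yv, b, tv, uv, pv, cv, vv, rfl, h1, -⟩ hb
      obtain ⟨hi, hiS, hk, hres⟩ := h1 hb
      replace hb : b = true := hb
      subst hb
      have hXF := K.pref_mem hsrc hi
      have hXne := K.pref_nonempty hsrc hi
      have hXq := card_le_rank hXF
      have hpc := K.pref_card hs hS.1 hsrc hi
      have hsub := K.pref_subset hsrc hi
      set X := pref e.O.fam ch m.S i with hX
      refine ⟨k - 1, by omega, Code.tri_seq (m1 := { m.completed X with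
        src := some s, A := m.S, y := yv, lp3 := true, t := tv, pi := pv, core := cv, v := vv, ua := false })
        ?_ rfl (Tri.call_le (hch _ hXF hXne) (Code.tri_seq (m1 := { m.completed X with
        src := some s, A := m.S, y := ch X univ, lp3 := true, t := false, pi := pv, core := cv, v := ch X univ, ua := true })
        ?_ rfl (Tri.call_le (hch _ hXF hXne) (T' := 20 * e.u) ?_ le_rfl) le_rfl) le_rfl) ?_⟩
      · simp
      · simp
      · change Tri e branchTail.cmd { m.completed X with
          src := some s, A := m.S, y := ch X m.S, lp3 := true, t := false, pi := pv, core := cv, v := ch X univ, ua := true } _ _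
        refine Code.tri_end ?_ (Nat.mul_le_mul_right _ (by simp [branchTail])) ?_
        · simp [branchTail, Mem.completed, card_insertOpt hXq]
        · cases hy : ch X m.S with
          | none =>
            have hXS : X = m.S := by
              by_contra hne
              obtain ⟨y, hy'⟩ := K.choose_pref hs hS.1 hsrc hi hne
              rw [← hX, hy] at hy'; cases hy'
            exact ⟨i, none, false, true, true, pv, cv, ch X univ, by simp [branchTail, Mem.completed, ← hX], by simp,
              fun _ => hres (by rw [hXS]; exact hS.eq_of_subset (K.complete_mem hS.1 _) (subset_complete _ _))⟩
          | some y =>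
            have hXS : X ≠ m.S := by
              intro h
              have := mem_addable.1 (K.mem hy)
              exact this.2.1 (h ▸ this.1)
            have hlt := card_lt_card (hsub.ssubset_of_ne hXS)
            have := hpc hXS
            have hps := pref_succ_of_some hsrc hi hy
            by_cases hv : ch X univ = some y
            · refine ⟨i + 1, some y, true, true, true, pv, cv, ch X univ, by simp [branchTail, Mem.completed, hv, insertOpt, hps, ← hX],
                fun _ => ⟨by omega, by omega, by omega, ?_⟩, by simp⟩
              rw [complete_pref_succ hsrc hi hy hv]
              exact hres
            · refine ⟨i + 1, some y, true, false, true, some y, X, ch X univ, by simp [branchTail, Mem.completed, hv, insertOpt, hps, ← hX],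
                fun _ => ⟨by omega, by omega, by omega, fun hcomp => ?_⟩, by simp⟩
              have hne := K.complete_pref_ne hsrc hi hy hv
              -- No index up to i is good, since goodness would pass on to the prefix i, where the
              -- choices disagree.
              have hpi : piIndex e.O.fam ch m.S = i + 1 := by
                refine K.piIndex_eq hs hS hsrc (by omega) hcomp fun j hj hji hcj => hne ?_
                exact K.complete_pref_of_le hS hsrc hj (by omega) hcj
              have hi0 : i ≠ 0 := by omega
              simp [ha, hc, branch, pi, core, canon, hpi, hi0, Nat.pos_of_ne_zero hi0, ← hX, hy]
      · simp only [Code.len, List.length_cons, List.length_nil]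
        omega
    · rintro k m' ⟨i, yv, b, tv, uv, pv, cv, vv, rfl, -, h1⟩ hb
      obtain ⟨rfl, rfl⟩ := h1 hb
      refine Code.tri_seq (okBlk_tidyOps _ _) (runBlk_tidyOps _ _) (Code.tri_end (T := 5 * e.u) ?_ ?_ ?_) ?_
      · simp
      · simp
      · simp [Mem.completed, hsrc]
      · simp only [Code.len, tidyOps, List.length_cons, List.length_nil]
        omega
    · refine ⟨1, none, true, false, m.ua, none, ∅, none, ?_, fun _ => ⟨le_rfl, hcard, by omega, fun h => ?_⟩, by simp⟩
      · rw [pref_one hsrc]; rfl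
      · have : piIndex e.O.fam ch m.S = 1 := K.piIndex_eq hs hS hsrc le_rfl h fun i hi hi' => by omega
        simp [ha, hc, branch, core, this]
  · have h1 : #m.S * (2 * Tc + 30 * e.u + e.u) ≤ rank e.O.fam * (33 * Tc) :=
      Nat.mul_le_mul hq (by omega)
    have h2 : 1 * Tc ≤ rank e.O.fam * Tc := Nat.mul_le_mul_right _ (Nat.succ_le_of_lt hcard |>.trans hq)
    have h3 : rank e.O.fam * e.u ≤ rank e.O.fam * Tc := Nat.mul_le_mul_left _ hTc
    have h4 : (20 * rank e.O.fam + 50) * e.u = 20 * (rank e.O.fam * e.u) + 50 * e.u := by ring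
    simp only [Code.len, tidyOps, List.length_cons, List.length_nil]
    rw [Nat.mul_left_comm] at h1
    omega

end Completion

-- The parent of a solution and the search for the next root

section Analysis

variable {n : ℕ} {e : Env n} {F : Finset (Finset (Fin n))} {ch : Chooser n} {key : Finset (Fin n) → Fin n → ℕ ×ₗ Fin n}
  {choose : Cmd 12} {Tc : ℕ}

/-- `parent(S)`, where it is empty for a root. -/
def parentSet (F : Finset (Finset (Fin n))) (ch : Chooser n) (S : Finset (Fin n)) :
    Finset (Fin n) := (parent F ch S).getD ∅

theorem branch_eq_none_iff (K : KeyChooser F ch key) (hs : StronglyAccessible F)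
    {S : Finset (Fin n)} {s : Fin n} (hS : IsMaxSol F S) (h : source F S = some s) :
    branch F ch S = none ↔ parent F ch S = none := by
  rw [parent_eq_none_iff, branch]
  split_ifs with hp
  · obtain ⟨j, w, v, -, -, -, -, hpi, -⟩ := K.nonroot_spec hs hS h hp
    simp [hpi, hp]
  · simp [hp]

theorem branch_of_parent {S P : Finset (Fin n)} (h : parent F ch S = some P) :
    branch F ch S = pi F ch S := by
  rw [branch, if_pos]
  by_contra hp
  rw [parent_eq_none_iff.2 hp] at h; cases h

/-- The registers hold defaults for the missing data of a root; as the branching element is null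
exactly for roots, comparing it with an actual element excludes them. -/
theorem parent_eq_some_iff (K : KeyChooser F ch key) (hs : StronglyAccessible F)
    {S P : Finset (Fin n)} {s : Fin n} (hS : IsMaxSol F S) (h : source F S = some s)
    {w : Fin n} : branch F ch S = some w ∧ parentSet F ch S = P ↔
      parent F ch S = some P ∧ pi F ch S = some w := by
  cases hP : parent F ch S with
  | none => simp [(branch_eq_none_iff K hs hS h).2 hP]
  | some P' => simp [parentSet, hP, branch_of_parent hP, and_comm]

/-- The memory with the data of `S`. -/
def Mem.analyzed (m : Mem n) (F : Finset (Finset (Fin n))) (ch : Chooser n) (S : Finset (Fin n)) :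
    Mem n :=
  { m.completed ∅ with
    src := source F S, pi := branch F ch S, core := MaxEnum.core F ch S, Q := parentSet F ch S, S := S
    A := ∅, v := none, ws := none, ua := false }

/-- The source, the branching element, the core and the parent of `S`. -/
def analyzeProg (choose : Cmd 12) : Cmd 12 :=
  branchProg choose ;; (Code.ops [.clrE .ws, .clrS .Q, .nullE .t .pi]).cmd ;;
  .cond FReg.t.idx (Code.ops [.setF .t false]).cmd
    ((Code.ops [.cpS .X .core]).cmd ;; completeProg choose ;; (Code.ops [.cpS .Q .X, .clrS .X]).cmd)

theorem tri_analyze (h0 : ∅ ∈ e.O.fam) (hs : StronglyAccessible e.O.fam)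
    (K : KeyChooser e.O.fam ch key) (hch : ChooseSpec e choose ch Tc)
    (hTc : e.u ≤ Tc) {m : Mem n} (hS : IsMaxSol e.O.fam m.S) (hne : m.S.Nonempty) :
    Tri e (analyzeProg choose) m (300 * (rank e.O.fam * Tc))
      (· = m.analyzed e.O.fam ch m.S) := by
  have hq := card_le_rank hS.1
  obtain ⟨s, hsrc⟩ := exists_source h0 hs hS.1 hne
  have h2 : 1 * Tc ≤ rank e.O.fam * Tc := Nat.mul_le_mul_right _ (Nat.succ_le_of_lt hne.card_pos |>.trans hq)
  have hb := branch_eq_none_iff K hs hS hsrc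
  refine Tri.call_le (tri_branch h0 hs K hch hTc hS hne) (Code.tri_seq (m1 := { m.completed ∅ with
        src := source e.O.fam m.S, pi := branch e.O.fam ch m.S, core := core e.O.fam ch m.S, A := ∅, v := none
        ua := false, ws := none, Q := ∅, t := (branch e.O.fam ch m.S).isNone })
    (T' := e.u + (50 * (rank e.O.fam * Tc) + 5 * e.u)) ?_ ?_ (Tri.cond (fun ht => ?_) fun ht => ?_) le_rfl) ?_
  · simp
  · simp
  · replace ht : (branch e.O.fam ch m.S).isNone = true := ht
    rw [Option.isNone_iff_eq_none] at ht
    refine Code.tri_end ?_ ?_ ?_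
    · simp
    · simp only [Code.len, List.length_cons, List.length_nil]; omega
    · simp [Mem.analyzed, Mem.completed, parentSet, hb.1 ht, ht]
  · replace ht : (branch e.O.fam ch m.S).isNone = false := ht
    have hp : 1 < piIndex e.O.fam ch m.S := by
      by_contra hp
      rw [branch, if_neg hp] at ht; cases ht
    obtain ⟨j, w, v, hj, -, hcore, hpar, -⟩ := K.nonroot_spec hs hS hsrc hp
    refine Code.tri_seq (T' := 50 * (rank e.O.fam * Tc) + 3 * e.u) ?_ rfl (Tri.call_le
      (tri_complete_univ K hch hTc ?_ ?_ rfl rfl) (Code.tri_end ?_ le_rfl ?_) ?_) ?_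
    · simp
    · change core e.O.fam ch m.S ∈ _
      rw [hcore]; exact K.pref_mem hsrc hj
    · change (core e.O.fam ch m.S).Nonempty
      rw [hcore]; exact K.pref_nonempty hsrc hj
    · simp
    · simp [Mem.analyzed, Mem.completed, parentSet, hpar, hcore]
    · simp
    · simp only [Code.len, List.length_cons, List.length_nil]; omega
  · simp only [Code.len, List.length_cons, List.length_nil]; omega

/-- The test whether `S` is a root with source `z0`. -/
def rootTail : Code :=
  .seq (.ops [.eqE .t .src .z0]) <| .ite .t
    (.seq (.ops [.nullE .t .pi]) (.ite .t (.ops [.setF .lp4 false, .setF .fd true]) (.ops [])))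
    (.ops [])

theorem exec_rootTail (F : Finset (Finset (Fin n))) (m : Mem n) :
    rootTail.exec F m = { m with
      t := decide (m.src = m.z0) && m.pi.isNone
      lp4 := m.lp4 && !(decide (m.src = m.z0) && m.pi.isNone)
      fd := m.fd || (decide (m.src = m.z0) && m.pi.isNone) } := by
  by_cases h1 : m.src = m.z0 <;> cases h2 : m.pi <;> simp [rootTail, h1, h2]

/-- One pass of `rootProg`. -/
def rootBody (choose : Cmd 12) : Cmd 12 :=
  (Code.ops [.succE .z0, .nullE .t .z0]).cmd ;;
  .cond FReg.t.idx (Code.ops [.setF .lp4 false, .setF .t false]).cmd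
    ((Code.ops [.clrS .X, .insE .X .z0, .qry .t .X]).cmd ;;
    .cond FReg.t.idx
      (completeProg choose ;; (Code.ops [.cpS .S .X]).cmd ;; analyzeProg choose ;;
        rootTail.cmd)
      (Code.ops []).cmd)

/-- The registers that hold the current node. -/
def Mem.frame (m : Mem n) : Bool × Bool × Bool × Finset (Fin n) := (m.go, m.lv, m.od, m.cur)

/-- The memory after a search with result `res`. -/
def Mem.searched (m : Mem n) (res : Option (Finset (Fin n))) : Mem n :=
  { Mem.blank n with go := m.go, lv := m.lv, od := m.od, cur := m.cur, fd := res.isSome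
                     S := res.getD ∅ }

/-- The result of a search. -/
def Mem.result (m : Mem n) : Option (Finset (Fin n)) := if m.fd then some m.S else none

theorem Mem.searched_congr {m m' : Mem n} (h : m.frame = m'.frame) (res : Option (Finset (Fin n))) :
    m.searched res = m'.searched res := by
  simp only [Mem.frame, Prod.mk.injEq] at h
  simp only [Mem.searched, h]

/-- Clearing the memory after a search. -/
def wipe : Code :=
  .seq (.ops [.setF .ua false, .setF .lp false, .setF .lp2 false, .setF .lp3 false, .setF .lp4 false,
    .setF .t false, .setF .ok false, .clrE .y, .clrE .z, .clrE .sx, .clrE .v, .clrE .src, .clrE .pi,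
    .clrE .w, .clrE .s, .clrE .ws, .clrE .z0, .clrS .X, .clrS .A, .clrS .B, .clrS .D, .clrS .E,
    .clrS .core, .clrS .Q, .clrS .C, .clrS .R, .clrS .rs, .stopL])
  (.ite .fd (.ops []) (.ops [.clrS .S]))

theorem exec_wipe (F : Finset (Finset (Fin n))) (m : Mem n) :
    wipe.exec F m = m.searched m.result := by
  cases h : m.fd <;> simp [wipe, Mem.searched, Mem.result, Mem.setLister, Mem.blank, h]

theorem tri_wipe (m : Mem n) : Tri e wipe.cmd m (40 * e.u) (· = m.searched m.result) := by
  refine Code.tri_end ?_ (Nat.mul_le_mul_right _ (by simp [wipe])) (exec_wipe _ _)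
  simp [wipe]

/-- The next root, after the source `z0`. -/
def rootProg (choose : Cmd 12) : Cmd 12 :=
  (Code.ops [.setF .lp4 true, .setF .fd false, .clrE .ws, .setF .ua false]).cmd ;;
  .loop FReg.lp4.idx (rootBody choose) ;; wipe.cmd

/-- The invariant leaves most registers unspecified and fixes only the node, the result and what the
next pass reads; the final `wipe` makes the resulting memory unique again. -/
theorem tri_rootProg (h0 : ∅ ∈ e.O.fam) (hs : StronglyAccessible e.O.fam)
    (K : KeyChooser e.O.fam ch key) (hch : ChooseSpec e choose ch Tc)
    (hTc : e.u ≤ Tc) (hr : 1 ≤ rank e.O.fam) {m : Mem n} {rest : List (Fin n)}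
    (hrest : Cursor (List.finRange n) m.z0 rest) :
    Tri e (rootProg choose) m (1000 * (n * (rank e.O.fam * Tc)))
      (· = m.searched (rest.findSome? (rootAt e.O.fam ch))) := by
  set res := rest.findSome? (rootAt e.O.fam ch) with hres
  have h2 : 1 * Tc ≤ rank e.O.fam * Tc := Nat.mul_le_mul_right _ hr
  unfold rootProg
  refine Code.tri_seq (T' := (rest.length + 1) * (400 * (rank e.O.fam * Tc) + e.u) + e.u + 40 * e.u) ?_ rfl ?_ ?_
  · simp
  · refine Tri.seq (Tri.loop_count (b := .lp4) (fun k m' => m'.frame = m.frame ∧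
      (m'.lp4 = true → m'.fd = false ∧ m'.ws = none ∧ m'.ua = false ∧ ∃ rest, rest.length + 1 = k ∧
        Cursor (List.finRange n) m'.z0 rest ∧ rest.findSome? (rootAt e.O.fam ch) = res) ∧
      (m'.lp4 = false → m'.result = res)) (400 * (rank e.O.fam * Tc)) ?_ ?_ ?_)
    · rintro k m' ⟨hf, h1, -⟩ hb
      replace hb : m'.lp4 = true := hb
      obtain ⟨hfd, hws, hua, rest, hk, hcur, hr⟩ := h1 hb
      have hn := hcur.next (List.pairwise_lt_finRange n)
      refine ⟨rest.length, hk.symm, Code.tri_seq (m1 := { m' with z0 := rest.head?, t := rest.head?.isNone })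
        (T' := e.u + (5 * e.u + (e.u + (380 * (rank e.O.fam * Tc))))) ?_ ?_ (Tri.cond (fun ht => ?_) (fun ht => ?_)) ?_⟩
      · simp
      · simp [hn]
      · cases rest with
        | cons x rest => exact absurd ht (by simp)
        | nil =>
          refine Code.tri_end ?_ ?_ ⟨?_, ?_, ?_⟩
          · simp
          · simp only [Code.len, List.length_cons, List.length_nil]; omega
          · simpa [Mem.frame] using hf
          · simp
          · simpa [Mem.result, hfd] using hr
      · cases rest with
        | nil => exact absurd ht (by simp)
        | cons x rest =>
          refine Code.tri_seq (T' := e.u + 370 * (rank e.O.fam * Tc)) (m1 := { m' with z0 := some x, X := {x}, t := decide ({x} ∈ e.O.fam) }) ?_ ?_ (Tri.cond (fun ht => ?_) (fun ht => ?_)) ?_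
          · simpa using card_insertOpt (by simp)
          · simp [insertOpt]
          · have hx : {x} ∈ e.O.fam := of_decide_eq_true ht
            set S := complete ch {x} univ with hS
            have hSm : IsMaxSol e.O.fam S := K.isMaxSol_complete hs hx (singleton_nonempty x)
            have hSne : S.Nonempty := (singleton_nonempty x).mono (subset_complete _ _)
            obtain ⟨s, hsrc⟩ := exists_source h0 hs hSm.1 hSne
            have hbr := branch_eq_none_iff K hs hSm hsrc
            refine Tri.call_le (tri_complete_univ K hch hTc (by exact hx) (singleton_nonempty x) hws hua)
              (Code.tri_seq (m1 := { ({ m' with z0 := some x, X := {x}, t := decide ({x} ∈ e.O.fam) } : Mem n).completed S with S := S }) (T' := 300 * (rank e.O.fam * Tc) + 9 * e.u) ?_ ?_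
                (Tri.call (tri_analyze h0 hs K hch hTc (by exact hSm) (by exact hSne)) (Code.tri_end ?_ ?_ ⟨?_, ?_, ?_⟩)) le_rfl) ?_
            · simp
            · simp [Mem.completed, hS]
            · simp [rootTail]
            · exact Nat.mul_le_mul_right _ (by simp [rootTail])
            · rw [exec_rootTail]; exact hf
            · rw [exec_rootTail]
              intro hl
              replace hl : (m'.lp4 && !(decide (source e.O.fam S = some x) && (branch e.O.fam ch S).isNone)) = true := hl
              rw [hb, Bool.true_and, Bool.not_eq_true'] at hl
              refine ⟨?_, rfl, rfl, rest, rfl, hcur.step, ?_⟩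
              · change (m'.fd || (decide (source e.O.fam S = some x) && (branch e.O.fam ch S).isNone)) = false
                rw [hl, hfd]; rfl
              · rw [← hr, List.findSome?_cons, rootAt, if_neg]
                rintro ⟨-, h1, h2⟩
                change source e.O.fam S = some x at h1
                simp [h1, hbr.2 h2] at hl
            · rw [exec_rootTail]
              intro hl
              replace hl : (m'.lp4 && !(decide (source e.O.fam S = some x) && (branch e.O.fam ch S).isNone)) = false := hl
              rw [hb, Bool.true_and, Bool.not_eq_false', Bool.and_eq_true, decide_eq_true_eq, Option.isNone_iff_eq_none] at hl
              rw [← hr, List.findSome?_cons, rootAt, if_pos ⟨hx, hl.1, hbr.1 hl.2⟩]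
              change _ = some S
              simp [Mem.analyzed, Mem.completed, Mem.result, hl.1, hl.2]
            · simp only [Code.len, List.length_cons, List.length_nil]; omega
          · have hx : {x} ∉ e.O.fam := of_decide_eq_false ht
            have hroot : rootAt e.O.fam ch x = none := by rw [rootAt, if_neg fun h => hx h.1]
            refine Code.tri_end ?_ ?_ ⟨?_, fun _ => ⟨hfd, hws, hua, rest, rfl, ?_, ?_⟩, ?_⟩
            · simp
            · simp only [Code.len, List.length_nil]; omega
            · exact hf
            · exact hcur.step
            · rw [← hr, List.findSome?_cons, hroot]
            · intro h
              exact absurd (hb.symm.trans h) (by simp)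
          · simp only [Code.len, List.length_cons, List.length_nil]; omega
      · simp only [Code.len, List.length_cons, List.length_nil]; omega
    · rintro k m' ⟨hf, -, h1⟩ hb
      refine (tri_wipe m').mono le_rfl ?_
      rintro m'' rfl
      rw [h1 hb, Mem.searched_congr hf]
    · exact ⟨rfl, fun _ => ⟨rfl, rfl, rfl, rest, rfl, hrest, rfl⟩, by simp⟩
  · have h3 : rest.length ≤ n := by
      obtain ⟨pre, h, -⟩ := hrest
      have := congrArg List.length h
      simp only [List.length_finRange, List.length_append] at this
      omega
    have h4 : (rest.length + 1) * (400 * (rank e.O.fam * Tc) + e.u) ≤ (n + 1) * (401 * (rank e.O.fam * Tc)) :=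
      Nat.mul_le_mul (by omega) (by omega)
    have h5 : 1 * (rank e.O.fam * Tc) ≤ n * (rank e.O.fam * Tc) := Nat.mul_le_mul_right _ (hr.trans (rank_le _))
    simp only [Code.len, List.length_cons, List.length_nil]
    have h6 : (n + 1) * (401 * (rank e.O.fam * Tc)) =
        401 * (n * (rank e.O.fam * Tc)) + 401 * (rank e.O.fam * Tc) := by ring
    omega

end Analysis

-- Binary counters and the passes of the basic framework

section Counter

variable {n : ℕ}

/-- Incrementing a binary counter whose digits are the members of the list. -/
def incr : List (Fin n) → Finset (Fin n) → Finset (Fin n)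
  | [], X => X
  | a :: l, X => if a ∈ X then incr l (X.erase a) else insert a X

theorem incr_subset {l : List (Fin n)} {X Y : Finset (Fin n)} (hl : l.toFinset ⊆ Y) (hX : X ⊆ Y) :
    incr l X ⊆ Y := by
  induction l generalizing X with
  | nil => exact hX
  | cons a l ih =>
    rw [List.toFinset_cons] at hl
    rw [incr]
    split_ifs
    · exact ih ((subset_insert _ _).trans hl) ((erase_subset _ _).trans hX)
    · exact insert_subset (hl (mem_insert_self _ _)) hX

theorem notMem_incr {a : Fin n} {l : List (Fin n)} {X : Finset (Fin n)} (hl : a ∉ l) (hX : a ∉ X) :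
    a ∉ incr l X := fun h => by
  have : incr l X ⊆ univ.erase a :=
    incr_subset (subset_erase.2 ⟨subset_univ _, by simpa using hl⟩)
      (subset_erase.2 ⟨subset_univ _, hX⟩)
  simpa using this h

/-- Two increments set and clear the lowest digit a and carry once into the remaining digits. -/
theorem iterate_incr_cons {a : Fin n} {l : List (Fin n)} (hl : a ∉ l) (k : ℕ) {X : Finset (Fin n)}
    (hX : a ∉ X) : List.iterate (incr (a :: l)) X (2 * k) =
      (List.iterate (incr l) X k).flatMap fun Y => [Y, insert a Y] := by
  induction k generalizing X with
  | zero => rfl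
  | succ k ih =>
    have h1 : incr (a :: l) X = insert a X := by rw [incr, if_neg hX]
    have h2 : incr (a :: l) (insert a X) = incr l X := by
      rw [incr, if_pos (mem_insert_self _ _), erase_insert hX]
    rw [Nat.mul_succ]
    simp only [List.iterate, h1, h2, List.flatMap_cons, ih (notMem_incr hl hX)]
    rfl

/-- This identifies the order of `List.sublists` with that of a counter whose lowest digit is the
head, so the successor of a subset can be computed from the subset alone. -/
theorem map_toFinset_sublists {l : List (Fin n)} (hl : l.Nodup) :
    l.sublists.map List.toFinset = List.iterate (incr l) ∅ (2 ^ l.length) := by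
  induction l with
  | nil => rfl
  | cons a l ih =>
    rw [List.nodup_cons] at hl
    rw [List.length_cons, pow_succ, mul_comm, iterate_incr_cons hl.1 _ (by simp), ← ih hl.2,
      List.sublists_cons]
    simp [List.map_flatMap, List.flatMap_map]

theorem getLast?_sublists (l : List (Fin n)) : l.sublists.getLast? = some l := by
  induction l using List.reverseRecOn with
  | nil => rfl
  | append_singleton l a ih => simp [List.sublists_concat, ih]

theorem iterate_eq_append {α : Type} {f : α → α} {x : α} {k : ℕ} {pre rest : List α} {y : α}
    (h : List.iterate f x k = pre ++ y :: rest) : rest = [] ∨ ∃ rest', rest = f y :: rest' := by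
  induction pre generalizing x k with
  | nil =>
    match k with
    | 0 => simp at h
    | 1 => simp at h; simp [h]
    | k + 2 =>
      simp only [List.iterate, List.nil_append, List.cons.injEq] at h
      obtain ⟨rfl, rfl⟩ := h
      exact Or.inr ⟨_, rfl⟩
  | cons a pre ih =>
    match k with
    | 0 => simp at h
    | k + 1 =>
      simp only [List.iterate, List.cons_append, List.cons.injEq] at h
      exact ih h.2

/-- The part of the list of subsets of `D` after `C` is `rest`. -/
def SubCursor (D C : Finset (Fin n)) (rest : List (Finset (Fin n))) : Prop :=
  ∃ pre, (sorted D).sublists.map List.toFinset = pre ++ C :: rest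

theorem SubCursor.subset {D C : Finset (Fin n)} {rest : List (Finset (Fin n))}
    (h : SubCursor D C rest) : C ⊆ D := by
  obtain ⟨pre, h⟩ := h
  have : C ∈ (sorted D).sublists.map List.toFinset := by rw [h]; simp
  obtain ⟨l, hl, rfl⟩ := List.mem_map.1 this
  intro x hx
  rw [← mem_sorted]
  exact (List.mem_sublists.1 hl).subset (List.mem_toFinset.1 hx)

/-- The full set is the last value of the counter and occurs once, so comparing C with D detects the
end. -/
theorem SubCursor.eq_nil_iff {D C : Finset (Fin n)} {rest : List (Finset (Fin n))}
    (h : SubCursor D C rest) : rest = [] ↔ C = D := by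
  obtain ⟨pre, h⟩ := h
  have hl : ((sorted D).sublists.map List.toFinset).getLast? = some D := by
    rw [List.getLast?_map, getLast?_sublists, Option.map_some, toFinset_sorted]
  have hnd := nodup_map_toFinset_sublists (pairwise_lt_sorted D)
  rw [h] at hl hnd
  constructor
  · rintro rfl
    simpa using hl
  · rintro rfl
    by_contra hne
    obtain ⟨rest, a, rfl⟩ := (List.eq_nil_or_concat rest).resolve_left hne
    simp only [List.concat_eq_append, ← List.cons_append, ← List.append_assoc,
      List.getLast?_append, List.getLast?_singleton, Option.some_or, Option.some.injEq] at hl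
    subst hl
    simp [List.nodup_append] at hnd

theorem SubCursor.step {D C : Finset (Fin n)} {rest : List (Finset (Fin n))}
    (h : SubCursor D C rest) (hne : C ≠ D) :
    ∃ rest', rest = incr (sorted D) C :: rest' ∧ SubCursor D (incr (sorted D) C) rest' := by
  have h1 := mt h.eq_nil_iff.1 hne
  obtain ⟨pre, h⟩ := h
  rw [map_toFinset_sublists (nodup_sorted D)] at h
  obtain h2 | ⟨rest', rfl⟩ := iterate_eq_append h
  · exact absurd h2 h1
  · refine ⟨rest', rfl, pre ++ [C], ?_⟩
    rw [map_toFinset_sublists (nodup_sorted D), h]; simp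

theorem exists_subCursor_empty (D : Finset (Fin n)) :
    ∃ rest, (sorted D).sublists.map List.toFinset = ∅ :: rest ∧ SubCursor D ∅ rest := by
  have h := map_toFinset_sublists (nodup_sorted D)
  obtain ⟨k, hk⟩ : ∃ k, 2 ^ (sorted D).length = k + 1 := ⟨2 ^ (sorted D).length - 1, by
    have := Nat.two_pow_pos (sorted D).length; omega⟩
  rw [hk, List.iterate] at h
  exact ⟨_, h, [], h⟩

theorem subCursor_self (D : Finset (Fin n)) : SubCursor D D [] := by
  have hl : ((sorted D).sublists.map List.toFinset).getLast? = some D := by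
    rw [List.getLast?_map, getLast?_sublists, Option.map_some, toFinset_sorted]
  rw [List.getLast?_eq_some_iff] at hl
  obtain ⟨pre, h⟩ := hl
  exact ⟨pre, h⟩

/-- All passes of the loop of the basic framework for one `w`, before filtering. -/
def rawPasses (P : Finset (Fin n)) (w : Fin n) : List (Fin n × Finset (Fin n)) :=
  ((sorted (P.erase w)).sublists.map List.toFinset).map fun X => (w, X)

/-- The passes that are left after those for `w`, up to the set `C`. -/
def PassCursor (P : Finset (Fin n)) (w : Option (Fin n)) (C : Finset (Fin n))
    (l : List (Fin n × Finset (Fin n))) : Prop :=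
  (w = none → C = P) ∧ ∃ restC restW, SubCursor (eraseOpt w P) C restC ∧
    Cursor (List.finRange n) w restW ∧
    l = (w.toList.flatMap fun w => restC.map fun X => (w, X)) ++ restW.flatMap (rawPasses P)

/-- The beginning is encoded as an exhausted counter: with null w the digits are P, and C = P is the
last value, so the first step moves on to the first w. -/
theorem PassCursor.start (P : Finset (Fin n)) :
    PassCursor P none P ((List.finRange n).flatMap (rawPasses P)) :=
  ⟨fun _ => rfl, [], _, subCursor_self P, Cursor.start _, by simp⟩

theorem PassCursor.step {P : Finset (Fin n)} {w : Option (Fin n)} {C : Finset (Fin n)}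
    {l : List (Fin n × Finset (Fin n))} (h : PassCursor P w C l) (hne : C ≠ eraseOpt w P) :
    ∃ w' l', w = some w' ∧ l = (w', incr (sorted (eraseOpt w P)) C) :: l' ∧
      PassCursor P w (incr (sorted (eraseOpt w P)) C) l' := by
  obtain ⟨h0, restC, restW, h1, h2, rfl⟩ := h
  obtain ⟨rest', rfl, h3⟩ := h1.step hne
  cases w with
  | none => exact absurd (h0 rfl) hne
  | some w' => exact ⟨w', _, rfl, by simp; rfl, by simp, rest', restW, h3, h2, by simp⟩

theorem PassCursor.next {P : Finset (Fin n)} {w : Option (Fin n)} 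
    {l : List (Fin n × Finset (Fin n))} (h : PassCursor P w (eraseOpt w P) l) :
    match nextIn (List.finRange n) w with
    | none => l = []
    | some w' => ∃ l', l = (w', ∅) :: l' ∧ PassCursor P (some w') ∅ l' := by
  obtain ⟨-, restC, restW, h1, h2, rfl⟩ := h
  obtain rfl := h1.eq_nil_iff.2 rfl
  rw [h2.next (List.pairwise_lt_finRange n)]
  cases restW with
  | nil => simp
  | cons w' restW =>
    obtain ⟨rest, h3, h4⟩ := exists_subCursor_empty (P.erase w')
    simp only [List.head?_cons]
    refine ⟨rest.map (fun X => (w', X)) ++ restW.flatMap (rawPasses P), ?_, by simp, rest, restW, h4, h2.step, ?_⟩ <;>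
      simp [rawPasses, h3]

/-- Used for resumption: the pair (w, C), recomputed from a child, by itself is a valid position in
the loop. -/
theorem passCursor_of_mem {P : Finset (Fin n)} {w : Fin n} {C : Finset (Fin n)} (hC : C ⊆ P.erase w) :
    ∃ pre l, (List.finRange n).flatMap (rawPasses P) = pre ++ (w, C) :: l ∧
      PassCursor P (some w) C l := by
  obtain ⟨preW, restW, hW⟩ := List.append_of_mem (List.mem_finRange w)
  have hmem : C ∈ (sorted (P.erase w)).sublists.map List.toFinset := by
    rw [List.mem_map]
    refine ⟨sorted C, List.mem_sublists.2 ?_, toFinset_sorted C⟩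
    have : sorted C = (sorted (P.erase w)).filter (fun x => x ∈ C) := by
      simp only [sorted, List.filter_filter]
      refine List.filter_congr fun x _ => ?_
      have : x ∈ C → x ∈ P.erase w := fun hx => hC hx
      simp only [← Bool.decide_and, decide_eq_decide]
      tauto
    rw [this]; exact List.filter_sublist
  obtain ⟨preC, restC, hrC⟩ := List.append_of_mem hmem
  refine ⟨preW.flatMap (rawPasses P) ++ preC.map (fun X => (w, X)), _, ?_, by simp, restC, restW,
    ⟨preC, hrC⟩, ⟨preW ++ [w], by simp [hW], by simp⟩, rfl⟩
  rw [hW]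
  simp [rawPasses, hrC]

theorem PassCursor.subset {P : Finset (Fin n)} {w : Option (Fin n)} {C : Finset (Fin n)}
    {l : List (Fin n × Finset (Fin n))} (h : PassCursor P w C l) : C ⊆ eraseOpt w P := by
  obtain ⟨-, restC, restW, h1, -⟩ := h
  exact h1.subset

/-- The machine runs through all subsets for all w and applies the filter inside the pass; the order
of the surviving passes is the same. -/
theorem iters_basic (F : Finset (Finset (Fin n))) (P : Finset (Fin n)) :
    (basic F).iters P = ((List.finRange n).flatMap (rawPasses P)).filter
      fun i => i.2 ⊂ P.erase i.1 ∧ insert i.1 i.2 ∈ F := by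
  simp only [basic, List.filter_flatMap, rawPasses]
  congr 1
  funext w
  simp only [List.filter_map, List.map_map]
  rfl

theorem length_rawPasses_le (P : Finset (Fin n)) :
    ((List.finRange n).flatMap (rawPasses P)).length ≤ n * 2 ^ #P := by
  rw [List.length_flatMap]
  have : ∀ w, (rawPasses P w).length ≤ 2 ^ #P := by
    intro w
    simp only [rawPasses, List.length_map, List.length_sublists, length_sorted]
    exact Nat.pow_le_pow_right (by norm_num) (card_le_card (erase_subset _ _))
  have h := List.sum_le_card_nsmul ((List.finRange n).map fun w => (rawPasses P w).length) (2 ^ #P) (by simpa using fun w => this w)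
  simpa using h

end Counter

-- The child search of the basic framework

section BasicSearch

variable {n : ℕ} {e : Env n} {F : Finset (Finset (Fin n))} {ch : Chooser n}
  {key : Finset (Fin n) → Fin n → ℕ ×ₗ Fin n} {choose : Cmd 12} {Tc : ℕ}

/-- One pass of `incrProg`. -/
def incrBody : Code :=
  .seq (.ops [.nextE .z .D, .memE .t .z .C])
    (.ite .t (.ops [.delE .C .z]) (.ops [.insE .C .z, .setF .lp2 false]))

/-- The binary counter `C` over `D` is incremented. -/
def incrProg : Cmd 12 :=
  (Code.ops [.clrE .z, .setF .lp2 true]).cmd ;; .loop FReg.lp2.idx incrBody.cmd ;;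
  (Code.ops [.clrE .z, .setF .t false]).cmd

/-- Strictness provides a digit 0, at which the carry stops before the digits run out. -/
theorem tri_incr {m : Mem n} (hD : #m.D ≤ rank e.O.fam) (hC : m.C ⊂ m.D) :
    Tri e incrProg m ((10 * rank e.O.fam + 20) * e.u)
      (· = { m with C := incr (sorted m.D) m.C, z := none, t := false, lp2 := false }) := by
  unfold incrProg
  set r := incr (sorted m.D) m.C with hr
  refine Code.tri_seq (T' := #m.D * (9 * e.u + e.u) + e.u + 4 * e.u) ?_ rfl ?_ ?_
  · simp
  · refine Tri.seq (Tri.loop_count (b := .lp2) (k := #m.D) (fun k m' => ∃ rest zv b tv Cv,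
      m' = { m with z := zv, lp2 := b, t := tv, C := Cv } ∧
      (b = true → rest.length = k ∧ Cursor (sorted m.D) zv rest ∧ Cv ⊆ m.D ∧
        (∃ x ∈ rest, x ∉ Cv) ∧ incr rest Cv = r) ∧
      (b = false → Cv = r)) (9 * e.u) ?_ ?_ ?_)
    · rintro k m' ⟨rest, zv, b, tv, Cv, rfl, h1, -⟩ hb
      obtain ⟨hk, hcur, hCD, ⟨x, hx, hxC⟩, hf⟩ := h1 hb
      replace hb : b = true := hb
      subst hb
      have hn := hcur.next (pairwise_lt_sorted m.D)
      cases rest with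
      | nil => simp at hx
      | cons a rest =>
        refine ⟨rest.length, hk.symm, Code.tri_end ?_ ?_ ?_⟩
        · have := card_insertOpt (x := nextIn (sorted m.D) zv) ((card_le_card hCD).trans hD)
          simpa [incrBody] using fun _ => this
        · exact Nat.mul_le_mul_right _ (by simp [incrBody])
        · by_cases ha : a ∈ Cv
          · refine ⟨rest, some a, true, true, Cv.erase a, by simp [incrBody, hn, memOpt, eraseOpt, ha],
              fun _ => ⟨rfl, hcur.step, (erase_subset _ _).trans hCD, ⟨x, ?_, ?_⟩, ?_⟩, by simp⟩
            · rcases List.mem_cons.1 hx with rfl | h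
              exacts [absurd ha hxC, h]
            · exact fun h => hxC (mem_of_mem_erase h)
            · rw [← hf, incr, if_pos ha]
          · refine ⟨rest, some a, false, false, insert a Cv, by simp [incrBody, hn, memOpt, insertOpt, ha],
              by simp, fun _ => ?_⟩
            rw [← hf, incr, if_neg ha]
    · rintro k m' ⟨rest, zv, b, tv, Cv, rfl, -, h1⟩ hb
      obtain rfl := h1 hb
      replace hb : b = false := hb
      refine Code.tri_end ?_ ?_ ?_
      · simp
      · exact Nat.mul_le_mul_right _ (by simp)
      · simp [hb]
    · refine ⟨sorted m.D, none, true, m.t, m.C, by simp,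
        fun _ => ⟨length_sorted _, Cursor.start _, hC.1, ?_, rfl⟩, by simp⟩
      obtain ⟨x, hx, hxC⟩ := exists_of_ssubset hC
      exact ⟨x, mem_sorted.2 hx, hxC⟩
  · simp only [Code.len, List.length_cons, List.length_nil]
    have := Nat.mul_le_mul_right e.u hD
    ring_nf at this ⊢
    nlinarith [Nat.zero_le (rank e.O.fam * e.u), Nat.zero_le e.u]

/-- The next values of the loop variables `w` and `C`. -/
def stepProg : Cmd 12 :=
  (Code.ops [.cpS .D .cur, .delE .D .w, .eqS .t .C .D]).cmd ;;
  .cond FReg.t.idx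
    (Code.seq (.ops [.succE .w, .clrS .C, .nullE .t .w]) (.ite .t (.ops [.setF .lp4 false]) (.ops []))).cmd
    incrProg

theorem tri_step {m : Mem n} (hP : #m.cur ≤ rank e.O.fam) {l : List (Fin n × Finset (Fin n))}
    (hl : PassCursor m.cur m.w m.C l) (hlp : m.lp4 = true) :
    Tri e stepProg m ((10 * rank e.O.fam + 40) * e.u) (fun m' => m'.frame = m.frame ∧ m'.fd = m.fd ∧
      match l with
      | [] => m'.lp4 = false
      | (w, C) :: l' => m'.lp4 = true ∧ m'.w = some w ∧ m'.C = C ∧ PassCursor m.cur (some w) C l') := by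
  refine Code.tri_seq (m1 := { m with D := eraseOpt m.w m.cur, t := decide (m.C = eraseOpt m.w m.cur) })
    (T' := e.u + (10 * rank e.O.fam + 20) * e.u) ?_ ?_ (Tri.cond (fun ht => ?_) (fun ht => ?_)) ?_
  · simp
  · simp; rfl
  · replace ht := of_decide_eq_true ht
    rw [ht] at hl
    have hn := hl.next
    refine Code.tri_end ?_ (Nat.mul_le_mul_right _ ?_) ?_
    · simp
    · simp only [Code.len, List.length_cons, List.length_nil]; omega
    · cases hw : nextIn (List.finRange n) m.w with
      | none =>
        rw [hw] at hn
        subst hn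
        simp [hw, Mem.frame]
      | some w =>
        rw [hw] at hn
        obtain ⟨l', rfl, h⟩ := hn
        simp [hw, Mem.frame, h, hlp]
  · replace ht := of_decide_eq_false ht
    obtain ⟨w, l', hw, rfl, h⟩ := hl.step ht
    refine (tri_incr (by exact (card_le_card (by rw [hw]; exact erase_subset _ _)).trans hP)
      (by exact hl.subset.ssubset_of_ne ht)).mono le_rfl ?_
    rintro m' rfl
    exact ⟨rfl, rfl, hlp, hw, rfl, hw ▸ h⟩
  · simp only [Code.len, List.length_cons, List.length_nil]
    ring_nf
    nlinarith [Nat.zero_le e.u]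

/-- The test whether `S` is a child of the current solution that belongs to the pass. -/
def basicTail : Code :=
  .seq (.ops [.eqE .t .pi .w]) <| .ite .t
    (.seq (.ops [.eqS .t .Q .cur]) <| .ite .t
      (.seq (.ops [.eqS .t .core .C]) (.ite .t (.ops [.setF .lp4 false, .setF .fd true]) (.ops [])))
      (.ops []))
    (.ops [])

/-- The outcome of `basicTail`. -/
def basicTest (m : Mem n) : Bool :=
  decide (m.pi = m.w) && (decide (m.Q = m.cur) && decide (m.core = m.C))

theorem exec_basicTail (F : Finset (Finset (Fin n))) (m : Mem n) :
    basicTail.exec F m = { m with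
      t := basicTest m, lp4 := m.lp4 && !basicTest m, fd := m.fd || basicTest m } := by
  unfold basicTest
  by_cases h1 : m.pi = m.w <;> by_cases h2 : m.Q = m.cur <;> by_cases h3 : m.core = m.C <;>
    simp [basicTail, h1, h2, h3]

/-- One pass of the loop of the basic framework. -/
def basicPass (choose : Cmd 12) : Cmd 12 :=
  (Code.ops [.cpS .D .cur, .delE .D .w, .clrE .ws, .setF .ua false, .eqS .t .C .D]).cmd ;;
  .cond FReg.t.idx (Code.ops []).cmd
    ((Code.ops [.cpS .X .C, .insE .X .w, .qry .t .X]).cmd ;;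
    .cond FReg.t.idx
      (completeProg choose ;; (Code.ops [.cpS .S .X]).cmd ;; analyzeProg choose ;; basicTail.cmd)
      (Code.ops []).cmd)

/-- The child of `P` for the pass `i`, if any, where `i` need not be one of the passes. -/
def basicChild (F : Finset (Finset (Fin n))) (P : Finset (Fin n)) (i : Fin n × Finset (Fin n)) :
    Option (Finset (Fin n)) :=
  if i.2 ⊂ P.erase i.1 ∧ insert i.1 i.2 ∈ F then (basic F).child P i else none

/-- A pass that the filter would remove yields no child, so the first child is the same in the
unfiltered loop. -/
theorem findSome?_basicChild (F : Finset (Finset (Fin n))) (P : Finset (Fin n))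
    (l : List (Fin n × Finset (Fin n))) :
    (l.filter fun i => i.2 ⊂ P.erase i.1 ∧ insert i.1 i.2 ∈ F).findSome? ((basic F).child P) =
      l.findSome? (basicChild F P) := by
  induction l with
  | nil => rfl
  | cons i l ih =>
    rw [List.filter_cons, List.findSome?_cons, ← ih, basicChild]
    split_ifs with h1 h2 h2
    · rfl
    · exact absurd (of_decide_eq_true h1) h2
    · exact absurd (decide_eq_true h2) h1
    · rfl

theorem tri_basicPass (h0 : ∅ ∈ e.O.fam) (hs : StronglyAccessible e.O.fam)
    (hch : ChooseSpec e choose (chooseMin e.O.fam) Tc)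
    (hTc : e.u ≤ Tc) (hr : 1 ≤ rank e.O.fam) {m : Mem n} {w : Fin n} (hw : m.w = some w)
    (hP : IsMaxSol e.O.fam m.cur) (hC : m.C ⊆ m.cur.erase w) (hlp : m.lp4 = true) (hfd : m.fd = false) :
    Tri e (basicPass choose) m (400 * (rank e.O.fam * Tc)) (fun m' => m'.frame = m.frame ∧
      match basicChild e.O.fam m.cur (w, m.C) with
      | none => m'.lp4 = true ∧ m'.fd = false ∧ m'.w = m.w ∧ m'.C = m.C
      | some S => m'.lp4 = false ∧ m'.fd = true ∧ m'.S = S) := by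
  have K := keyChooser_chooseMin (F := e.O.fam)
  have h2 : 1 * Tc ≤ rank e.O.fam * Tc := Nat.mul_le_mul_right _ hr
  have hq := card_le_rank hP.1
  have hss : m.C ⊂ m.cur.erase w ↔ m.C ≠ m.cur.erase w := ⟨fun h => h.ne, fun h => hC.ssubset_of_ne h⟩
  refine Code.tri_seq (m1 := { m with D := m.cur.erase w, ws := none, ua := false, t := decide (m.C = m.cur.erase w) })
    (T' := e.u + (5 * e.u + (e.u + 370 * (rank e.O.fam * Tc)))) ?_ ?_ (Tri.cond (fun ht => ?_) (fun ht => ?_)) ?_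
  · simp
  · simp [hw, eraseOpt]
  · replace ht : m.C = _ := of_decide_eq_true ht
    have : basicChild e.O.fam m.cur (w, m.C) = none := if_neg fun h => (hss.1 h.1) ht
    rw [this]
    refine Code.tri_end ?_ ?_ ⟨rfl, hlp, hfd, rfl, rfl⟩
    · simp
    · simp only [Code.len, List.length_nil]; omega
  · replace ht : m.C ≠ _ := of_decide_eq_false ht
    refine Code.tri_seq (m1 := { m with X := insert w m.C, D := m.cur.erase w, ws := none, ua := false, t := decide (insert w m.C ∈ e.O.fam) })
      (T' := (e.u + 370 * (rank e.O.fam * Tc))) ?_ ?_ (Tri.cond (fun ht' => ?_) (fun ht' => ?_)) ?_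
    · simpa using card_insertOpt ((card_le_card (hC.trans (erase_subset _ _))).trans hq)
    · simp [hw, insertOpt]; rfl
    · replace ht' : insert w m.C ∈ _ := of_decide_eq_true ht'
      set S := complete (chooseMin e.O.fam) (insert w m.C) univ with hS
      have hSm : IsMaxSol e.O.fam S := K.isMaxSol_complete hs ht' (insert_nonempty _ _)
      have hSne : S.Nonempty := (insert_nonempty _ _).mono (subset_complete _ _)
      obtain ⟨s, hsrc⟩ := exists_source h0 hs hSm.1 hSne
      refine Tri.call_le (tri_complete_univ K hch hTc (by exact ht') (insert_nonempty _ _) rfl rfl)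
        (Code.tri_seq (m1 := { ({ m with X := insert w m.C, D := m.cur.erase w, ws := none, ua := false, t := decide (insert w m.C ∈ e.O.fam) } : Mem n).completed S with S := S })
          (T' := 300 * (rank e.O.fam * Tc) + 15 * e.u) ?_ ?_
          (Tri.call (tri_analyze h0 hs K hch hTc (by exact hSm) (by exact hSne)) (Code.tri_end ?_ ?_ ?_)) le_rfl) ?_
      · simp
      · simp [Mem.completed, hS]
      · simp [basicTail]
      · exact Nat.mul_le_mul_right _ (by simp [basicTail])
      · rw [exec_basicTail]
        refine ⟨rfl, ?_⟩
        -- The condition on parent and pi is restated as comparisons of the registers, in which a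
        -- root is marked by a null branching element.
        have hchild : basicChild e.O.fam m.cur (w, m.C) =
            if branch e.O.fam (chooseMin e.O.fam) S = m.w ∧ parentSet e.O.fam (chooseMin e.O.fam) S = m.cur ∧
              core e.O.fam (chooseMin e.O.fam) S = m.C then some S else none := by
          refine (if_pos ⟨hss.2 ht, ht'⟩).trans (if_congr ?_ rfl rfl)
          rw [hw, ← and_assoc, ← and_assoc, parent_eq_some_iff K hs hSm hsrc]
        generalize hm' : Mem.analyzed _ _ _ _ = m'
        have ht : basicTest m' = decide (branch e.O.fam (chooseMin e.O.fam) S = m.w ∧ parentSet e.O.fam (chooseMin e.O.fam) S = m.cur ∧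
              core e.O.fam (chooseMin e.O.fam) S = m.C) := by
          subst hm'
          simp only [Bool.decide_and]; rfl
        rw [hchild]
        split_ifs with hc
        · refine ⟨?_, ?_, ?_⟩
          · simp [ht, hc]
          · simp [ht, hc]
          · subst hm'; rfl
        · refine ⟨?_, ?_, ?_, ?_⟩
          · subst hm'; simp [ht, hc]; exact hlp
          · subst hm'; simp [ht, hc]; exact hfd
          · subst hm'; rfl
          · subst hm'; rfl
      · simp only [Code.len, List.length_cons, List.length_nil]; omega
    · replace ht' : insert w m.C ∉ _ := of_decide_eq_false ht'
      have : basicChild e.O.fam m.cur (w, m.C) = none := if_neg fun h => ht' h.2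
      rw [this]
      refine Code.tri_end ?_ ?_ ⟨rfl, hlp, hfd, rfl, rfl⟩
      · simp
      · simp only [Code.len, List.length_nil]; omega
    · simp only [Code.len, List.length_cons, List.length_nil]; omega
  · simp only [Code.len, List.length_cons, List.length_nil]; omega

/-- The search for the next child in the basic framework. -/
def basicSearch (choose : Cmd 12) : Cmd 12 :=
  (Code.ops [.setF .lp4 true, .setF .fd false]).cmd ;;
  .loop FReg.lp4.idx (stepProg ;; .cond FReg.lp4.idx (basicPass choose) (Code.ops []).cmd) ;; wipe.cmd

theorem tri_basicSearch (h0 : ∅ ∈ e.O.fam) (hs : StronglyAccessible e.O.fam)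
    (hch : ChooseSpec e choose (chooseMin e.O.fam) Tc)
    (hTc : e.u ≤ Tc) (hr : 1 ≤ rank e.O.fam) {m : Mem n} (hP : IsMaxSol e.O.fam m.cur)
    {l : List (Fin n × Finset (Fin n))} (hl : PassCursor m.cur m.w m.C l) :
    Tri e (basicSearch choose) m ((l.length + 2) * (500 * (rank e.O.fam * Tc)))
      (· = m.searched (l.findSome? (basicChild e.O.fam m.cur))) := by
  set res := l.findSome? (basicChild e.O.fam m.cur) with hres
  have h2 : 1 * Tc ≤ rank e.O.fam * Tc := Nat.mul_le_mul_right _ hr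
  have h3 : rank e.O.fam * e.u ≤ rank e.O.fam * Tc := Nat.mul_le_mul_left _ hTc
  have hq := card_le_rank hP.1
  unfold basicSearch
  refine Code.tri_seq (T' := (l.length + 1) * (490 * (rank e.O.fam * Tc) + e.u) + e.u + 40 * e.u) ?_ rfl ?_ ?_
  · simp
  · refine Tri.seq (Tri.loop_count (b := .lp4) (fun k m' => m'.frame = m.frame ∧
      (m'.lp4 = true → m'.fd = false ∧ ∃ l, l.length + 1 = k ∧ PassCursor m'.cur m'.w m'.C l ∧
        l.findSome? (basicChild e.O.fam m.cur) = res) ∧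
      (m'.lp4 = false → m'.result = res)) (490 * (rank e.O.fam * Tc)) ?_ ?_ ?_)
    · rintro k m' ⟨hf, h1, -⟩ hb
      replace hb : m'.lp4 = true := hb
      obtain ⟨hfd, l, hk, hl, hres⟩ := h1 hb
      have hcur : m'.cur = m.cur := by
        simp only [Mem.frame, Prod.mk.injEq] at hf; exact hf.2.2.2
      refine ⟨l.length, hk.symm, (Tri.seq (T' := e.u + 400 * (rank e.O.fam * Tc)) ((tri_step (hcur ▸ hq) hl hb).mono le_rfl ?_)).le ?_⟩
      · rintro m1 ⟨hf1, hfd1, hm1⟩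
        have hcur1 : m1.cur = m'.cur := by
          simp only [Mem.frame, Prod.mk.injEq] at hf1; exact hf1.2.2.2
        cases l with
        | nil =>
          refine Tri.cond (fun h => absurd (hm1.symm.trans h) (by simp)) fun _ => Code.tri_end ?_ ?_ ?_
          · simp
          · simp only [Code.len, List.length_nil]; omega
          · refine ⟨hf1.trans hf, fun h => absurd (hm1.symm.trans h) (by simp), fun _ => ?_⟩
            rw [← hres]
            simp [Mem.result, hfd1, hfd]
        | cons i l' =>
          obtain ⟨w, C⟩ := i
          obtain ⟨hlp1, hw1, hC1, hl'⟩ := hm1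
          refine Tri.cond (fun _ => ?_) (fun h => absurd (hlp1.symm.trans h) (by simp))
          refine (tri_basicPass h0 hs hch hTc hr hw1 (by rw [hcur1, hcur]; exact hP) ?_ hlp1 (hfd1.trans hfd)).mono le_rfl ?_
          · rw [hC1, hcur1]; exact hl'.subset
          · rintro m2 ⟨hf2, hm2⟩
            have hcur2 : m2.cur = m1.cur := by
              simp only [Mem.frame, Prod.mk.injEq] at hf2; exact hf2.2.2.2
            rw [hC1, hcur1, hcur] at hm2
            rw [List.findSome?_cons] at hres
            refine ⟨hf2.trans (hf1.trans hf), ?_⟩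
            cases hc : basicChild e.O.fam m.cur (w, C) with
            | none =>
              rw [hc] at hm2 hres
              obtain ⟨h1, h2, h3, h4⟩ := hm2
              refine ⟨fun _ => ⟨h2, l', rfl, ?_, hres⟩, fun h => absurd (h1.symm.trans h) (by simp)⟩
              rw [hcur2, hcur1, h3, h4, hw1]
              exact hl'
            | some S =>
              rw [hc] at hm2 hres
              obtain ⟨h1, h2, h3⟩ := hm2
              refine ⟨fun h => absurd (h1.symm.trans h) (by simp), fun _ => ?_⟩
              rw [← hres]
              simp [Mem.result, h2, h3]
      · ring_nf at h3 ⊢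
        nlinarith
    · rintro k m' ⟨hf, -, h1⟩ hb
      refine (tri_wipe m').mono le_rfl ?_
      rintro m'' rfl
      rw [h1 hb, Mem.searched_congr hf]
    · exact ⟨rfl, fun _ => ⟨rfl, l, rfl, hl, rfl⟩, by simp⟩
  · have h4 : (l.length + 1) * (490 * (rank e.O.fam * Tc) + e.u) ≤ (l.length + 1) * (500 * (rank e.O.fam * Tc)) :=
      Nat.mul_le_mul_left _ (by omega)
    have h6 : (l.length + 2) * (500 * (rank e.O.fam * Tc)) =
        (l.length + 1) * (500 * (rank e.O.fam * Tc)) + 500 * (rank e.O.fam * Tc) := by ring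
    simp only [Code.len, List.length_cons, List.length_nil]
    omega

end BasicSearch

-- One pass of the refined framework

section RefinedSearch

variable {n : ℕ} {e : Env n} {F : Finset (Finset (Fin n))} {ch : Chooser n}
  {key : Finset (Fin n) → Fin n → ℕ ×ₗ Fin n} {choose : Cmd 12} {Tc : ℕ}
  {restr : Finset (Fin n) → Fin n → List (Finset (Fin n))}

/-- The solution `r(S)` of the restricted problem. -/
def restrProg (choose : Cmd 12) : Cmd 12 :=
  (Code.ops [.cpS .X .core, .insE .X .pi, .cpS .A .Q, .insE .A .pi, .setF .ua true, .clrE .ws]).cmd ;;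
  completeProg choose ;; (Code.ops [.cpS .rs .X, .clrS .X, .clrS .A, .setF .ua false]).cmd

theorem tri_restrProg (h0 : ∅ ∈ e.O.fam) (hs : StronglyAccessible e.O.fam)
    (hn : ∃ X ∈ e.O.fam, X.Nonempty)
    (K : KeyChooser e.O.fam ch key) (hch : ChooseSpec e choose ch Tc) (hTc : e.u ≤ Tc)
    (hr : 1 ≤ rank e.O.fam) {m : Mem n}
    {S P R : Finset (Fin n)} {w : Fin n} (hS : IsMaxSol e.O.fam S) (hP : parent e.O.fam ch S = some P)
    (hw : pi e.O.fam ch S = some w) (hR : rSol e.O.fam ch S = some R)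
    (hmc : m.core = core e.O.fam ch S) (hmQ : m.Q = P) (hmw : m.pi = some w) :
    Tri e (restrProg choose) m (70 * (rank e.O.fam * Tc))
      (· = { m.completed ∅ with rs := R, A := ∅, ua := false, ws := none }) := by
  have h2 : 1 * Tc ≤ rank e.O.fam * Tc := Nat.mul_le_mul_right _ hr
  obtain ⟨s, hsrc⟩ := exists_source h0 hs hS.1 (hS.nonempty hn)
  obtain ⟨j, w', v, hj, -, hcore, hpar, hpi, -, hps, -⟩ := K.nonroot_spec hs hS hsrc (K.one_lt_piIndex hP)
  obtain rfl : w = w' := Option.some.inj (hw.symm.trans hpi)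
  have hX : insert w m.core ∈ e.O.fam := by
    rw [hmc, hcore, ← hps]; exact K.pref_mem hsrc (by omega)
  have hPm := K.isMaxSol_parent h0 hs hn hS hP
  have hR' : R = complete ch (insert w m.core) (insert w P) := by
    rw [rSol, hP, hw] at hR
    rw [hmc]; exact (Option.some.inj hR).symm
  refine Code.tri_seq (m1 := { m with X := insert w m.core, A := insert w P, ua := true, ws := none })
    (T' := 50 * (rank e.O.fam * Tc) + 5 * e.u) ?_ ?_
    (Tri.call (tri_complete K hch hTc (by exact hX) (insert_nonempty _ _)) (Code.tri_end ?_ le_rfl ?_)) ?_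
  -- The set P ∪ {w} need not be a solution and can have q + 1 elements; the bound for stored sets
  -- allows for this.
  · have h1 := card_insertOpt (x := some w) (card_le_rank hPm.1)
    have h2 := card_le_rank hX
    simp only [insertOpt] at h1
    simp [hmQ, hmw, insertOpt]
    omega
  · simp [hmw, hmQ, insertOpt]
  · simp
  · rw [completeStop_none, hR']
    simp [Mem.completed, Mem.dom]
  · simp only [Code.len, List.length_cons, List.length_nil]
    omega

/-- The passes of the loop of the refined framework for one `w`, before filtering. -/
def rawRefined (restr : Finset (Fin n) → Fin n → List (Finset (Fin n))) (P : Finset (Fin n))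
    (w : Fin n) : List (Fin n × Finset (Fin n) × Fin n) :=
  if w ∈ P then [] else (restr P w).flatMap fun R => (sorted R).map fun s => (w, R, s)

/-- The child of `P` for the pass `i`, if any, where `i` need not be one of the passes. -/
def refinedChild (F : Finset (Finset (Fin n))) (restr : Finset (Fin n) → Fin n → List (Finset (Fin n)))
    (P : Finset (Fin n)) (i : Fin n × Finset (Fin n) × Fin n) : Option (Finset (Fin n)) :=
  if i.2.1 ≠ P ∧ i.2.2 ≠ i.1 ∧ {i.2.2} ∈ F then (refined F restr).child P i else none

/-- As in the basic framework, the conditions R ≠ P, s ≠ w and {s} ∈ F can be tested inside the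
passes of a loop over all listed R and all their elements. -/
theorem iters_refined (F : Finset (Finset (Fin n)))
    (restr : Finset (Fin n) → Fin n → List (Finset (Fin n))) (P : Finset (Fin n)) :
    (refined F restr).iters P = ((List.finRange n).flatMap (rawRefined restr P)).filter
      fun i => i.2.1 ≠ P ∧ i.2.2 ≠ i.1 ∧ {i.2.2} ∈ F := by
  simp only [refined, List.filter_flatMap, rawRefined]
  congr 1
  funext w
  split_ifs
  · rfl
  · rw [List.filter_flatMap]
    induction restr P w with
    | nil => rfl
    | cons R l ih =>
      rw [List.flatMap_cons, ← ih, List.filter_cons]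
      by_cases hR : R = P
      · simp [hR]
      · have : sorted ((R ∩ singles F).erase w) =
            (sorted R).filter fun s => decide (s ≠ w ∧ {s} ∈ F) := by
          simp only [sorted, List.filter_filter]
          refine List.filter_congr fun x _ => ?_
          simp only [← Bool.decide_and, decide_eq_decide, mem_erase, mem_inter, singles, mem_filter,
            mem_univ, true_and]
          tauto
        simp only [hR, ne_eq, not_false_eq_true, decide_true, if_true, List.flatMap_cons, this,
          List.filter_map]
        congr 2
        simp only [decide_not, Bool.decide_and, Function.comp_def, hR, decide_false, Bool.not_false,
          Bool.true_and]

theorem findSome?_refinedChild (F : Finset (Finset (Fin n))) (P : Finset (Fin n))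
    (l : List (Fin n × Finset (Fin n) × Fin n)) :
    (l.filter fun i => i.2.1 ≠ P ∧ i.2.2 ≠ i.1 ∧ {i.2.2} ∈ F).findSome? ((refined F restr).child P) =
      l.findSome? (refinedChild F restr P) := by
  induction l with
  | nil => rfl
  | cons i l ih =>
    rw [List.filter_cons, List.findSome?_cons, ← ih, refinedChild]
    split_ifs with h1 h2 h2
    · rfl
    · exact absurd (of_decide_eq_true h1) h2
    · exact absurd (decide_eq_true h2) h1
    · rfl

/-- The test whether `S` is a child of the current solution that belongs to the pass. -/
def refinedTail : Code :=
  .seq (.ops [.eqS .t .rs .R]) <| .ite .t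
    (.seq (.ops [.eqS .t .Q .cur]) <| .ite .t
      (.seq (.ops [.eqE .t .src .s]) (.ite .t (.ops [.setF .lp4 false, .setF .fd true]) (.ops [])))
      (.ops []))
    (.ops [])

/-- The outcome of `refinedTail`. -/
def refinedTest (m : Mem n) : Bool :=
  decide (m.rs = m.R) && (decide (m.Q = m.cur) && decide (m.src = m.s))

theorem exec_refinedTail (F : Finset (Finset (Fin n))) (m : Mem n) :
    refinedTail.exec F m = { m with
      t := refinedTest m, lp4 := m.lp4 && !refinedTest m, fd := m.fd || refinedTest m } := by
  unfold refinedTest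
  by_cases h1 : m.rs = m.R <;> by_cases h2 : m.Q = m.cur <;> by_cases h3 : m.src = m.s <;>
    simp [refinedTail, h1, h2, h3]

/-- One pass of the loop of the refined framework. -/
def refinedPass (choose : Cmd 12) : Cmd 12 :=
  (Code.ops [.eqE .t .s .w]).cmd ;;
  .cond FReg.t.idx (Code.ops []).cmd
    ((Code.ops [.clrS .X, .insE .X .s, .qry .t .X]).cmd ;;
    .cond FReg.t.idx
      ((Code.ops [.cpS .A .R, .setF .ua true, .cpE .ws .w]).cmd ;; completeProg choose ;;
        (Code.ops [.insE .X .w, .setF .ua false, .clrE .ws]).cmd ;; completeProg choose ;;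
        (Code.ops [.cpS .S .X]).cmd ;; analyzeProg choose ;; (Code.ops [.eqE .t .pi .w]).cmd ;;
        .cond FReg.t.idx (restrProg choose ;; refinedTail.cmd) (Code.ops []).cmd)
      (Code.ops []).cmd)

theorem tri_refinedPass (h0 : ∅ ∈ e.O.fam) (hs : StronglyAccessible e.O.fam)
    (hn : ∃ X ∈ e.O.fam, X.Nonempty)
    (hch : ChooseSpec e choose (chooseLay e.O.fam) Tc)
    (hTc : e.u ≤ Tc) (hr : 1 ≤ rank e.O.fam) {m : Mem n} {w s : Fin n} (hw : m.w = some w)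
    (hms : m.s = some s) (hP : IsMaxSol e.O.fam m.cur)
    (hR : Maximal (fun X => X ∈ e.O.fam ∧ X ⊆ insert w m.cur) m.R) (hRP : m.R ≠ m.cur) (hsR : s ∈ m.R)
    (hlp : m.lp4 = true) (hfd : m.fd = false) :
    Tri e (refinedPass choose) m (600 * (rank e.O.fam * Tc)) (fun m' => m'.frame = m.frame ∧
      match refinedChild e.O.fam e.O.restr m.cur (w, m.R, s) with
      | none => m'.lp4 = true ∧ m'.fd = false ∧ m'.w = m.w ∧ m'.s = m.s ∧ m'.R = m.R ∧
          m'.lister = m.lister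
      | some S => m'.lp4 = false ∧ m'.fd = true ∧ m'.S = S) := by
  have K := keyChooser_chooseLay h0 hs
  have h2 : 1 * Tc ≤ rank e.O.fam * Tc := Nat.mul_le_mul_right _ hr
  have hq := card_le_rank hP.1
  refine Code.tri_seq (m1 := { m with t := decide (some s = some w) })
    (T' := e.u + (5 * e.u + (e.u + 560 * (rank e.O.fam * Tc)))) ?_ ?_ (Tri.cond (fun ht => ?_) (fun ht => ?_)) ?_
  · simp
  · simp [hw, hms]
  · replace ht := Option.some.inj (of_decide_eq_true ht)
    have : refinedChild e.O.fam e.O.restr m.cur (w, m.R, s) = none := if_neg fun h => h.2.1 ht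
    rw [this]
    refine Code.tri_end ?_ ?_ ⟨rfl, hlp, hfd, rfl, rfl, rfl, rfl⟩
    · simp
    · simp only [Code.len, List.length_nil]; omega
  · replace ht : s ≠ w := fun h => of_decide_eq_false ht (congrArg _ h)
    refine Code.tri_seq (m1 := { m with X := {s}, t := decide ({s} ∈ e.O.fam) })
      (T' := (e.u + 560 * (rank e.O.fam * Tc))) ?_ ?_ (Tri.cond (fun ht' => ?_) (fun ht' => ?_)) ?_
    · simpa using card_insertOpt (by simp)
    · simp [hms, insertOpt]
    · replace ht' : {s} ∈ _ := of_decide_eq_true ht'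
      set Y := completeUntil (chooseLay e.O.fam) w {s} m.R with hY
      -- Whether or not the pass yields a child, the truncated completion together with w is a
      -- solution, so the second completion may be started.
      obtain ⟨hYF, hYR⟩ := insert_completeUntil_mem h0 hs hP hR hRP hsR ht'
      have hYq := card_le_rank hYF
      set S := complete (chooseLay e.O.fam) (insert w Y) univ with hS
      have hSm : IsMaxSol e.O.fam S := K.isMaxSol_complete hs hYF (insert_nonempty _ _)
      have hSne : S.Nonempty := (insert_nonempty _ _).mono (subset_complete _ _)
      obtain ⟨s', hsrc⟩ := exists_source h0 hs hSm.1 hSne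
      have hcs : completeStop (chooseLay e.O.fam) (some w) {s} m.R = Y := completeStop_some _ _ _
      have hchild : refinedChild e.O.fam e.O.restr m.cur (w, m.R, s) =
          if parent e.O.fam (chooseLay e.O.fam) S = some m.cur ∧ pi e.O.fam (chooseLay e.O.fam) S = some w ∧
            rSol e.O.fam (chooseLay e.O.fam) S = some m.R ∧ source e.O.fam S = some s then some S else none :=
        if_pos ⟨hRP, ht, ht'⟩
      refine Code.tri_seq (m1 := { m with X := {s}, t := true, A := m.R, ua := true, ws := some w })
        (T' := 550 * (rank e.O.fam * Tc)) ?_ ?_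
        (Tri.call_le (tri_complete K hch hTc (by exact ht') (singleton_nonempty s)) (Code.tri_seq
        (m1 := { m.completed (insert w Y) with A := m.R, ua := false, ws := none })
        (T' := 440 * (rank e.O.fam * Tc) + 10 * e.u)
        ?_ ?_ (Tri.call_le (tri_complete_univ K hch hTc (by exact hYF) (insert_nonempty _ _) rfl rfl)
        (Code.tri_seq (m1 := { m.completed S with A := m.R, ua := false, ws := none, S := S })
          ?_ ?_ (Tri.call_le (tri_analyze h0 hs K hch hTc (by exact hSm) (by exact hSne))
          (Code.tri_seq (m1 := { ({ m.completed S with A := m.R, ua := false, ws := none, S := S } : Mem n).analyzed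
            e.O.fam (chooseLay e.O.fam) S with t := decide (branch e.O.fam (chooseLay e.O.fam) S = some w) })
            (T' := e.u + (70 * (rank e.O.fam * Tc) + 14 * e.u)) ?_ ?_ (Tri.cond (fun ht2 => ?_) (fun ht2 => ?_)) le_rfl) le_rfl)
            le_rfl) ?_) le_rfl) ?_) ?_
      · simp
      · simp [ht', hw]
      · simpa [Mem.completed, Mem.dom, hw, insertOpt, hcs] using hYq.trans (Nat.le_succ _)
      · simp [Mem.completed, Mem.dom, hw, insertOpt, hcs]
      · simp
      · simp [Mem.completed, hS]
      · simp
      · simp [Mem.completed, Mem.analyzed, hw]; rfl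
      · replace ht2 : branch e.O.fam (chooseLay e.O.fam) S = some w := of_decide_eq_true ht2
        cases hpar : parent e.O.fam (chooseLay e.O.fam) S with
        | none => rw [(branch_eq_none_iff K hs hSm hsrc).2 hpar] at ht2; cases ht2
        | some P =>
          have hpi : pi e.O.fam (chooseLay e.O.fam) S = some w := (branch_of_parent hpar).symm.trans ht2
          obtain ⟨R, hR'⟩ : ∃ R, rSol e.O.fam (chooseLay e.O.fam) S = some R := by
            rw [rSol, hpar, hpi]; exact ⟨_, rfl⟩
          have hps : parentSet e.O.fam (chooseLay e.O.fam) S = P := by rw [parentSet, hpar]; rfl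
          refine Tri.seq ((tri_restrProg h0 hs hn K hch hTc hr hSm hpar hpi hR' (by rfl) (by exact hps)
            (by exact ht2)).mono le_rfl fun m' hm' => Code.tri_end ?_ ?_ ?_)
          · simp [refinedTail]
          · exact Nat.mul_le_mul_right _ (by simp [refinedTail])
          · rw [exec_refinedTail]
            refine ⟨by subst hm'; rfl, ?_⟩
            have hchild' : refinedChild e.O.fam e.O.restr m.cur (w, m.R, s) =
                if R = m.R ∧ parentSet e.O.fam (chooseLay e.O.fam) S = m.cur ∧
                  source e.O.fam S = m.s then some S else none := by
              refine hchild.trans (if_congr ?_ rfl rfl)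
              rw [hpar, hpi, hR', hps, hms]
              simp only [Option.some.injEq, true_and]
              tauto
            have ht : refinedTest m' = decide (R = m.R ∧ parentSet e.O.fam (chooseLay e.O.fam) S = m.cur ∧
                  source e.O.fam S = m.s) := by
              subst hm'
              simp only [Bool.decide_and]; rfl
            rw [hchild']
            split_ifs with hc
            · refine ⟨?_, ?_, ?_⟩
              · simp [ht, hc]
              · simp [ht, hc]
              · subst hm'; rfl
            · refine ⟨?_, ?_, ?_, ?_, ?_, ?_⟩
              · change (m'.lp4 && !refinedTest m') = true
                rw [ht, decide_eq_false hc]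
                subst hm'
                exact (Bool.and_true _).trans hlp
              · change (m'.fd || refinedTest m') = false
                rw [ht, decide_eq_false hc]
                subst hm'
                exact (Bool.or_false _).trans hfd
              all_goals subst hm'; rfl
      · replace ht2 : branch e.O.fam (chooseLay e.O.fam) S ≠ some w := of_decide_eq_false ht2
        have hnone : refinedChild e.O.fam e.O.restr m.cur (w, m.R, s) = none := by
          refine hchild.trans (if_neg fun h => ht2 ?_)
          rw [branch_of_parent h.1, h.2.1]
        rw [hnone]
        refine Code.tri_end ?_ ?_ ⟨rfl, hlp, hfd, rfl, rfl, rfl, rfl⟩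
        · simp
        · simp only [Code.len, List.length_nil]; omega
      all_goals simp only [Code.len, List.length_cons, List.length_nil]; omega
    · replace ht' : {s} ∉ _ := of_decide_eq_false ht'
      have : refinedChild e.O.fam e.O.restr m.cur (w, m.R, s) = none := if_neg fun h => ht' h.2.2
      rw [this]
      refine Code.tri_end ?_ ?_ ⟨rfl, hlp, hfd, rfl, rfl, rfl, rfl⟩
      · simp
      · simp only [Code.len, List.length_nil]; omega
    · simp only [Code.len, List.length_cons, List.length_nil]; omega
  · simp only [Code.len, List.length_cons, List.length_nil]; omega

end RefinedSearch

-- The child search of the refined framework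

section RefinedSearch

variable {n : ℕ} {e : Env n} {choose : Cmd 12} {Tc : ℕ}
  {restr : Finset (Fin n) → Fin n → List (Finset (Fin n))}

/-- The loop variables `w`, `R`, `s` and the lister `li` are such that after the present pass the
elements `restS` of `R`, the lists of the members of `restR`, and the elements `restW` are left. -/
structure ListCursor (restr : Finset (Fin n) → Fin n → List (Finset (Fin n))) (P : Finset (Fin n))
    (w s : Option (Fin n)) (R : Finset (Fin n)) (li : Option (Finset (Fin n) × Fin n × ℕ))
    (restS : List (Fin n)) (restR : List (Finset (Fin n))) (restW : List (Fin n)) : Prop where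
  cursorS : Cursor (sorted R) s restS
  cursorW : Cursor (List.finRange n) w restW
  lister : match li with
    | none => restR = []
    | some (P', w', i) => P' = P ∧ w = some w' ∧ w' ∉ P ∧ restR = (restr P w').drop i
  mem : ∀ x ∈ restS, ∃ w', w = some w' ∧ w' ∉ P ∧ R ∈ restr P w' ∧ x ∈ R

/-- The passes that are left. -/
def leftPasses (restr : Finset (Fin n) → Fin n → List (Finset (Fin n))) (P : Finset (Fin n))
    (w : Option (Fin n)) (R : Finset (Fin n))
    (restS : List (Fin n)) (restR : List (Finset (Fin n))) (restW : List (Fin n)) :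
    List (Fin n × Finset (Fin n) × Fin n) :=
  (w.toList.flatMap fun w => restS.map (fun s => (w, R, s)) ++
    restR.flatMap fun R => (sorted R).map fun s => (w, R, s)) ++ restW.flatMap (rawRefined restr P)

/-- This and the next two equations correspond to the three ways in which the search advances: to
the next s, to the next answer of the lister, to the next w. Only the first consumes a pass. -/
theorem leftPasses_cons (P : Finset (Fin n)) (w : Fin n) (R : Finset (Fin n)) (s : Fin n)
    (restS : List (Fin n)) (restR : List (Finset (Fin n))) (restW : List (Fin n)) :
    leftPasses restr P (some w) R (s :: restS) restR restW =
      (w, R, s) :: leftPasses restr P (some w) R restS restR restW := by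
  simp [leftPasses]

theorem leftPasses_list (P : Finset (Fin n)) (w : Fin n) (R R' : Finset (Fin n))
    (restR : List (Finset (Fin n))) (restW : List (Fin n)) :
    leftPasses restr P (some w) R [] (R' :: restR) restW =
      leftPasses restr P (some w) R' (sorted R') restR restW := by
  simp [leftPasses]

theorem leftPasses_next (P : Finset (Fin n)) (w : Option (Fin n)) (w' : Fin n) (R R' : Finset (Fin n))
    (restW : List (Fin n)) :
    leftPasses restr P w R [] [] (w' :: restW) =
      leftPasses restr P (some w') R' [] (if w' ∈ P then [] else restr P w') restW := by
  by_cases h : w' ∈ P <;> simp [leftPasses, rawRefined, h]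

theorem ListCursor.start (P : Finset (Fin n)) :
    ListCursor restr P none none ∅ none [] [] (List.finRange n) :=
  ⟨by simpa [sorted] using Cursor.start [], Cursor.start _, rfl, by simp⟩

theorem ListCursor.stepS {P : Finset (Fin n)} {w s : Option (Fin n)} {R : Finset (Fin n)}
    {li : Option (Finset (Fin n) × Fin n × ℕ)} {a : Fin n}
    {restS : List (Fin n)} {restR : List (Finset (Fin n))} {restW : List (Fin n)}
    (h : ListCursor restr P w s R li (a :: restS) restR restW) :
    ListCursor restr P w (some a) R li restS restR restW :=
  ⟨h.cursorS.step, h.cursorW, h.lister, fun x hx => h.mem x (List.mem_cons_of_mem _ hx)⟩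

/-- The next answer of the lister. -/
theorem ListCursor.stepR {P : Finset (Fin n)} {w s : Option (Fin n)} {R R' : Finset (Fin n)}
    {restS : List (Fin n)} {restR : List (Finset (Fin n))} {restW : List (Fin n)}
    {P' : Finset (Fin n)} {w' : Fin n} {i : ℕ}
    (h : ListCursor restr P w s R (some (P', w', i)) restS restR restW)
    (hR : (restr P' w')[i]? = some R') :
    restR = R' :: (restr P' w').drop (i + 1) ∧
    ListCursor restr P w none R' (some (P', w', i + 1)) (sorted R') ((restr P' w').drop (i + 1)) restW := by
  obtain ⟨rfl, rfl, hw, rfl⟩ := h.lister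
  have h1 := List.getElem?_eq_some_iff.1 hR
  refine ⟨?_, Cursor.start _, h.cursorW, ⟨rfl, rfl, hw, rfl⟩, fun x hx => ⟨w', rfl, hw, ?_, mem_sorted.1 hx⟩⟩
  · rw [List.drop_eq_getElem_cons h1.1, h1.2]
  · exact List.mem_of_getElem? hR

/-- The next value of `s`, `R` or `w`. -/
def nextWProg : Cmd 12 :=
  (Code.ops [.clrS .R, .succE .w, .nullE .t .w]).cmd ;;
  .cond FReg.t.idx (Code.ops [.setF .lp4 false]).cmd
    ((Code.ops [.memE .t .w .cur]).cmd ;;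
      .cond FReg.t.idx (Code.ops []).cmd (.instr (.startList SReg.cur.idx EReg.w.idx)))

/-- A lister is started only for w ∉ P, where its bounds apply, and its time is charged only if
there is a further w. Clearing R leaves, with a null s, an exhausted cursor. -/
theorem tri_nextW (hmay : ∀ w, w ∉ P → e.may P w) {m : Mem n} (hP : m.cur = P) (hli : m.lister = none) (hs : m.s = none)
    {w : Option (Fin n)} {restW : List (Fin n)} (hw : m.w = w) (hW : Cursor (List.finRange n) w restW)
    (hlp : m.lp4 = true) :
    Tri e nextWProg m (12 * e.u + if restW = [] then 0 else e.RT) (fun m' => m'.frame = m.frame ∧ m'.fd = m.fd ∧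
      match restW with
      | [] => m'.lp4 = false
      | w' :: restW' => m'.lp4 = true ∧
        ListCursor restr P m'.w m'.s m'.R m'.lister [] (if w' ∈ P then [] else restr P w') restW' ∧ m'.w = some w') := by
  have hn := hW.next (List.pairwise_lt_finRange n)
  subst hw hP
  refine Code.tri_seq (m1 := { m with R := ∅, w := restW.head?, t := restW.head?.isNone })
    (T' := e.u + (2 * e.u + (e.u + (e.u + if restW = [] then 0 else e.RT)))) ?_ ?_ (Tri.cond (fun ht => ?_) (fun ht => ?_)) ?_
  · simp
  · simp [hn]
  · cases restW with
    | cons w' restW' => exact absurd ht (by simp)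
    | nil =>
      refine Code.tri_end ?_ ?_ ⟨rfl, rfl, rfl⟩
      · simp
      · simp only [Code.len, List.length_cons, List.length_nil]; omega
  · cases restW with
    | nil => exact absurd ht (by simp)
    | cons w' restW' =>
      have h0 : ∀ R : Finset (Fin n), R = ∅ → Cursor (sorted R) none [] := by
        rintro R rfl; simpa [sorted] using Cursor.start []
      refine Code.tri_seq (m1 := { m with R := ∅, w := some w', t := decide (w' ∈ m.cur) })
        ?_ ?_ (Tri.cond (fun ht => ?_) (fun ht => ?_)) le_rfl
      · simp
      · simp [memOpt]; rfl
      · replace ht : w' ∈ m.cur := of_decide_eq_true ht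
        refine Code.tri_end ?_ ?_ ⟨rfl, rfl, hlp, ⟨?_, hW.step, ?_, by simp⟩, rfl⟩
        · simp
        · simp only [Code.len, List.length_nil]; omega
        · exact hs ▸ h0 _ rfl
        · simp only [Code.exec, runBlk, hli, if_pos ht]
      · replace ht : w' ∉ m.cur := of_decide_eq_false ht
        refine (tri_startList ?_).mono (by rw [if_neg (by simp)]) ?_
        · intro a ha
          obtain rfl := Option.some.inj ha
          exact hmay _ ht
        · rintro m' rfl
          exact ⟨rfl, rfl, hlp, ⟨hs ▸ h0 _ rfl, hW.step, ⟨rfl, rfl, ht, by rw [if_neg ht]; rfl⟩, by simp⟩, rfl⟩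
  · simp only [Code.len, List.length_cons, List.length_nil]; omega

/-- The search for the next child in the refined framework. -/
def refinedSearch (choose : Cmd 12) : Cmd 12 :=
  (Code.ops [.setF .lp4 true, .setF .fd false]).cmd ;;
  .loop FReg.lp4.idx
    ((Code.ops [.nextE .s .R, .nullE .t .s]).cmd ;;
      .cond FReg.t.idx
        (.instr (.nextList FReg.t.idx SReg.R.idx) ;; .cond FReg.t.idx (Code.ops []).cmd nextWProg)
        (refinedPass choose)) ;; wipe.cmd

/-- The passes of the machine loop that are left are counted as follows: one for each remaining s; q
+ 1 for each remaining R, one to fetch it and at most q for its elements; and RB·(q + 1) + 1 for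
each remaining w. A uniform bound per pass would charge the lister too often, so a budget is used in
which RT is due once for each remaining w. -/
theorem tri_refinedSearch (h0 : ∅ ∈ e.O.fam) (hs : StronglyAccessible e.O.fam)
    (hn : ∃ X ∈ e.O.fam, X.Nonempty)
    (hch : ChooseSpec e choose (chooseLay e.O.fam) Tc)
    (hTc : e.u ≤ Tc) (hr : 1 ≤ rank e.O.fam) {m : Mem n} (hP : IsMaxSol e.O.fam m.cur)
    (hmay : ∀ w, w ∉ m.cur → e.may m.cur w) {RB : ℕ}
    (hrestr : ∀ w, w ∉ m.cur → (e.O.restr m.cur w).length ≤ RB ∧ ∀ R ∈ e.O.restr m.cur w,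
      Maximal (fun X => X ∈ e.O.fam ∧ X ⊆ insert w m.cur) R ∧ R ≠ m.cur)
    {restS : List (Fin n)} {restR : List (Finset (Fin n))} {restW : List (Fin n)}
    (hl : ListCursor e.O.restr m.cur m.w m.s m.R m.lister restS restR restW) :
    Tri e (refinedSearch choose) m
      ((restS.length + restR.length * (rank e.O.fam + 1) + restW.length * (RB * (rank e.O.fam + 1) + 1) + 2) *
        (700 * (rank e.O.fam * Tc)) + restW.length * e.RT)
      (· = m.searched ((leftPasses e.O.restr m.cur m.w m.R restS restR restW).findSome?
        (refinedChild e.O.fam e.O.restr m.cur))) := by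
  set res := (leftPasses e.O.restr m.cur m.w m.R restS restR restW).findSome?
        (refinedChild e.O.fam e.O.restr m.cur) with hres
  set q := rank e.O.fam with hq
  set P := m.cur with hPc
  have h2 : 1 * Tc ≤ q * Tc := Nat.mul_le_mul_right _ hr
  unfold refinedSearch
  set T := 630 * (q * Tc) with hT
  refine Code.tri_seq (T' := ((restS.length + restR.length * (q + 1) + restW.length * (RB * (q + 1) + 1) + 1) *
    (T + e.u) + restW.length * e.RT + e.u) + 40 * e.u) ?_ rfl ?_ ?_
  · simp
  · refine Tri.seq (Tri.loop (b := .lp4) (fun τ m' => m'.frame = m.frame ∧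
      (m'.lp4 = true → m'.fd = false ∧ ∃ restS restR restW,
        ListCursor e.O.restr P m'.w m'.s m'.R m'.lister restS restR restW ∧
        (restS.length + restR.length * (q + 1) + restW.length * (RB * (q + 1) + 1) + 1) *
          (T + e.u) + restW.length * e.RT + e.u ≤ τ ∧
        (leftPasses e.O.restr P m'.w m'.R restS restR restW).findSome?
          (refinedChild e.O.fam e.O.restr P) = res) ∧
      (m'.lp4 = false → e.u ≤ τ ∧ m'.result = res)) ?_ ?_ ?_)
    · rintro τ m' ⟨hf, h1, -⟩ hb
      replace hb : m'.lp4 = true := hb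
      obtain ⟨hfd, restS, restR, restW, hl, hτ, hres⟩ := h1 hb
      have hcur : m'.cur = P := by
        simp only [Mem.frame, Prod.mk.injEq] at hf; exact hf.2.2.2
      have hnx := hl.cursorS.next (pairwise_lt_sorted m'.R)
      cases restS with
      | cons s restS =>
        simp only [List.length_cons] at hτ
        have : (restS.length + 1 + restR.length * (q + 1) + restW.length * (RB * (q + 1) + 1) + 1) * (T + e.u) =
          (restS.length + restR.length * (q + 1) + restW.length * (RB * (q + 1) + 1) + 1) * (T + e.u) + (T + e.u) := by ring
        refine ⟨T, τ - (e.u + T), ?_, Code.tri_seq (m1 := { m' with s := some s, t := false })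
          (T' := e.u + 600 * (q * Tc)) ?_ ?_ (Tri.cond (fun h => absurd h (by simp)) fun _ => ?_) ?_⟩
        · omega
        · simp
        · simp [hnx]
        · obtain ⟨w, hw, hwP, hR, hsR⟩ := hl.mem s (by simp)
          obtain ⟨hR1, hR2⟩ := (hrestr w hwP).2 _ hR
          rw [← hcur] at hR1 hR2
          refine (tri_refinedPass (m := { m' with s := some s, t := false }) h0 hs hn hch hTc hr hw rfl (by exact hcur ▸ hP) (by exact hR1)
            (by exact hR2) (by exact hsR) hb hfd).mono le_rfl ?_
          rintro m2 ⟨hf2, hm2⟩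
          refine ⟨hf2.trans hf, ?_⟩
          rw [hw, leftPasses_cons, List.findSome?_cons] at hres
          change match refinedChild e.O.fam e.O.restr m'.cur (w, m'.R, s) with | none => _ | some S => _ at hm2
          rw [hcur] at hm2
          cases hc : refinedChild e.O.fam e.O.restr P (w, m'.R, s) with
          | none =>
            rw [hc] at hm2 hres
            obtain ⟨h1, h2, h3, h4, h5, h6⟩ := hm2
            refine ⟨fun _ => ⟨h2, restS, restR, restW, ?_, ?_, ?_⟩, fun h => absurd (h1.symm.trans h) (by simp)⟩
            · rw [h3, h4, h5, h6]; exact hl.stepS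
            · omega
            · rw [h3, h5, ← hres]
              change _ = List.findSome? _ (leftPasses _ _ _ _ _ _ _)
              rw [← hw]
          | some S =>
            rw [hc] at hm2 hres
            obtain ⟨h1, h2, h3⟩ := hm2
            refine ⟨fun h => absurd (h1.symm.trans h) (by simp), fun _ => ⟨by omega, ?_⟩⟩
            rw [← hres]
            simp [Mem.result, h2, h3]
        · simp only [Code.len, List.length_cons, List.length_nil]; omega
      | nil =>
        simp only [List.length_nil, zero_add] at hτ
        -- The step to the next w is reached either without an active lister or after the lister has
        -- just reported its end. T' accounts for the part of the pass already made.
        have hnext : ∀ m1 : Mem n, m1.frame = m'.frame → m1.fd = m'.fd → m1.lister = none → m1.s = none →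
            m1.w = m'.w → m1.lp4 = true → restR = [] → ∀ T', 12 * e.u + T' ≤ T → ∃ TW τ', e.u + (T' + TW) + τ' ≤ τ ∧
              Tri e nextWProg m1 TW (fun m' => m'.frame = m.frame ∧
      (m'.lp4 = true → m'.fd = false ∧ ∃ restS restR restW,
        ListCursor e.O.restr P m'.w m'.s m'.R m'.lister restS restR restW ∧
        (restS.length + restR.length * (q + 1) + restW.length * (RB * (q + 1) + 1) + 1) *
          (T + e.u) + restW.length * e.RT + e.u ≤ τ' ∧
        (leftPasses e.O.restr P m'.w m'.R restS restR restW).findSome?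
          (refinedChild e.O.fam e.O.restr P) = res) ∧
      (m'.lp4 = false → e.u ≤ τ' ∧ m'.result = res)) := by
          rintro m1 hf1 hfd1 hli1 hs1 hw1 hlp1 rfl T' hT'
          have hcur1 : m1.cur = P := by
            have := hf1.trans hf
            simp only [Mem.frame, Prod.mk.injEq] at this; exact this.2.2.2
          have ht := tri_nextW (restr := e.O.restr) hmay hcur1 hli1 hs1 hw1 hl.cursorW hlp1
          cases restW with
          | nil =>
            refine ⟨_, e.u, ?_, ht.mono le_rfl ?_⟩
            · simp only [List.length_nil, if_true] at hτ ⊢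
              omega
            · rintro m2 ⟨hf2, hfd2, hlp2⟩
              refine ⟨hf2.trans (hf1.trans hf), fun h => absurd (hlp2.symm.trans h) (by simp), fun _ => ⟨le_rfl, ?_⟩⟩
              rw [← hres]
              cases m'.w <;> simp [leftPasses, Mem.result, hfd2, hfd1, hfd]
          | cons w' restW =>
            have hlen : (if w' ∈ P then [] else e.O.restr P w').length ≤ RB := by
              split_ifs with h
              exacts [Nat.zero_le _, (hrestr w' h).1]
            refine ⟨_, ((if w' ∈ P then [] else e.O.restr P w').length * (q + 1) +
              restW.length * (RB * (q + 1) + 1) + 1) * (T + e.u) + restW.length * e.RT + e.u, ?_,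
              ht.mono le_rfl ?_⟩
            · rw [if_neg (by simp)]
              have h3 := Nat.mul_le_mul_right (q + 1) hlen
              have h4 : ((if w' ∈ P then [] else e.O.restr P w').length * (q + 1) + restW.length * (RB * (q + 1) + 1) + 1) * (T + e.u) ≤
                (RB * (q + 1) + restW.length * (RB * (q + 1) + 1) + 1) * (T + e.u) := Nat.mul_le_mul_right _ (by omega)
              simp only [List.length_nil, List.length_cons, Nat.zero_mul, zero_add] at hτ
              have h5 : ((restW.length + 1) * (RB * (q + 1) + 1) + 1) * (T + e.u) =
                (RB * (q + 1) + restW.length * (RB * (q + 1) + 1) + 1) * (T + e.u) + (T + e.u) := by ring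
              have h6 : (restW.length + 1) * e.RT = restW.length * e.RT + e.RT := by ring
              omega
            · rintro m2 ⟨hf2, hfd2, hlp2, hl2, hw2⟩
              refine ⟨hf2.trans (hf1.trans hf), fun _ => ⟨hfd2.trans (hfd1.trans hfd), _, _, _, hl2, ?_, ?_⟩,
                fun h => absurd (hlp2.symm.trans h) (by simp)⟩
              · simp only [List.length_nil, zero_add]; exact le_rfl
              · rw [hw2, ← leftPasses_next, ← hres]
        have hfirst : ∀ {T : ℕ} {Q : Mem n → Prop}, Tri e
            (.instr (.nextList FReg.t.idx SReg.R.idx) ;; .cond FReg.t.idx (Code.ops []).cmd nextWProg)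
              { m' with s := none, t := true } T Q → Tri e ((Code.ops [.nextE .s .R, .nullE .t .s]).cmd ;;
          .cond FReg.t.idx
          (.instr (.nextList FReg.t.idx SReg.R.idx) ;; .cond FReg.t.idx (Code.ops []).cmd nextWProg)
            (refinedPass choose)) m' (4 * e.u + T) Q := by
          intro T Q h
          refine Code.tri_seq (m1 := { m' with s := none, t := true }) (T' := e.u + T) ?_ ?_
            (Tri.cond (fun _ => h) fun h => absurd h (by simp)) ?_
          · simp
          · simp [hnx]
          · simp only [Code.len, List.length_cons, List.length_nil]; omega
        have hlast : restR = [] → (∀ Q : Mem n → Prop, Q ({ m' with s := none, t := false, lister := none }) →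
            Tri e (.instr (.nextList FReg.t.idx SReg.R.idx)) { m' with s := none, t := true } e.u Q) →
            ∃ T' τ', e.u + T' + τ' ≤ τ ∧ Tri e ((Code.ops [.nextE .s .R, .nullE .t .s]).cmd ;;
          .cond FReg.t.idx
          (.instr (.nextList FReg.t.idx SReg.R.idx) ;; .cond FReg.t.idx (Code.ops []).cmd nextWProg)
            (refinedPass choose)) m' T' (fun m' => m'.frame = m.frame ∧
      (m'.lp4 = true → m'.fd = false ∧ ∃ restS restR restW,
        ListCursor e.O.restr P m'.w m'.s m'.R m'.lister restS restR restW ∧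
        (restS.length + restR.length * (q + 1) + restW.length * (RB * (q + 1) + 1) + 1) *
          (T + e.u) + restW.length * e.RT + e.u ≤ τ' ∧
        (leftPasses e.O.restr P m'.w m'.R restS restR restW).findSome?
          (refinedChild e.O.fam e.O.restr P) = res) ∧
      (m'.lp4 = false → e.u ≤ τ' ∧ m'.result = res)) := by
          intro hR hQ
          obtain ⟨TW, τ', h1, h2⟩ := hnext { m' with s := none, t := false, lister := none } rfl rfl rfl rfl rfl hb hR
            (6 * e.u) (by omega)
          refine ⟨4 * e.u + (e.u + (e.u + TW)), τ', by omega, hfirst (Tri.seq (hQ _ (Tri.cond (fun h => absurd h (by simp))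
            fun _ => h2)))⟩
        cases hli : m'.lister with
        | none =>
          have hR : restR = [] := by have := hl.lister; rwa [hli] at this
          refine hlast hR fun Q hQ => tri_nextList.mono le_rfl ?_
          rintro m2 rfl
          simp only [hli, FReg.set] at hQ ⊢
          exact hQ
        | some x =>
          obtain ⟨P', w', i⟩ := x
          rw [hli] at hl
          cases hget : (e.O.restr P' w')[i]? with
          | none =>
            have hR : restR = [] := by
              obtain ⟨-, -, -, rfl⟩ := hl.lister
              obtain ⟨rfl, -⟩ := hl.lister
              rw [List.getElem?_eq_none_iff] at hget
              exact List.drop_eq_nil_of_le hget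
            refine hlast hR fun Q hQ => tri_nextList.mono le_rfl ?_
            rintro m2 rfl
            simp only [hli, hget, FReg.set, Mem.setLister] at hQ ⊢
            exact hQ
          | some R' =>
            obtain ⟨hR, hl'⟩ := hl.stepR hget
            obtain ⟨rfl, hw, hwP, -⟩ := hl.lister
            -- The q + 1 passes reserved for this answer are the present one and those for its at
            -- most q elements.
            have hRq : #R' ≤ q := card_le_rank ((hrestr w' hwP).2 _ (List.mem_of_getElem? hget)).1.1.1
            set restR' := (e.O.restr P w').drop (i + 1) with hrestR'
            have h7 : ((restR'.length + 1) * (q + 1) + restW.length * (RB * (q + 1) + 1) + 1) * (T + e.u) =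
                (q + restR'.length * (q + 1) + restW.length * (RB * (q + 1) + 1) + 1) * (T + e.u) + (T + e.u) := by ring
            have h8 : (#R' + restR'.length * (q + 1) + restW.length * (RB * (q + 1) + 1) + 1) * (T + e.u) ≤
                (q + restR'.length * (q + 1) + restW.length * (RB * (q + 1) + 1) + 1) * (T + e.u) :=
              Nat.mul_le_mul_right _ (by omega)
            refine ⟨_, τ - (e.u + T), ?_, (hfirst (T := T - 4 * e.u) (Tri.seq (T := e.u) (T' := T - 5 * e.u) (tri_nextList.mono le_rfl ?_) |>.le (by omega)))⟩
            · rw [hR] at hτ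
              simp only [List.length_cons] at hτ
              have := h7
              omega
            · rintro m2 rfl
              simp only [hli, hget, FReg.set, SReg.set, Mem.setLister]
              refine (Tri.cond (T := e.u) (fun _ => Code.tri_end ?_ ?_ ?_) (fun h => absurd h (by simp))).le ?_
              · simp
              · simp
              · refine ⟨hf, fun _ => ⟨hfd, _, _, _, hl', ?_, ?_⟩, fun h => absurd (hb.symm.trans h) (by simp)⟩
                · rw [length_sorted]
                  rw [hR] at hτ
                  simp only [List.length_cons] at hτ
                  omega
                · rw [← hres, hR, hw, leftPasses_list]
                  rfl
              · omega
    · rintro k m' ⟨hf, -, h1⟩ hb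
      refine ⟨(h1 hb).1, (tri_wipe m').mono le_rfl ?_⟩
      rintro m'' rfl
      rw [(h1 hb).2, Mem.searched_congr hf]
    · exact ⟨rfl, fun _ => ⟨rfl, restS, restR, restW, hl, le_rfl, rfl⟩, by simp⟩
  · have h4 : (restS.length + restR.length * (q + 1) + restW.length * (RB * (q + 1) + 1) + 1) * (T + e.u) ≤
      (restS.length + restR.length * (q + 1) + restW.length * (RB * (q + 1) + 1) + 1) * (700 * (q * Tc)) :=
      Nat.mul_le_mul_left _ (by omega)
    have h6 : (restS.length + restR.length * (q + 1) + restW.length * (RB * (q + 1) + 1) + 2) * (700 * (q * Tc)) =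
        (restS.length + restR.length * (q + 1) + restW.length * (RB * (q + 1) + 1) + 1) * (700 * (q * Tc)) +
          700 * (q * Tc) := by ring
    simp only [Code.len, List.length_cons, List.length_nil]
    omega

end RefinedSearch

-- Entering and resuming the loop of a solution

section Moves

variable {n : ℕ} {e : Env n} {choose : Cmd 12} {Tc : ℕ}

/-- What is left of the filtered loop is the filtered remainder of the raw loop; thus the search may
be resumed in the raw loop, where the machine has its position. -/
theorem exists_after {α : Type} [DecidableEq α] {l pre rest : List α} {a : α} {p : α → Bool} (hl : l = pre ++ a :: rest)
    (hp : p a = true) (hnd : (l.filter p).Nodup) : after (l.filter p) (some a) = rest.filter p := by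
  have h : l.filter p = pre.filter p ++ a :: rest.filter p := by
    rw [hl, List.filter_append, List.filter_cons, if_pos hp]
  rw [h] at hnd ⊢
  exact after_append hnd

/-- The loop of the basic framework from its beginning. -/
def basicEnter (choose : Cmd 12) : Cmd 12 := (Code.ops [.cpS .C .cur]).cmd ;; basicSearch choose

/-- The loop of the basic framework after the pass that belongs to `S`. -/
def basicResume (choose : Cmd 12) : Cmd 12 :=
  (Code.ops [.cpS .cur .Q, .cpE .w .pi, .cpS .C .core]).cmd ;; basicSearch choose

theorem basicSearch_time {P : Finset (Fin n)} (hP : IsMaxSol e.O.fam P) (hTc : e.u ≤ Tc)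
    (hr : 1 ≤ rank e.O.fam) {l : List (Fin n × Finset (Fin n))}
    (hl : l.length ≤ ((List.finRange n).flatMap (rawPasses P)).length) :
    4 * e.u + (l.length + 2) * (500 * (rank e.O.fam * Tc)) ≤
      2000 * (n * 2 ^ rank e.O.fam * (rank e.O.fam * Tc)) := by
  have h1 : l.length ≤ n * 2 ^ rank e.O.fam := hl.trans ((length_rawPasses_le P).trans
    (Nat.mul_le_mul_left _ (Nat.pow_le_pow_right (by norm_num) (card_le_rank hP.1))))
  have h2 : 1 * Tc ≤ rank e.O.fam * Tc := Nat.mul_le_mul_right _ hr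
  have h3 : 1 * 1 ≤ n * 2 ^ rank e.O.fam :=
    Nat.mul_le_mul (hr.trans (rank_le _)) (Nat.one_le_two_pow)
  have h4 : (l.length + 2) * (500 * (rank e.O.fam * Tc)) ≤
      (3 * (n * 2 ^ rank e.O.fam)) * (500 * (rank e.O.fam * Tc)) := Nat.mul_le_mul_right _ (by omega)
  have h5 : 1 * (rank e.O.fam * Tc) ≤ n * 2 ^ rank e.O.fam * (rank e.O.fam * Tc) :=
    Nat.mul_le_mul_right _ (by omega)
  have h6 : (3 * (n * 2 ^ rank e.O.fam)) * (500 * (rank e.O.fam * Tc)) =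
      1500 * (n * 2 ^ rank e.O.fam * (rank e.O.fam * Tc)) := by ring
  omega

theorem tri_basicEnter (h0 : ∅ ∈ e.O.fam) (hs : StronglyAccessible e.O.fam)
    (hch : ChooseSpec e choose (chooseMin e.O.fam) Tc)
    (hTc : e.u ≤ Tc) (hr : 1 ≤ rank e.O.fam) {m : Mem n} (hP : IsMaxSol e.O.fam m.cur) (hw : m.w = none) :
    Tri e (basicEnter choose) m (2000 * (n * 2 ^ rank e.O.fam * (rank e.O.fam * Tc)))
      (· = m.searched (((basic e.O.fam).iters m.cur).findSome? ((basic e.O.fam).child m.cur))) := by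
  refine Code.tri_seq (m1 := { m with C := m.cur }) ?_ rfl ((tri_basicSearch h0 hs hch hTc hr (by exact hP)
    (l := (List.finRange n).flatMap (rawPasses m.cur)) ?_).mono le_rfl ?_) ?_
  · simp
  · rw [show (Mem.w { m with C := m.cur }) = none from hw]
    exact PassCursor.start _
  · rintro m' rfl
    rw [iters_basic, findSome?_basicChild]
    exact Mem.searched_congr rfl _
  · refine le_trans ?_ (basicSearch_time hP hTc hr le_rfl)
    simp only [Code.len, List.length_cons, List.length_nil]
    omega

theorem tri_basicResume (h0 : ∅ ∈ e.O.fam) (hs : StronglyAccessible e.O.fam)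
    (hn : ∃ X ∈ e.O.fam, X.Nonempty)
    (hch : ChooseSpec e choose (chooseMin e.O.fam) Tc)
    (hTc : e.u ≤ Tc) (hr : 1 ≤ rank e.O.fam) (m : Mem n) {S P : Finset (Fin n)} (hS : IsMaxSol e.O.fam S)
    (hP : (basic e.O.fam).parent S = some P) :
    Tri e (basicResume choose) (m.analyzed e.O.fam (chooseMin e.O.fam) S)
      (2000 * (n * 2 ^ rank e.O.fam * (rank e.O.fam * Tc)))
      (· = Mem.searched { m with cur := P } ((after ((basic e.O.fam).iters P) ((basic e.O.fam).resume S)).findSome?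
        ((basic e.O.fam).child P))) := by
  have hA := sound_basic h0 hn hs
  obtain ⟨hPm, i, hi, hc⟩ := hA.parent_spec S P hS hP
  have hres := (hA.child_spec P i S hPm hi hc).2.2
  obtain ⟨w, C⟩ := i
  have hmem := mem_iters_basic.1 hi
  obtain ⟨pre, l, hl, hcur⟩ := passCursor_of_mem hmem.1.1
  have hpar : parent e.O.fam (chooseMin e.O.fam) S = some P := hP
  have hps : parentSet e.O.fam (chooseMin e.O.fam) S = P := by rw [parentSet, hpar]; rfl
  have hres' : pi e.O.fam (chooseMin e.O.fam) S = some w ∧ core e.O.fam (chooseMin e.O.fam) S = C := by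
    simpa [basic] using hres
  have hbr : branch e.O.fam (chooseMin e.O.fam) S = some w := (branch_of_parent hpar).trans hres'.1
  refine Code.tri_seq (m1 := { m.analyzed e.O.fam (chooseMin e.O.fam) S with cur := P, w := some w, C := C })
    ?_ ?_ ((tri_basicSearch h0 hs hch hTc hr (by exact hPm) (l := l) (by exact hcur)).mono le_rfl ?_) ?_
  · simp
  · simp [Mem.analyzed, hps, hbr, hres'.2]
  · rintro m' rfl
    have hnd := hA.nodup P hPm
    rw [iters_basic] at hnd ⊢
    rw [hres, exists_after hl (by simpa using hmem) hnd, findSome?_basicChild]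
    exact Mem.searched_congr rfl _
  · refine le_trans ?_ (basicSearch_time hPm hTc hr (l := l) ?_)
    · simp only [Code.len, List.length_cons, List.length_nil]
      omega
    · rw [hl]; simp; omega

/-- The loop of the refined framework after the pass that belongs to `S`. -/
def refinedResume (choose : Cmd 12) : Cmd 12 :=
  restrProg choose ;; (Code.ops [.cpS .cur .Q, .cpE .w .pi, .cpE .s .src, .setF .lp2 true]).cmd ;;
  .instr (.startList SReg.cur.idx EReg.w.idx) ;;
  .loop FReg.lp2.idx (.instr (.nextList FReg.t.idx SReg.R.idx) ;;
    (Code.seq (.ops [.eqS .t .R .rs]) (.ite .t (.ops [.setF .lp2 false]) (.ops []))).cmd) ;;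
  refinedSearch choose

theorem refinedSearch_time (hTc : e.u ≤ Tc) (hr : 1 ≤ rank e.O.fam) {RB a b c : ℕ} (hRB : 1 ≤ RB)
    (ha : a ≤ rank e.O.fam) (hb : b ≤ RB) (hc : c ≤ n) :
    RB * (10 * e.u) + 100 * (rank e.O.fam * Tc) + (a + b * (rank e.O.fam + 1) + c * (RB * (rank e.O.fam + 1) + 1) + 2) *
        (700 * (rank e.O.fam * Tc)) + c * e.RT ≤
      6000 * (n * RB * rank e.O.fam * (rank e.O.fam * Tc)) + n * e.RT := by
  set q := rank e.O.fam with hq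
  have hn : 1 ≤ n := hr.trans (rank_le _)
  have h2 : 1 * Tc ≤ q * Tc := Nat.mul_le_mul_right _ hr
  have h1 : 1 ≤ n * RB * q := Nat.mul_pos (Nat.mul_pos hn hRB) hr
  have h3 : 1 * (q * Tc) ≤ n * RB * q * (q * Tc) := Nat.mul_le_mul_right _ h1
  have h4 : RB ≤ n * RB * q := by nlinarith [Nat.mul_le_mul hn (le_refl RB)]
  have h5 : RB * (10 * e.u) ≤ (n * RB * q) * (10 * (q * Tc)) := Nat.mul_le_mul h4 (by omega)
  have h6 : b * (q + 1) ≤ RB * (2 * q) := Nat.mul_le_mul hb (by omega)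
  have h7 : RB * (2 * q) ≤ 2 * (n * RB * q) := by nlinarith [Nat.mul_le_mul hn (le_refl (RB * q))]
  have h8 : q ≤ n * RB * q := by nlinarith [Nat.mul_le_mul (Nat.mul_le_mul hn hRB) (le_refl q)]
  have h9 : RB * (q + 1) + 1 ≤ 3 * (RB * q) := by
    have := Nat.mul_le_mul_left RB hr
    have := Nat.mul_le_mul hRB hr
    rw [Nat.mul_succ]; omega
  have h10 : c * (RB * (q + 1) + 1) ≤ n * (3 * (RB * q)) := Nat.mul_le_mul hc h9
  have h11 : n * (3 * (RB * q)) = 3 * (n * RB * q) := by ring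
  have h12 : (a + b * (q + 1) + c * (RB * (q + 1) + 1) + 2) * (700 * (q * Tc)) ≤
      (8 * (n * RB * q)) * (700 * (q * Tc)) := Nat.mul_le_mul_right _ (by omega)
  have h13 : (8 * (n * RB * q)) * (700 * (q * Tc)) = 5600 * (n * RB * q * (q * Tc)) := by ring
  have h14 : (n * RB * q) * (10 * (q * Tc)) = 10 * (n * RB * q * (q * Tc)) := by ring
  have h15 := Nat.mul_le_mul_right e.RT hc
  omega

theorem tri_refinedEnter (h0 : ∅ ∈ e.O.fam) (hs : StronglyAccessible e.O.fam)
    (hn : ∃ X ∈ e.O.fam, X.Nonempty)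
    (hch : ChooseSpec e choose (chooseLay e.O.fam) Tc)
    (hTc : e.u ≤ Tc) (hr : 1 ≤ rank e.O.fam) {RB : ℕ} (hRB : 1 ≤ RB)
    (hmay : ∀ P w, IsMaxSol e.O.fam P → w ∉ P → e.may P w)
    (hrestr : ∀ P w, IsMaxSol e.O.fam P → w ∉ P → (e.O.restr P w).length ≤ RB ∧ ∀ R ∈ e.O.restr P w,
      Maximal (fun X => X ∈ e.O.fam ∧ X ⊆ insert w P) R ∧ R ≠ P)
    (t : Node n) (hP : IsMaxSol e.O.fam t.cur) :
    Tri e (refinedSearch choose) (Mem.ofNode t)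
      (6000 * (n * RB * rank e.O.fam * (rank e.O.fam * Tc)) + (n + 1) * e.RT)
      (· = (Mem.ofNode t).searched (((refined e.O.fam e.O.restr).iters t.cur).findSome?
        ((refined e.O.fam e.O.restr).child t.cur))) := by
  refine (tri_refinedSearch (m := Mem.ofNode t) h0 hs hn hch hTc hr hP (fun w => hmay _ w hP) (fun w => hrestr _ w hP)
    (ListCursor.start t.cur)).mono ?_ ?_
  · have := refinedSearch_time (a := 0) (b := 0) (c := n) hTc hr hRB (Nat.zero_le _) (Nat.zero_le _) le_rfl
    simp only [List.length_nil, List.length_finRange]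
    rw [Nat.add_mul n 1]
    omega
  · rintro m' rfl
    rw [iters_refined, findSome?_refinedChild]
    rfl

/-- The position of the lister is not remembered. Its list depends only on (P, w), so it is produced
again and its answers are discarded until r(S) appears; the remainder is the one that was
interrupted. This is one additional run of a lister, whence the factor n + 1. -/
theorem tri_refinedResume (h0 : ∅ ∈ e.O.fam) (hs : StronglyAccessible e.O.fam)
    (hn : ∃ X ∈ e.O.fam, X.Nonempty) (hcomm : Commutable e.O.fam)
    (hrs : RestrSpec e.O.fam e.O.restr)
    (hch : ChooseSpec e choose (chooseLay e.O.fam) Tc)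
    (hTc : e.u ≤ Tc) (hr : 1 ≤ rank e.O.fam) {RB : ℕ} (hRB : 1 ≤ RB)
    (hmay : ∀ P w, IsMaxSol e.O.fam P → w ∉ P → e.may P w)
    (hrestr : ∀ P w, IsMaxSol e.O.fam P → w ∉ P → (e.O.restr P w).length ≤ RB ∧ ∀ R ∈ e.O.restr P w,
      Maximal (fun X => X ∈ e.O.fam ∧ X ⊆ insert w P) R ∧ R ≠ P)
    (m : Mem n) {S P : Finset (Fin n)} (hS : IsMaxSol e.O.fam S)
    (hP : (refined e.O.fam e.O.restr).parent S = some P) :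
    Tri e (refinedResume choose) (m.analyzed e.O.fam (chooseLay e.O.fam) S)
      (6000 * (n * RB * rank e.O.fam * (rank e.O.fam * Tc)) + (n + 1) * e.RT)
      (· = Mem.searched { m with cur := P } ((after ((refined e.O.fam e.O.restr).iters P)
        ((refined e.O.fam e.O.restr).resume S)).findSome? ((refined e.O.fam e.O.restr).child P))) := by
  have K := keyChooser_chooseLay h0 hs
  have hA := sound_refined h0 hn hs hcomm hrs
  obtain ⟨hPm, i, hi, hc⟩ := hA.parent_spec S P hS hP
  have hres := (hA.child_spec P i S hPm hi hc).2.2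
  obtain ⟨w, R, s⟩ := i
  have hmem := mem_iters_refined.1 hi
  obtain ⟨hw, hR, hRP, hsR, hsF, hsw⟩ := hmem
  have hpar : parent e.O.fam (chooseLay e.O.fam) S = some P := hP
  have hps : parentSet e.O.fam (chooseLay e.O.fam) S = P := by rw [parentSet, hpar]; rfl
  have hres' : pi e.O.fam (chooseLay e.O.fam) S = some w ∧ rSol e.O.fam (chooseLay e.O.fam) S = some R ∧
      source e.O.fam S = some s := by
    simp only [refined] at hres
    split at hres
    · rename_i h1 h2 h3
      cases hres
      exact ⟨h1, h2, h3⟩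
    · cases hres
  obtain ⟨hpi, hrS, hsrc⟩ := hres'
  have hbr : branch e.O.fam (chooseLay e.O.fam) S = some w := (branch_of_parent hpar).trans hpi
  have h2 : 1 * Tc ≤ rank e.O.fam * Tc := Nat.mul_le_mul_right _ hr
  obtain ⟨preW, restW, hW⟩ := List.append_of_mem (List.mem_finRange w)
  obtain ⟨preS, restS, hSs⟩ := List.append_of_mem (mem_sorted.2 hsR)
  set m3 : Mem n := { (m.analyzed e.O.fam (chooseLay e.O.fam) S).completed ∅ with
    rs := R
    cur := P
    w := some w
    s := some s
    lp2 := true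
    A := ∅
    ua := false
    ws := none } with hm3
  have hlen := (hrestr P w hPm hw).1
  unfold refinedResume
  refine Tri.call_le (T' := 5 * e.u + (e.u + e.RT + (RB * (9 * e.u + e.u) + e.u +
      ((restS.length + RB * (rank e.O.fam + 1) + restW.length * (RB * (rank e.O.fam + 1) + 1) + 2) *
        (700 * (rank e.O.fam * Tc)) + restW.length * e.RT))))
    (tri_restrProg h0 hs hn K hch hTc hr hS hpar hpi hrS (by rfl) (by exact hps) (by exact hbr)) ?_ ?_
  · refine Code.tri_seq (m1 := m3) (T' := e.u + e.RT + (RB * (9 * e.u + e.u) + e.u +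
      ((restS.length + RB * (rank e.O.fam + 1) + restW.length * (RB * (rank e.O.fam + 1) + 1) + 2) *
        (700 * (rank e.O.fam * Tc)) + restW.length * e.RT))) ?_ ?_ ?_ (by simp [Code.len])
    · simp
    · simp [Mem.analyzed, Mem.completed, hps, hbr, hsrc, hm3]
    · refine Tri.call (tri_startList ?_) ?_
      · intro a ha
        obtain rfl : w = a := Option.some.inj ha
        exact hmay _ _ hPm hw
      -- While the loop goes on, r(S) is still among the answers to come, so it is met before the
      -- list ends.
      · refine Tri.seq (((Tri.loop_count (b := .lp2) (k := (e.O.restr P w).length) (fun k m' => ∃ i b tv Rv,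
          m' = { m3 with R := Rv, lister := some (P, w, i), t := tv, lp2 := b } ∧
          (b = true → i + k = (e.O.restr P w).length ∧ R ∈ (e.O.restr P w).drop i) ∧
          (b = false → Rv = R ∧ ∃ pre, e.O.restr P w = pre ++ R :: (e.O.restr P w).drop i)) (9 * e.u) ?_ ?_ ?_)).le ?_)
        · rintro k m' ⟨i, b, tv, Rv, rfl, h1, -⟩ hb
          replace hb : b = true := hb
          subst hb
          obtain ⟨hk, hRi⟩ := h1 rfl
          have hi : i < (e.O.restr P w).length := by
            by_contra h
            rw [List.drop_eq_nil_of_le (not_lt.1 h)] at hRi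
            simp at hRi
          rw [List.drop_eq_getElem_cons hi] at hRi
          refine ⟨k - 1, by omega, (Tri.call (m1 := { m3 with
            R := (e.O.restr P w)[i], lister := some (P, w, i + 1), t := true, lp2 := true }) (tri_nextList.mono le_rfl ?_)
            (Code.tri_end (T := 6 * e.u) ?_ ?_ ?_)).le (by omega)⟩
          · rintro m' rfl
            simp [List.getElem?_eq_getElem hi, Mem.setLister]
          · simp
          · exact Nat.mul_le_mul_right _ (by simp [Code.len])
          · by_cases h : (e.O.restr P w)[i] = R
            · refine ⟨i + 1, false, true, R, ?_, by simp, fun _ => ⟨rfl, (e.O.restr P w).take i, ?_⟩⟩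
              · simp [h, hm3]
              · conv_lhs => rw [← List.take_append_drop i (e.O.restr P w), List.drop_eq_getElem_cons hi, h]
            · refine ⟨i + 1, true, false, (e.O.restr P w)[i], ?_, fun _ => ⟨by omega, ?_⟩, by simp⟩
              · simp [h, hm3]
              · rcases List.mem_cons.1 hRi with h' | h'
                exacts [absurd h'.symm h, h']
        · rintro k m' ⟨i, b, tv, Rv, rfl, -, h1⟩ hb
          obtain ⟨rfl, pre, hpre⟩ := h1 hb
          have hcur : ListCursor e.O.restr P (some w) (some s) Rv (some (P, w, i)) restS ((e.O.restr P w).drop i) restW :=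
            ⟨⟨preS ++ [s], by simp [hSs], by simp⟩, ⟨preW ++ [w], by simp [hW], by simp⟩, ⟨rfl, rfl, hw, rfl⟩,
              fun x hx => ⟨w, rfl, hw, hR, by rw [← mem_sorted, hSs]; simp [hx]⟩⟩
          refine (tri_refinedSearch h0 hs hn hch hTc hr (by exact hPm) (by exact fun w => hmay _ w hPm)
            (by exact fun w => hrestr _ w hPm) (by exact hcur)).mono ?_ ?_
          · gcongr
            rw [List.length_drop]; omega
          · rintro m' rfl
            -- The raw loop is split at the pass of S on three levels: at w, at r(S) within the list
            -- for w, and at the source within r(S).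
            have hraw : (List.finRange n).flatMap (rawRefined e.O.restr P) =
                (preW.flatMap (rawRefined e.O.restr P) ++ (pre.flatMap fun R => (sorted R).map fun s => (w, R, s)) ++
                  preS.map fun s => (w, Rv, s)) ++ (w, Rv, s) :: leftPasses e.O.restr P (some w) Rv restS
                    ((e.O.restr P w).drop i) restW := by
              rw [hW, List.flatMap_append, List.flatMap_cons]
              have : rawRefined e.O.restr P w = (pre.flatMap fun R => (sorted R).map fun s => (w, R, s)) ++
                  (preS.map (fun s => (w, Rv, s)) ++ (w, Rv, s) :: (restS.map (fun s => (w, Rv, s)) ++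
                    ((e.O.restr P w).drop i).flatMap fun R => (sorted R).map fun s => (w, R, s))) := by
                rw [rawRefined, if_neg hw]
                conv_lhs => rw [hpre]
                simp [hSs]
              rw [this]
              simp [leftPasses]
            have hnd := hA.nodup P hPm
            rw [iters_refined] at hnd ⊢
            rw [hres, exists_after hraw (by simpa using ⟨hRP, hsw, hsF⟩) hnd, findSome?_refinedChild]
            exact Mem.searched_congr rfl _
        · exact ⟨0, true, m3.t, m3.R, rfl, fun _ => ⟨by simp, by simpa using hR⟩, by simp⟩
        · gcongr
  · have hS1 : restS.length ≤ rank e.O.fam := by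
      have h1 := congrArg List.length hSs
      have h2 := card_le_rank ((hrestr P w hPm hw).2 R hR).1.1.1
      rw [length_sorted] at h1
      simp at h1
      omega
    have hW1 : restW.length ≤ n := by
      have h1 := congrArg List.length hW
      simp at h1
      omega
    have := refinedSearch_time hTc hr hRB hS1 (le_refl RB) hW1
    rw [Nat.add_mul n 1]
    have h9 : RB * (9 * e.u + e.u) = RB * (10 * e.u) := by ring
    omega

end Moves

-- One move of the traversal and the assembled program

section Body

variable {n : ℕ} {ι : Type} {e : Env n} {choose enter resume : Cmd 12} {ch : Chooser n} {Tc TS : ℕ}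
  {key : Finset (Fin n) → Fin n → ℕ ×ₗ Fin n} {A : Scheme n ι}

/-- The memory that holds a state of the traversal. -/
def Mem.ofState : Option (Node n) → Mem n
  | none => Mem.blank n
  | some t => Mem.ofNode t

theorem encode_eq_ofState (t : Option (Node n)) : encode 9 t = (Mem.ofState t).toStore := by
  cases t with
  | none => exact encode_none
  | some t => exact encode_some t

theorem good_ofState {t : Option (Node n)} (ht : ∀ s ∈ t, s.cur ∈ e.O.fam) :
    e.Good (Mem.ofState t).toStore := by
  rw [← encode_eq_ofState]
  cases t with
  | none => exact ⟨fun s => by simp [encode], fun P w i h => by simp [encode] at h⟩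
  | some t =>
    refine ⟨fun s => ?_, fun P w i h => by simp [encode] at h⟩
    have := card_le_rank (ht t rfl)
    simp only [encode]
    split_ifs
    · omega
    · simp

/-- Moving down, or turning around. -/
def enterTail : Code :=
  .ite .fd
    (.seq (.ops [.cpS .cur .S, .clrS .S, .setF .fd false])
      (.ite .od (.ops [.setF .od false]) (.ops [.setF .od true])))
    (.ops [.setF .lv true])

/-- Moving to a sibling, or to the parent. -/
def resumeTail : Code :=
  .ite .fd
    (.ops [.cpS .cur .S, .clrS .S, .setF .fd false, .setF .lv false])
    (.ite .od (.ops [.setF .od false]) (.ops [.setF .od true]))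

/-- Moving to another root, or stopping. -/
def rootsTail : Code :=
  .ite .fd
    (.ops [.cpS .cur .S, .clrS .S, .setF .fd false, .setF .lv false])
    (.ops [.setF .go false, .setF .lv false, .setF .od false, .clrS .cur])

/-- Moving to the first root. -/
def startTail : Code :=
  .ite .fd (.ops [.setF .go true, .cpS .cur .S, .clrS .S, .setF .fd false]) (.ops [])

/-- One move of the traversal. -/
def moveProg (choose enter resume : Cmd 12) : Cmd 12 :=
  .cond FReg.lv.idx
    ((Code.ops [.cpS .S .cur]).cmd ;; analyzeProg choose ;; (Code.ops [.nullE .t .pi]).cmd ;;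
      .cond FReg.t.idx
        ((Code.ops [.cpE .z0 .src, .setF .t false]).cmd ;; rootProg choose ;; rootsTail.cmd)
        (resume ;; resumeTail.cmd))
    (enter ;; enterTail.cmd)

/-- The first node of the traversal. -/
def setupProg (choose : Cmd 12) : Cmd 12 := rootProg choose ;; startTail.cmd

/-- The output of a move. -/
def emitProg : Cmd 12 :=
  .cond FReg.lv.idx
    (.cond FReg.od.idx (.instr .stopList) (.instr (.output SReg.cur.idx)))
    (.cond FReg.od.idx (.instr (.output SReg.cur.idx)) (.instr .stopList))

theorem exec_enterTail (F : Finset (Finset (Fin n))) (t : Node n) (ht : t.leaving = false)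
    (res : Option (Finset (Fin n))) :
    enterTail.exec F ((Mem.ofNode t).searched res) = Mem.ofState (match res with
      | some S => some ⟨S, false, !t.odd⟩
      | none => some ⟨t.cur, true, t.odd⟩) := by
  obtain ⟨S, lv, od⟩ := t
  simp only at ht
  subst ht
  cases res <;> cases od <;> simp [enterTail, Mem.ofState, Mem.ofNode, Mem.searched, Mem.blank]

theorem exec_resumeTail (F : Finset (Finset (Fin n))) (t : Node n) (ht : t.leaving = true)
    (P : Finset (Fin n)) (res : Option (Finset (Fin n))) :
    resumeTail.exec F (Mem.searched { Mem.ofNode t with cur := P } res) = Mem.ofState (match res with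
      | some S => some ⟨S, false, t.odd⟩
      | none => some ⟨P, true, !t.odd⟩) := by
  obtain ⟨S, lv, od⟩ := t
  simp only at ht
  subst ht
  cases res <;> cases od <;> simp [resumeTail, Mem.ofState, Mem.ofNode, Mem.searched, Mem.blank]

theorem exec_rootsTail (F : Finset (Finset (Fin n))) (t : Node n) (res : Option (Finset (Fin n))) :
    rootsTail.exec F ((Mem.ofNode t).searched res) =
      Mem.ofState (res.map fun R => ⟨R, false, t.odd⟩) := by
  cases res <;> simp [rootsTail, Mem.ofState, Mem.ofNode, Mem.searched, Mem.blank]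

theorem exec_startTail (F : Finset (Finset (Fin n))) (res : Option (Finset (Fin n))) :
    startTail.exec F ((Mem.blank n).searched res) =
      Mem.ofState (res.map fun R => ⟨R, false, false⟩) := by
  cases res <;> simp [startTail, Mem.ofState, Mem.ofNode, Mem.searched, Mem.blank]

theorem cursor_source {z : Fin n} : Cursor (List.finRange n) (some z) (after (List.finRange n) (some z)) := by
  obtain ⟨pre, rest, h⟩ := List.append_of_mem (List.mem_finRange z)
  have hnd := List.nodup_finRange n
  rw [h] at hnd ⊢
  rw [after_append hnd]
  exact ⟨pre ++ [z], by simp, by simp⟩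

/-- Common to both frameworks: the analysis of the current solution and the search for roots depend
on the scheme only through the chooser, while the two searches for children enter as hypotheses. -/
theorem tri_move [DecidableEq ι] (h0 : ∅ ∈ e.O.fam) (hs : StronglyAccessible e.O.fam)
    (hn : ∃ X ∈ e.O.fam, X.Nonempty)
    (K : KeyChooser e.O.fam ch key) (hch : ChooseSpec e choose ch Tc)
    (hTc : e.u ≤ Tc) (hr : 1 ≤ rank e.O.fam) (hroot : A.root = rootAt e.O.fam ch)
    (hparent : A.parent = parent e.O.fam ch) (hsource : A.source = source e.O.fam)
    (henter : ∀ t : Node n, IsMaxSol e.O.fam t.cur → Tri e enter (Mem.ofNode t) TS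
      (· = (Mem.ofNode t).searched ((A.iters t.cur).findSome? (A.child t.cur))))
    (hresume : ∀ (m : Mem n) (S P : Finset (Fin n)), IsMaxSol e.O.fam S → A.parent S = some P →
      Tri e resume (m.analyzed e.O.fam ch S) TS
        (· = Mem.searched { m with cur := P } ((after (A.iters P) (A.resume S)).findSome? (A.child P))))
    (t : Node n) (ht : IsMaxSol e.O.fam t.cur) :
    Tri e (moveProg choose enter resume) (Mem.ofNode t) (TS + 1400 * (n * (rank e.O.fam * Tc)))
      (· = Mem.ofState (A.next t)) := by
  have h2 : 1 * Tc ≤ rank e.O.fam * Tc := Nat.mul_le_mul_right _ hr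
  have h3 : 1 * (rank e.O.fam * Tc) ≤ n * (rank e.O.fam * Tc) := Nat.mul_le_mul_right _ (hr.trans (rank_le _))
  have hne := ht.nonempty hn
  obtain ⟨s, hsrc⟩ := exists_source h0 hs ht.1 hne
  have hbr := branch_eq_none_iff K hs ht hsrc
  refine Tri.cond_le (T := TS + 1399 * (n * (rank e.O.fam * Tc))) (fun hl => ?_) (fun hl => ?_) (by omega)
  · replace hl : t.leaving = true := hl
    set m1 : Mem n := { Mem.ofNode t with S := t.cur } with hm1
    refine Code.tri_seq (m1 := m1) ?_ (by simp [hm1, Mem.ofNode]) (Tri.call_le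
      (tri_analyze h0 hs K hch hTc (m := m1) ht hne)
      (Code.tri_seq (m1 := { m1.analyzed e.O.fam ch t.cur with t := (branch e.O.fam ch t.cur).isNone })
        ?_ (by simp [Mem.analyzed, hm1]) (Tri.cond_le (T := TS + 1090 * (n * (rank e.O.fam * Tc)))
          (fun hb => ?_) (fun hb => ?_) le_rfl) le_rfl) le_rfl) ?_
    · simp
    · simp
    · replace hb : (branch e.O.fam ch t.cur).isNone = true := hb
      rw [Option.isNone_iff_eq_none, hbr] at hb
      refine Code.tri_seq (m1 := { m1.analyzed e.O.fam ch t.cur with z0 := some s, t := false }) ?_ ?_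
        (Tri.call_le (tri_rootProg h0 hs K hch hTc hr (by exact cursor_source)) (Code.tri_end ?_ le_rfl ?_) le_rfl) ?_
      · simp
      · simp [Mem.analyzed, hsrc]
      · simp [rootsTail]
      · refine (congrArg _ (Mem.searched_congr rfl _)).trans ((exec_rootsTail _ t _).trans ?_)
        simp only [Scheme.next, hl, if_true, hparent, hb, hsource, hsrc, hroot]
      · simp [rootsTail]
        omega
    · replace hb : (branch e.O.fam ch t.cur).isNone = false := hb
      obtain ⟨P, hP⟩ : ∃ P, parent e.O.fam ch t.cur = some P := by
        cases hp : parent e.O.fam ch t.cur with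
        | none => rw [hbr.2 hp] at hb; cases hb
        | some P => exact ⟨P, rfl⟩
      have hm : ({ m1.analyzed e.O.fam ch t.cur with t := (branch e.O.fam ch t.cur).isNone } : Mem n) =
          m1.analyzed e.O.fam ch t.cur := by
        rw [hb]; rfl
      rw [hm]
      refine Tri.call_le (hresume m1 t.cur P ht (hparent ▸ hP)) (Code.tri_end ?_ le_rfl ?_) ?_
      · simp [resumeTail]
      · refine (congrArg _ (Mem.searched_congr rfl _)).trans ((exec_resumeTail _ t hl P _).trans ?_)
        cases h : (after (A.iters P) (A.resume t.cur)).findSome? (A.child P) <;>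
          simp [Scheme.next, hl, hparent, hP, h]
      · simp [resumeTail]
        omega
    · simp
      omega
  · replace hl : t.leaving = false := hl
    refine Tri.call_le (henter t ht) (Code.tri_end ?_ le_rfl ?_) ?_
    · simp [enterTail]
    · rw [exec_enterTail _ _ hl]
      cases h : (A.iters t.cur).findSome? (A.child t.cur) <;> simp [Scheme.next, hl, h]
    · simp [enterTail]
      omega

theorem tri_setup (h0 : ∅ ∈ e.O.fam) (hs : StronglyAccessible e.O.fam)
    (K : KeyChooser e.O.fam ch key) (hch : ChooseSpec e choose ch Tc)
    (hTc : e.u ≤ Tc) (hr : 1 ≤ rank e.O.fam) (hroot : A.root = rootAt e.O.fam ch) :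
    Tri e (setupProg choose) (Mem.blank n) (1010 * (n * (rank e.O.fam * Tc)))
      (· = Mem.ofState A.start) := by
  have h2 : 1 * Tc ≤ rank e.O.fam * Tc := Nat.mul_le_mul_right _ hr
  have h3 : 1 * (rank e.O.fam * Tc) ≤ n * (rank e.O.fam * Tc) := Nat.mul_le_mul_right _ (hr.trans (rank_le _))
  refine Tri.call_le (tri_rootProg h0 hs K hch hTc hr (Cursor.start _)) (Code.tri_end ?_ le_rfl ?_) ?_
  · simp [startTail]
  · rw [exec_startTail, Scheme.start, hroot]
  · simp [startTail]
    omega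

/-- The output precedes the move, as the node is overwritten by it. `stopList` serves as a no-op: no
lister is active between two passes. -/
theorem exec_emit (A : Scheme n ι) (t : Node n) (ht : t.cur ∈ e.O.fam) :
    ∃ tr, Exec e.O emitProg (Mem.ofNode t).toStore tr (Mem.ofNode t).toStore ∧
      outputs tr = A.emit t ∧ duration tr ≤ 3 * e.u ∧ SpaceLE tr e.B := by
  have hg : e.Good (Mem.ofNode t).toStore := good_ofState (t := some t) (by simpa using ht)
  have hu := e.size_le
  have hw := hg.words_le
  obtain ⟨-, s2, s3⟩ := hg.instr (i := .stopList) trivial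
  obtain ⟨-, o2, o3⟩ := hg.instr (i := .output SReg.cur.idx) trivial
  have hlv : (Mem.ofNode t).toStore.flag FReg.lv.idx = t.leaving := flag_toStore _ .lv
  have hod : (Mem.ofNode t).toStore.flag FReg.od.idx = t.odd := flag_toStore _ .od
  have hsame : Instr.eval e.O (Mem.ofNode t).toStore .stopList = (Mem.ofNode t).toStore := rfl
  have hcur : (Mem.ofNode t).toStore.fset SReg.cur.idx = t.cur := fset_toStore _ .cur
  have hexit := Exec.instr (O := e.O) .stopList (Mem.ofNode t).toStore
  rw [hsame] at hexit
  have hout := Exec.instr (O := e.O) (.output SReg.cur.idx) (Mem.ofNode t).toStore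
  have key : ∀ i : Instr 12, i.time e.O (Mem.ofNode t).toStore ≤ e.u → i.space e.O (Mem.ofNode t).toStore ≤ e.B →
      duration [⟨1, (Mem.ofNode t).toStore.words e.O, none⟩, ⟨1, (Mem.ofNode t).toStore.words e.O, none⟩,
        i.event e.O (Mem.ofNode t).toStore] ≤ 3 * e.u ∧
      SpaceLE [⟨1, (Mem.ofNode t).toStore.words e.O, none⟩, ⟨1, (Mem.ofNode t).toStore.words e.O, none⟩,
        i.event e.O (Mem.ofNode t).toStore] e.B := by
    intro i h1 h2
    constructor
    · simp only [duration, Instr.event, List.map_cons, List.map_nil, List.sum_cons, List.sum_nil]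
      omega
    · intro x hx
      simp only [List.mem_cons, List.not_mem_nil, or_false] at hx
      rcases hx with rfl | rfl | rfl
      · simp only; omega
      · simp only; omega
      · exact h2
  have hl : (Mem.ofNode t).toStore.lister = none := rfl
  have ks := key _ (by rw [hsame, hl] at s2; simpa [Env.cost, Env.pot] using s2) s3
  have ko := key _ (by simpa [Env.cost, Env.pot, hl, Instr.eval] using o2) o3
  cases h1 : t.leaving <;> cases h2 : t.odd <;> rw [h1] at hlv <;> rw [h2] at hod
  · exact ⟨_, .condFalse _ _ _ _ _ _ hlv (.condFalse _ _ _ _ _ _ hod hexit),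
      by simp [outputs, Instr.event, Scheme.emit, h1, h2], ks⟩
  · exact ⟨_, .condFalse _ _ _ _ _ _ hlv (.condTrue _ _ _ _ _ _ hod hout),
      by simp [outputs, Instr.event, Scheme.emit, h1, h2, hcur], ko⟩
  · exact ⟨_, .condTrue _ _ _ _ _ _ hlv (.condFalse _ _ _ _ _ _ hod hout),
      by simp [outputs, Instr.event, Scheme.emit, h1, h2, hcur], ko⟩
  · exact ⟨_, .condTrue _ _ _ _ _ _ hlv (.condTrue _ _ _ _ _ _ hod hexit),
      by simp [outputs, Instr.event, Scheme.emit, h1, h2], ks⟩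

/-- The stateless version from its parts. -/
theorem statelessVersion [DecidableEq ι] (h0 : ∅ ∈ e.O.fam) (hs : StronglyAccessible e.O.fam)
    (hn : ∃ X ∈ e.O.fam, X.Nonempty)
    (K : KeyChooser e.O.fam ch key) (hch : ChooseSpec e choose ch Tc)
    (hTc : e.u ≤ Tc) (hr : 1 ≤ rank e.O.fam) (hA : A.Sound (IsMaxSol e.O.fam)) (hroot : A.root = rootAt e.O.fam ch)
    (hparent : A.parent = parent e.O.fam ch) (hsource : A.source = source e.O.fam)
    (henter : ∀ t : Node n, IsMaxSol e.O.fam t.cur → Tri e enter (Mem.ofNode t) TS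
      (· = (Mem.ofNode t).searched ((A.iters t.cur).findSome? (A.child t.cur))))
    (hresume : ∀ (m : Mem n) (S P : Finset (Fin n)), IsMaxSol e.O.fam S → A.parent S = some P →
      Tri e resume (m.analyzed e.O.fam ch S) TS
        (· = Mem.searched { m with cur := P } ((after (A.iters P) (A.resume S)).findSome? (A.child P))))
    {D B : ℕ} (hD : 3 * (TS + 1404 * (n * (rank e.O.fam * Tc))) ≤ D) (hB : e.B ≤ B) :
    StatelessVersion (k := 9) A e.O (setupProg choose) (emitProg ;; moveProg choose enter resume) D B := by
  have h2 : 1 * Tc ≤ rank e.O.fam * Tc := Nat.mul_le_mul_right _ hr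
  have h3 : 1 * (rank e.O.fam * Tc) ≤ n * (rank e.O.fam * Tc) := Nat.mul_le_mul_right _ (hr.trans (rank_le _))
  have hu := e.size_le
  obtain ⟨tr0, m0, a1, a2, a3, a4, a5, rfl⟩ := tri_setup h0 hs K hch hTc hr hroot
    (good_ofState (t := (none : Option (Node n))) (by simp))
  have hmove : ∀ t : Node n, IsMaxSol e.O.fam t.cur → ∃ tr,
      Exec e.O (emitProg ;; moveProg choose enter resume) (encode 9 (some t)) tr (encode 9 (A.next t)) ∧
      outputs tr = A.emit t ∧ duration tr ≤ TS + 1403 * (n * (rank e.O.fam * Tc)) ∧ SpaceLE tr e.B := by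
    intro t ht
    obtain ⟨tr1, b1, b2, b3, b4⟩ := exec_emit A t ht.1
    obtain ⟨tr2, m2, c1, c2, c3, c4, c5, rfl⟩ :=
      tri_move h0 hs hn K hch hTc hr hroot hparent hsource henter hresume t ht
        (good_ofState (t := some t) (by simpa using ht.1))
    refine ⟨tr1 ++ tr2, ?_, ?_, ?_, b4.append c4⟩
    · rw [encode_eq_ofState, encode_eq_ofState]
      exact .seq _ _ _ _ _ _ _ b1 c1
    · rw [outputs_append, b2, c2, List.append_nil]
    · rw [duration_append]
      have : e.pot (Mem.ofNode t).lister = 0 := rfl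
      omega
  have hd0 : duration tr0 ≤ 1010 * (n * (rank e.O.fam * Tc)) := by
    have : e.pot (Mem.blank n).lister = 0 := rfl
    omega
  have hstart : Exec e.O (setupProg choose) (encode 9 none) tr0 (encode 9 A.start) := by
    rw [encode_eq_ofState, encode_eq_ofState]
    exact a1
  have hwords : ∀ t : Option (Node n), (∀ s ∈ t, s.cur ∈ e.O.fam) → (encode 9 t).words e.O ≤ e.B := fun t ht => by
    have := (good_ofState ht).words_le
    rw [encode_eq_ofState]; omega
  refine ⟨⟨tr0, hstart, a2⟩, fun t ht => ?_, ?_⟩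
  · obtain ⟨tr, g1, g2, -⟩ := hmove t ht
    exact ⟨tr, g1, g2⟩
  · obtain ⟨out, f1, f2, f3, f4⟩ := hA.run
    suffices ∃ tr, Exec e.O (.loop 0 (emitProg ;; moveProg choose enter resume)) (encode 9 A.start) tr
        (encode 9 none) ∧ outputs tr = out ∧ SpaceLE tr e.B ∧
        HeadLE tr (2 * (TS + 1403 * (n * (rank e.O.fam * Tc)) + 1)) ∧
        DelayLE tr (3 * (TS + 1403 * (n * (rank e.O.fam * Tc)) + 1)) by
      obtain ⟨tr, g1, g2, g3, g4, g5⟩ := this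
      have hout : outputs (tr0 ++ tr) = out := by rw [outputs_append, a2, g2]; rfl
      refine ⟨tr0 ++ tr, .seq _ _ _ _ _ _ _ hstart g1, ?_⟩
      rw [hout]
      refine ⟨f1, f2, f3, fun blk h h' => ?_, fun x hx => (a4.append g3 x hx).trans hB⟩
      -- The setup is no longer than one move, so the time up to the first output is also covered by
      -- three passes.
      exact (DelayLE.append hd0 g4 (by omega) g5 blk h h').trans (by omega)
    cases hst : A.start with
    | none =>
      rw [hst] at f4
      refine ⟨_, .loopStop _ _ _ (by simp [encode]), ?_, ?_, ?_, ?_⟩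
      · subst f4; rfl
      · intro x hx
        rw [List.mem_singleton] at hx
        subst hx
        exact hwords none (by simp)
      · intro p hp _
        have := duration_le_of_sublist hp.sublist
        simp only [duration, List.map_cons, List.map_nil, List.sum_cons, List.sum_nil] at this
        omega
      · intro p hp _
        have := duration_le_of_sublist hp.sublist
        simp only [duration, List.map_cons, List.map_nil, List.sum_cons, List.sum_nil] at this
        omega
    | some t =>
      rw [hst] at f4
      obtain ⟨tr, g1, g2, g3, g4, -, g5⟩ := f4.exec hmove
        (fun t ht => hwords (some t) (by simpa using ht.1)) (hwords none (by simp))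
      exact ⟨tr, g1, g2, g3, g4, g5⟩

end Body

-- The two algorithms with their explicit constants

section Instances

variable {n : ℕ} {O : Oracle n}

theorem one_le_rank {F : Finset (Finset (Fin n))} (hn : ∃ X ∈ F, X.Nonempty) : 1 ≤ rank F := by
  obtain ⟨X, hX, hne⟩ := hn
  exact (Nat.succ_le_of_lt hne.card_pos).trans (card_le_rank hX)

/-- The time of a query includes issuing it and reading the set; applied to a largest solution this
makes GT exceed q, so that set instructions are no dearer than a constant number of queries. -/
theorem Oracle.MemBound.rank_lt {GT GS : ℕ} (h : O.MemBound GT GS) (hn : ∃ X ∈ O.fam, X.Nonempty) :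
    rank O.fam + 1 ≤ GT := by
  obtain ⟨X, hX, -⟩ := hn
  obtain ⟨Y, hY, hc⟩ := exists_mem_eq_sup O.fam ⟨X, hX⟩ Finset.card
  have h1 : #Y = rank O.fam := hc.symm
  have := (h Y (by omega)).1
  unfold Oracle.queryTime at this
  omega

theorem stateless_basic {GT GS κ : ℕ} (h0 : ∅ ∈ O.fam) (hn : ∃ X ∈ O.fam, X.Nonempty)
    (hs : StronglyAccessible O.fam) (hM : O.MemBound GT GS) (hq : rank O.fam ≤ κ * GS) :
    StatelessVersion (k := 9) (basic O.fam) O (setupProg chooseMinProg)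
      (emitProg ;; moveProg chooseMinProg (basicEnter chooseMinProg) (basicResume chooseMinProg))
      (3000000 * (rank O.fam * 2 ^ rank O.fam * n ^ 2 * GT)) ((60 * κ + 1) * GS) := by
  have hr := one_le_rank hn
  have hGT := hM.rank_lt hn
  have hn1 := hr.trans (rank_le O.fam)
  -- The unit `3 * GT` suffices since 2q + 3 ≤ 3(q + 1) ≤ 3·GT. No lister may be started, so its
  -- bounds are zero.
  let e : Env n :=
    { O := O, may := fun _ _ => False, u := 3 * GT, RT := 0, LS := 0, GS := GS
      B := 36 + 12 * (rank O.fam + 1) + 0 + GS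
      query_le := fun X hX => ⟨(hM X hX).1.trans (by omega), (hM X hX).2⟩
      size_le := by omega
      lister_le := fun _ _ h => h.elim
      space_le := le_rfl }
  have hch := chooseSpec_min (e := e)
  have hTc : e.u ≤ (30 * n + 60) * e.u := Nat.le_mul_of_pos_left _ (by omega)
  refine statelessVersion (e := e) h0 hs hn keyChooser_chooseMin hch hTc hr (sound_basic h0 hn hs) rfl rfl rfl
    (fun t ht => tri_basicEnter h0 hs hch hTc hr ht rfl)
    (fun m S P hS hP => tri_basicResume h0 hs hn hch hTc hr m hS hP) ?_ ?_
  · change 3 * (2000 * (n * 2 ^ rank O.fam * (rank O.fam * ((30 * n + 60) * (3 * GT)))) +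
      1404 * (n * (rank O.fam * ((30 * n + 60) * (3 * GT))))) ≤ _
    set q := rank O.fam
    -- A call of `choose` is linear in n; the second factor n of the delay counts the values of w.
    have h1 : (30 * n + 60) * (3 * GT) ≤ 270 * (n * GT) := by
      calc (30 * n + 60) * (3 * GT) ≤ (90 * n) * (3 * GT) := Nat.mul_le_mul_right _ (by omega)
        _ = _ := by ring
    have h2 : n * (q * ((30 * n + 60) * (3 * GT))) ≤ 270 * (q * 2 ^ q * n ^ 2 * GT) := by
      calc n * (q * ((30 * n + 60) * (3 * GT))) ≤ n * (q * (270 * (n * GT))) := by gcongr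
        _ = 270 * (q * 1 * n ^ 2 * GT) := by ring
        _ ≤ _ := by gcongr; exact Nat.one_le_two_pow
    have h3 : n * 2 ^ q * (q * ((30 * n + 60) * (3 * GT))) ≤ 270 * (q * 2 ^ q * n ^ 2 * GT) := by
      calc n * 2 ^ q * (q * ((30 * n + 60) * (3 * GT))) ≤ n * 2 ^ q * (q * (270 * (n * GT))) := by gcongr
        _ = _ := by ring
    omega
  -- Because q ≥ 1, the fixed part 48 + 12q is at most 60q, and q ≤ κ·GS.
  · change 36 + 12 * (rank O.fam + 1) + 0 + GS ≤ _
    have : (60 * κ + 1) * GS = 60 * (κ * GS) + GS := by ring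
    omega

theorem stateless_refined {GT GS RT RS RB : ℕ} (h0 : ∅ ∈ O.fam) (hn : ∃ X ∈ O.fam, X.Nonempty)
    (hs : StronglyAccessible O.fam) (hc : Commutable O.fam) (hM : O.MemBound GT GS)
    (hR : O.RestrBound RT RS RB) (hq : rank O.fam ≤ RS) (hRB : 1 ≤ RB) :
    StatelessVersion (k := 9) (refined O.fam O.restr) O (setupProg chooseLayProg)
      (emitProg ;; moveProg chooseLayProg (refinedSearch chooseLayProg) (refinedResume chooseLayProg))
      (40000000 * (RT * n + rank O.fam ^ 3 * n * GT * RB * n)) (40000000 * (GS + RS)) := by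
  have hr := one_le_rank hn
  have hGT := hM.rank_lt hn
  have hn1 := hr.trans (rank_le O.fam)
  have hrs : RestrSpec O.fam O.restr := fun P hP w hw => ⟨(hR P hP w hw).1, (hR P hP w hw).2.1⟩
  let e : Env n :=
    { O := O, may := fun P w => IsMaxSol O.fam P ∧ w ∉ P, u := 3 * GT, RT := RT, LS := RS, GS := GS
      B := 36 + 12 * (rank O.fam + 1) + RS + GS
      query_le := fun X hX => ⟨(hM X hX).1.trans (by omega), (hM X hX).2⟩
      size_le := by omega
      lister_le := fun P w h => by
        obtain ⟨-, h2, h3, h4, -⟩ := hR P h.1 w h.2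
        exact ⟨h3, h4, fun R hR => (card_le_rank ((h2 R).1 hR).1.1.1).trans (Nat.le_succ _)⟩
      space_le := le_rfl }
  have hch := chooseSpec_lay (e := e) h0 hs hc
  have hTc : e.u ≤ 500 * (rank O.fam * n * e.u) := by
    rw [← mul_assoc]
    exact Nat.le_mul_of_pos_left _ (Nat.mul_pos (by norm_num) (Nat.mul_pos hr hn1))
  have hmay : ∀ P w, IsMaxSol O.fam P → w ∉ P → e.may P w := fun P w h h' => ⟨h, h'⟩
  have hrestr : ∀ P w, IsMaxSol O.fam P → w ∉ P → (O.restr P w).length ≤ RB ∧ ∀ R ∈ O.restr P w,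
      Maximal (fun X => X ∈ O.fam ∧ X ⊆ insert w P) R ∧ R ≠ P := fun P w h h' =>
    ⟨(hR P h w h').2.2.2.2, fun R hR' => ((hR P h w h').2.1 R).1 hR'⟩
  refine statelessVersion (e := e) h0 hs hn (keyChooser_chooseLay h0 hs) hch hTc hr (sound_refined h0 hn hs hc hrs)
    rfl rfl rfl
    (fun t ht => tri_refinedEnter h0 hs hn hch hTc hr hRB hmay hrestr t ht)
    (fun m S P hS hP => tri_refinedResume h0 hs hn hc hrs hch hTc hr hRB hmay hrestr m hS hP) ?_ ?_
  · change 3 * (6000 * (n * RB * rank O.fam * (rank O.fam * (500 * (rank O.fam * n * (3 * GT))))) + (n + 1) * RT +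
      1404 * (n * (rank O.fam * (500 * (rank O.fam * n * (3 * GT)))))) ≤ _
    set q := rank O.fam
    -- The factors are n·RB·q triples (w, R, s), q calls of `choose` in each pass, and q·n queries
    -- in each call.
    have h1 : n * RB * q * (q * (500 * (q * n * (3 * GT)))) = 1500 * (q ^ 3 * n * GT * RB * n) := by ring
    have h2 : n * (q * (500 * (q * n * (3 * GT)))) ≤ 1500 * (q ^ 3 * n * GT * RB * n) := by
      calc n * (q * (500 * (q * n * (3 * GT)))) = 1500 * (q ^ 2 * n * GT * 1 * n) := by ring
        _ ≤ _ := by gcongr; omega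
    have h3 : (n + 1) * RT ≤ 2 * (RT * n) := by
      calc (n + 1) * RT ≤ (2 * n) * RT := Nat.mul_le_mul_right _ (by omega)
        _ = _ := by ring
    rw [h1, Nat.mul_add 40000000]
    omega
  · change 36 + 12 * (rank O.fam + 1) + RS + GS ≤ _
    omega

end Instances

end MaxEnum

open MaxEnum in
theorem mainTheorem5 :
    (∃ (k : ℕ) (setup body : Cmd (k + 3)) (C : ℕ), ∀ κ : ℕ, ∃ C' : ℕ,
      ∀ (n : ℕ) (O : Oracle n) (GT GS : ℕ),
        ∅ ∈ O.fam → (∃ X ∈ O.fam, X.Nonempty) → StronglyAccessible O.fam →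
        O.MemBound GT GS → rank O.fam ≤ κ * GS →
        StatelessVersion (basic O.fam) O setup body
          (C * (rank O.fam * 2 ^ rank O.fam * n ^ 2 * GT))
          (C' * GS)) ∧
    (∃ (k : ℕ) (setup body : Cmd (k + 3)) (C : ℕ),
      ∀ (n : ℕ) (O : Oracle n) (GT GS RT RS RB : ℕ),
        ∅ ∈ O.fam → (∃ X ∈ O.fam, X.Nonempty) → StronglyAccessible O.fam → Commutable O.fam →
        O.MemBound GT GS → O.RestrBound RT RS RB → rank O.fam ≤ RS → 1 ≤ RB →
        StatelessVersion (refined O.fam O.restr) O setup body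
          (C * (RT * n + rank O.fam ^ 3 * n * GT * RB * n))
          (C * (GS + RS))) :=
  -- Nine registers of each kind besides the three that `encode` presupposes give the twelve of the
  -- programs. Programs and constants are found by unification, which can succeed only because they
  -- do not involve the instance.
  ⟨⟨9, _, _, _, fun _ => ⟨_, fun _ _ _ _ h0 hn hs hM hq => stateless_basic h0 hn hs hM hq⟩⟩,
    ⟨9, _, _, _, fun _ _ _ _ _ _ _ h0 hn hs hc hM hR hq hRB => stateless_refined h0 hn hs hc hM hR hq hRB⟩⟩
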